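/- **Setting.** Let $\Omega\subseteq\mathbb R^d$ and let $K:\Omega\times\Omega\to\mathbb R$ be a symmetric positive definite kernel (every kernel matrix on pairwise distinct points is positive definite) with $K(x,x)\le 1$ for all $x$. Let $\mathcal A\subseteq\Omega$ be a finite non-empty set of arms, $T\ge 1$ a horizon, $R\ge 0$, $\alpha>0$, $0<\delta<1$. Let $f$ lie in the RKHS of $K$, with norm at most $B$. In round $t=1,\dots,T$ the learner pulls an arm $x_t\in\mathcal A$ and observes $y_t=f(x_t)+\varepsilon_t$, where the $\varepsilon_t$ are independent and $R$-sub-Gaussian: $\mathbb E\,e^{\xi\varepsilon_t}\le e^{\xi^2R^2/2}$ for all $\xi\in\mathbb R$. The regret is $R_{\text{APG-PE}}(T)=\max_{x\in\mathcal A}\sum_{t=1}^T\big(f(x)-f(x_t)\big)$. **P-greedy features ($q=1/2$).** Let $\mathfrak e=\alpha/T^{1/2}$. For points $\xi_1,\xi_2,\dots$ put $P_m^2(x)=K(x,x)-\sum_{k\le m}N_k(x)^2$ and $N_{m+1}(x)=\big(K(x,\xi_{m+1})-\sum_{k\le m}N_k(\xi_{m+1})N_k(x)\big)/\sqrt{P_m^2(\xi_{m+1})}$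 (Newton basis). The P-greedy algorithm chooses $\xi_{m+1}\in\arg\max_{x\in\mathcal A}P_m^2(x)$ for $m=0,1,\dots$ and stops after the first $m\ge1$ with $\max_{x\in\mathcal A}P_m^2(x)<\mathfrak e^2$. Let $D=D_{1/2,\alpha}(T)$ be the number of points it returns, and $\widetilde x=(N_1(x),\dots,N_D(x))\in\mathbb R^D$. **Phased Elimination.** Put $m_0=16D\,(1+\lfloor\log_2(\lfloor\log_2D\rfloor+1)\rfloor)$, $m_\ell=2^\ell m_0$ and $\mathcal A_0=\mathcal A$. In phase $\ell=0,1,\dots$ the learner takes a design $\rho$ that depends only on $\mathcal A_\ell$: a probability distribution on $\mathcal A_\ell$ with at most $m_0$ support points such that, with $G(\rho)=\sum_x\rho(x)\widetilde x\widetilde x^{\mathsf T}$, each $\widetilde x$ with $x\in\mathcal A_\ell$ lies in the range of $G(\rho)$ and $\widetilde x^{\mathsf T}G(\rho)^{-1}\widetilde x\le 2D$ (inverse on the range). It pulls each arm $x$ exactly $\lceil m_\ell\,\rho(x)\rceil$ times (in a fixed order of the arms), computes the least-squares estimate $\hat\theta$ from the rewards of this phase, and sets $$\mathcal A_{\ell+1}=\Big\{x\in\mathcal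 A_\ell:\max_{z\in\mathcal A_\ell}\langle\hat\theta,\widetilde z-\widetilde x\rangle\le 4R\sqrt{\tfrac{D}{m_\ell}\log\tfrac{2|\mathcal A|(\lfloor\log_2T\rfloor+1)}{\delta}}\Big\}.$$ The run ends after $T$ rounds, possibly within a phase. (If $T\le m_0$, so that no estimate can be used, the P-greedy points are pulled in cyclic order.) APG-PE is Phased Elimination with the features $\widetilde x$. **Theorem (thm:app-pe).** There are universal constants $C,c$ such that in this setting the following hold. 1. For every way to break ties in the P-greedy algorithm and every choice of the designs, with probability at least $1-\delta$, $$R_{\text{APG-PE}}(T)\le C\,\big(R+(1+\alpha)B\big)(1+\log T)^c\sqrt{T\,D_{1/2,\alpha}(T)\,\log(|\mathcal A|/\delta)} .$$ 2. APG-PE (with some tie-breaking and some choice of designs as above) is carried out, for every sequence of rewards, by one explicit program — P-greedy algorithm with Newton basis, designs by a Frank–Wolfe iteration, rank-one updates for the least-squares estimates — whose total number of steps is at most $$C\,(1+\log T)^c\,(|\mathcal A|+T)\,D_{1/2,\alpha}(T)^2 .$$ A step is an exact real arithmetic operation, square root, logarithm, comparison, loading of an integer, evaluation of $K$ at two arms,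 pull of an arm, or a bookkeeping step for an array entry or list item. -/

import Mathlib

open scoped NNReal Matrix

namespace APG

/-! ## Kernels and the P-greedy algorithm -/

/-- A symmetric, (strictly) positive definite kernel: every kernel matrix on pairwise distinct
points is positive definite. -/
def IsPosDefKernel {X : Type*} (K : X → X → ℝ) : Prop :=
  (∀ x y, K x y = K y x) ∧
    ∀ (m : ℕ) (x : Fin m → X), Function.Injective x →
      (Matrix.of fun i j => K (x i) (x j)).PosDef

/-- The Newton basis of the points `ξ 0, ξ 1, …` (indices start at `0`):
`N m x = (K x (ξ m) - ∑ k < m, N k (ξ m) * N k x) / √(P m ^ 2 (ξ m))` where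
`P m ^ 2 x = K x x - ∑ k < m, N k x ^ 2`. -/
noncomputable def newton {X : Type*} (K : X → X → ℝ) (ξ : ℕ → X) (m : ℕ) (x : X) : ℝ :=
  (K x (ξ m) - ∑ k : Fin m, newton K ξ k (ξ m) * newton K ξ k x) /
    Real.sqrt (K (ξ m) (ξ m) - ∑ k : Fin m, newton K ξ k (ξ m) ^ 2)
termination_by m
decreasing_by all_goals exact k.2

/-- The squared power function `P m ^ 2` of the first `m` points. -/
noncomputable def powerSq {X : Type*} (K : X → X → ℝ) (ξ : ℕ → X) (m : ℕ) (x : X) : ℝ :=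
  K x x - ∑ k : Fin m, newton K ξ k x ^ 2

/-- `ξ 0, …, ξ (D - 1)` are the points returned by some run (some way to break ties) of the
P-greedy algorithm with admissible error `e`, applied to the whole type `X`. The first point is
always selected; afterwards the run stops as soon as `max P m ^ 2 < e ^ 2`. -/
def IsPGreedy {X : Type*} (K : X → X → ℝ) (e : ℝ) (ξ : ℕ → X) (D : ℕ) : Prop :=
  1 ≤ D ∧
  (∀ m < D, ∀ x, powerSq K ξ m x ≤ powerSq K ξ m (ξ m)) ∧
  (∀ m, 1 ≤ m → m < D → ∃ x, e ^ 2 ≤ powerSq K ξ m x) ∧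
  ∀ x, powerSq K ξ D x < e ^ 2

/-- The feature vector `x ↦ (N 0 x, …, N (D - 1) x)`. -/
noncomputable def feature {X : Type*} (K : X → X → ℝ) (ξ : ℕ → X) (D : ℕ) (x : X) :
    Fin D → ℝ :=
  fun k => newton K ξ k x

/-! ## Phased elimination for `n` arms with feature vectors in `ℝ ^ D` -/

/-- The number of rounds for which the first phase is planned, and also the bound on the support
of the designs: a constant times `D log log D`. -/
def firstPhase (D : ℕ) : ℕ := 16 * D * (1 + Nat.log 2 (Nat.log 2 D + 1))

/-- The matrix `∑ i, w i • φ i (φ i)ᵀ`. -/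
def gram {n D : ℕ} (φ : Fin n → Fin D → ℝ) (w : Fin n → ℝ) : Matrix (Fin D) (Fin D) ℝ :=
  ∑ i, w i • Matrix.vecMulVec (φ i) (φ i)

/-- `ρ` is a near-optimal design on the set `S` of arms: a probability distribution on `S` with
small support, such that each feature vector `a` of an arm in `S` is in the range of `G = gram φ ρ`
and its squared Mahalanobis norm `aᵀ G⁻¹ a` (with the inverse taken on the range of `G`) is at
most `2 D`. -/
def IsDesign {n D : ℕ} (φ : Fin n → Fin D → ℝ) (S : Finset (Fin n)) (ρ : Fin n → ℝ) : Prop :=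
  (∀ i, 0 ≤ ρ i) ∧ (∀ i, i ∉ S → ρ i = 0) ∧ ∑ i, ρ i = 1 ∧
  (Finset.univ.filter fun i => ρ i ≠ 0).card ≤ firstPhase D ∧
  ∀ i ∈ S, ∃ w, gram φ ρ *ᵥ w = φ i ∧ φ i ⬝ᵥ w ≤ 2 * D

/-- A rule that chooses a near-optimal design for each non-empty set of active arms. -/
def IsDesignRule {n D : ℕ} (φ : Fin n → Fin D → ℝ) (ρ : Finset (Fin n) → Fin n → ℝ) : Prop :=
  ∀ S : Finset (Fin n), S.Nonempty → IsDesign φ S (ρ S)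

/-- Planned length of phase `l`. -/
def phaseLength (D l : ℕ) : ℕ := firstPhase D * 2 ^ l

/-- The number of times each arm is pulled in phase `l`, for the design `ρ`. -/
noncomputable def pullCount {n : ℕ} (D l : ℕ) (ρ : Fin n → ℝ) (i : Fin n) : ℕ :=
  ⌈(phaseLength D l : ℝ) * ρ i⌉₊

/-- The sequence of arms in which each arm `i` occurs `u i` times. -/
def pullList {n : ℕ} (u : Fin n → ℕ) : List (Fin n) :=
  (List.finRange n).flatMap fun i => List.replicate (u i) i

/-- The least-squares estimate from the arms `arms` with rewards `r`: a solution of the normal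
equations (they always have one; `⟨θ, φ i⟩` is the same for all of them when `φ i` is in the span
of the feature vectors of `arms`). -/
noncomputable def leastSquares {n D : ℕ} (φ : Fin n → Fin D → ℝ) (arms : List (Fin n))
    (r : Fin arms.length → ℝ) : Fin D → ℝ :=
  Classical.epsilon fun θ =>
    (∑ s, Matrix.vecMulVec (φ (arms.get s)) (φ (arms.get s))) *ᵥ θ = ∑ s, r s • φ (arms.get s)

/-- The confidence term `log (1 / δ')`: here `δ'` is `δ`, divided by twice the number of arms and
by a bound on the number of phases that end before round `T`. -/
noncomputable def confidence (n T : ℕ) (δ : ℝ) : ℝ :=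
  Real.log (2 * n * (Nat.log 2 T + 1 : ℕ) / δ)

/-- The elimination threshold of phase `l`. -/
noncomputable def threshold (n D T : ℕ) (R δ : ℝ) (l : ℕ) : ℝ :=
  4 * R * Real.sqrt (D / phaseLength D l * confidence n T δ)

/-- The active arms and the sequence of all pulled arms after `l` phases of phased elimination,
when `y t i` is the reward observed if arm `i` is pulled in round `t` (rounds start at `0`). -/
noncomputable def phases {n D : ℕ} (φ : Fin n → Fin D → ℝ) (ρ : Finset (Fin n) → Fin n → ℝ)
    (T : ℕ) (R δ : ℝ) (y : ℕ → Fin n → ℝ) : ℕ → Finset (Fin n) × List (Fin n)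
  | 0 => (Finset.univ, [])
  | l + 1 =>
    let S := (phases φ ρ T R δ y l).1
    let past := (phases φ ρ T R δ y l).2
    let new := pullList (pullCount D l (ρ S))
    let θ := leastSquares φ new fun s => y (past.length + s) (new.get s)
    (S.filter fun i => ∀ j ∈ S, θ ⬝ᵥ φ j - θ ⬝ᵥ φ i ≤ threshold n D T R δ l, past ++ new)

/-- The arms that APG-PE pulls in rounds `0, …, T - 1`: phased elimination on the P-greedy
features. (Each phase has at least one round, so the first `T` rounds lie in the first `T` phases.)
When the horizon is not longer than the first phase, no estimate is ever used; then the arms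
of this unfinished phase are simply the P-greedy points in cyclic order, and no design is
needed. -/
noncomputable def arms {n : ℕ} (K : Fin n → Fin n → ℝ) (ξ : ℕ → Fin n) (D : ℕ)
    (ρ : Finset (Fin n) → Fin n → ℝ) (T : ℕ) (R δ : ℝ) (y : ℕ → Fin n → ℝ) : List (Fin n) :=
  if T ≤ firstPhase D then (List.range T).map fun t => ξ (t % D)
  else (phases (feature K ξ D) ρ T R δ y T).2.take T

/-- The regret of the sequence `a` of arms, when `g i` is the mean reward of arm `i`. -/
noncomputable def regret {n : ℕ} (g : Fin n → ℝ) (a : List (Fin n)) : ℝ :=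
  ⨆ i, (a.map fun j => g i - g j).sum

/-! ## Programs with a step count

A program computes with values of a type `V` (the real numbers in the theorem), on which it can act
only by the instructions below. Each instruction costs one step. Arrays are functions on `Fin k`;
they are filled entry by entry with `tab`. Lists grow by appending one item, and each pass through
a list is charged one step per item; the integer arithmetic on indices and counters that
accompanies an instruction is not charged separately. -/

/-- The binary arithmetic operations. -/
inductive BinOp
  | add | sub | mul | div

/-- The unary operations. -/
inductive UnOp
  | sqrt | log

/-- Programs for a learner with `n` arms that return an element of `α`. -/
inductive Prog (V : Type) (n : ℕ) (α : Type) : Type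
  /-- End of the program, with its result. -/
  | ret (a : α)
  /-- Load a natural number as a value. -/
  | const (k : ℕ) (next : V → Prog V n α)
  /-- Arithmetic operation. -/
  | bin (op : BinOp) (x y : V) (next : V → Prog V n α)
  /-- Square root or logarithm. -/
  | un (op : UnOp) (x : V) (next : V → Prog V n α)
  /-- Test whether `x ≤ y`. -/
  | test (x y : V) (next : Bool → Prog V n α)
  /-- Evaluate the kernel at two arms. -/
  | kernel (i j : Fin n) (next : V → Prog V n α)
  /-- Pull an arm and observe the reward. -/
  | pull (i : Fin n) (next : V → Prog V n α)
  /-- A step of bookkeeping (writing an entry of an array, passing to the next item of a list). -/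
  | tick (next : Prog V n α)

/-- Sequential composition. -/
def Prog.bind {V : Type} {n : ℕ} {α β : Type} :
    Prog V n α → (α → Prog V n β) → Prog V n β
  | .ret a, f => f a
  | .const k next, f => .const k fun v => (next v).bind f
  | .bin op x y next, f => .bin op x y fun v => (next v).bind f
  | .un op x next, f => .un op x fun v => (next v).bind f
  | .test x y next, f => .test x y fun b => (next b).bind f
  | .kernel i j next, f => .kernel i j fun v => (next v).bind f
  | .pull i next, f => .pull i fun v => (next v).bind f
  | .tick next, f => .tick (next.bind f)

instance {V : Type} {n : ℕ} : Monad (Prog V n) where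
  pure := Prog.ret
  bind := Prog.bind

/-- What is seen of an execution: the result, the number of steps, the arms pulled, in order. -/
structure Outcome (n : ℕ) (α : Type) where
  value : α
  steps : ℕ
  pulled : List (Fin n)

/-- Exact real arithmetic. -/
noncomputable def BinOp.eval : BinOp → ℝ → ℝ → ℝ
  | .add, x, y => x + y
  | .sub, x, y => x - y
  | .mul, x, y => x * y
  | .div, x, y => x / y

/-- Exact real functions. -/
noncomputable def UnOp.eval : UnOp → ℝ → ℝ
  | .sqrt, x => Real.sqrt x
  | .log, x => Real.log x

/-- Add one step. -/
def Outcome.charge {n : ℕ} {α : Type} (o : Outcome n α) : Outcome n α :=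
  { o with steps := o.steps + 1 }

open Classical in
/-- Execution over the real numbers from round `t` on, for the kernel `K` and the rewards `y`. -/
noncomputable def Prog.exec {n : ℕ} {α : Type} (K : Fin n → Fin n → ℝ) (y : ℕ → Fin n → ℝ) :
    Prog ℝ n α → ℕ → Outcome n α
  | .ret a, _ => ⟨a, 0, []⟩
  | .const k next, t => ((next k).exec K y t).charge
  | .bin op x z next, t => ((next (op.eval x z)).exec K y t).charge
  | .un op x next, t => ((next (op.eval x)).exec K y t).charge
  | .test x z next, t => ((next (decide (x ≤ z))).exec K y t).charge
  | .kernel i j next, t => ((next (K i j)).exec K y t).charge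
  | .pull i next, t =>
    let o := (next (y t i)).exec K y (t + 1)
    ⟨o.value, o.steps + 1, i :: o.pulled⟩
  | .tick next, t => (next.exec K y t).charge

section Code

variable {V : Type} {n : ℕ}

/-! ### Single instructions and loops -/

def nat (k : ℕ) : Prog V n V := .const k .ret
def add (x y : V) : Prog V n V := .bin .add x y .ret
def sub (x y : V) : Prog V n V := .bin .sub x y .ret
def mul (x y : V) : Prog V n V := .bin .mul x y .ret
def div (x y : V) : Prog V n V := .bin .div x y .ret
def sqrt (x : V) : Prog V n V := .un .sqrt x .ret
def log (x : V) : Prog V n V := .un .log x .ret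
def leq (x y : V) : Prog V n Bool := .test x y .ret
def ker (i j : Fin n) : Prog V n V := .kernel i j .ret
def pullArm (i : Fin n) : Prog V n V := .pull i .ret

/-- Fill an array of length `k`. -/
def tab {β : Type} : (k : ℕ) → (Fin k → Prog V n β) → Prog V n (Fin k → β)
  | 0, _ => pure Fin.elim0
  | k + 1, f => do
    let x ← f 0
    let v ← tab k fun i => f i.succ
    .tick (pure (Fin.cons x v))

/-- Fill a `k × m` array. -/
def tab₂ (k m : ℕ) (f : Fin k → Fin m → Prog V n V) : Prog V n (Fin k → Fin m → V) :=
  tab k fun i => tab m fun j => f i j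

/-- Run through a list, updating a state. -/
def loop {β σ : Type} : List β → σ → (σ → β → Prog V n σ) → Prog V n σ
  | [], s, _ => pure s
  | b :: l, s, f => do
    let s' ← f s b
    .tick (loop l s' f)

/-- Sum over a list. -/
def sumList {β : Type} (l : List β) (f : β → Prog V n V) : Prog V n V := do
  let z ← nat 0
  loop l z fun acc b => do add acc (← f b)

/-- Inner product. -/
def dot {k : ℕ} (v w : Fin k → V) : Prog V n V :=
  sumList (List.finRange k) fun i => mul (v i) (w i)

/-- Matrix times vector. -/
def mulVec {k : ℕ} (H : Fin k → Fin k → V) (v : Fin k → V) : Prog V n (Fin k → V) :=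
  tab k fun i => dot (H i) v

/-- The first maximizer of `v` in the list `a :: l`. -/
def argmax (v : Fin n → V) (a : Fin n) (l : List (Fin n)) : Prog V n (Fin n) :=
  loop l a fun best i => do
    if ← leq (v i) (v best) then pure best else pure i

/-- The least natural number `≥ v` among `k, …, k + fuel`. -/
def ceil (v : V) : (fuel k : ℕ) → Prog V n ℕ
  | 0, k => pure k
  | fuel + 1, k => do
    if ← leq v (← nat k) then pure k else ceil v fuel (k + 1)

/-! ### The P-greedy algorithm -/

/-- The points selected so far, the values of their Newton basis, and the squared power
function. -/
structure GreedyState (V : Type) (n : ℕ) where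
  points : List (Fin n)
  basis : List (Fin n → V)
  power : Fin n → V

/-- Add the point `p` and its Newton basis function. -/
def greedyStep (st : GreedyState V n) (p : Fin n) : Prog V n (GreedyState V n) := do
  let s ← sqrt (st.power p)
  let N ← tab n fun i => do
    let k ← ker i p
    let c ← sumList st.basis fun b => mul (b p) (b i)
    div (← sub k c) s
  let P ← tab n fun i => do sub (st.power i) (← mul (N i) (N i))
  .tick (pure ⟨st.points ++ [p], st.basis ++ [N], P⟩)

/-- Add points as long as the maximum of the squared power function is at least `e2`. -/
def greedyLoop [NeZero n] (e2 : V) :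
    (fuel : ℕ) → GreedyState V n → Prog V n (GreedyState V n)
  | 0, st => pure st
  | fuel + 1, st => do
    let p ← argmax st.power 0 (List.finRange n)
    if ← leq e2 (st.power p) then
      greedyLoop e2 fuel (← greedyStep st p)
    else pure st

/-- The P-greedy algorithm with squared admissible error `e2`. It selects at most `n` points. -/
def greedy [NeZero n] (e2 : V) : Prog V n (GreedyState V n) := do
  let P ← tab n fun i => ker i i
  let p ← argmax P 0 (List.finRange n)
  greedyLoop e2 n (← greedyStep ⟨[], [], P⟩ p)

/-! ### Near-optimal designs -/

/-- State of the elimination by columns: an arm `i` has the feature vector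
`res i + ∑ j, coord i j • φ (pivot of column j)`. -/
structure ElimState (V : Type) (n D : ℕ) where
  res : Fin n → Fin D → V
  coord : Fin n → Fin D → V
  pivots : List (Fin n)

/-- Eliminate column `k`; the pivot is an arm in `a :: l` with the largest entry. Columns without
a non-zero entry are skipped. -/
def elimColumn {D : ℕ} (a : Fin n) (l : List (Fin n)) (st : ElimState V n D) (k : Fin D) :
    Prog V n (ElimState V n D) := do
  let sq ← tab n fun i => mul (st.res i k) (st.res i k)
  let p ← argmax sq a l
  if ← leq (sq p) (← nat 0) then pure st else do
    let t ← tab n fun i => div (st.res i k) (st.res p k)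
    let res ← tab₂ n D fun i j => do sub (st.res i j) (← mul (t i) (st.res p j))
    let coord ← tab₂ n D fun i j =>
      if j = k then pure (t i) else do sub (st.coord i j) (← mul (t i) (st.coord p j))
    .tick (pure ⟨res, coord, st.pivots ++ [p]⟩)

/-- Coordinates of the arms in `a :: l` with respect to a basis (the pivots) among them. -/
def coordinates {D : ℕ} (φ : Fin n → Fin D → V) (a : Fin n) (l : List (Fin n)) :
    Prog V n (ElimState V n D) := do
  let c ← tab₂ n D fun _ _ => nat 0
  loop (List.finRange D) ⟨φ, c, []⟩ (elimColumn a l)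

/-- State of the Frank-Wolfe iteration: the design, the inverse of its matrix (in coordinates),
the squared Mahalanobis norms. -/
structure DesignState (V : Type) (n D : ℕ) where
  weight : Fin n → V
  inv : Fin D → Fin D → V
  lev : Fin n → V

/-- Start: the uniform distribution on the pivots (or one arm, if there are no pivots). -/
def designInit {D : ℕ} (st : ElimState V n D) (a : Fin n) : Prog V n (DesignState V n D) := do
  let zero ← nat 0
  let one ← nat 1
  let r ← nat st.pivots.length
  let H ← tab₂ D D fun i j => pure (if i = j then r else zero)
  let lev ← tab n fun i => do mul r (← dot (st.coord i) (st.coord i))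
  let w₀ ← tab n fun _ => pure zero
  let w ← match st.pivots with
    | [] => tab n fun i => pure (if i = a then one else w₀ i)
    | _ :: _ => do
      let q ← div one r
      loop st.pivots w₀ fun w p => tab n fun i => pure (if i = p then q else w i)
  pure ⟨w, H, lev⟩

/-- Frank-Wolfe iteration with step size `1 / (2 r)`, where `r` is the dimension of the span,
until all squared Mahalanobis norms are at most `2 D`. -/
def designLoop {D : ℕ} (c : Fin n → Fin D → V) (r : ℕ) (a : Fin n) (l : List (Fin n)) :
    (fuel : ℕ) → DesignState V n D → Prog V n (DesignState V n D)
  | 0, st => pure st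
  | fuel + 1, st => do
    let p ← argmax st.lev a l
    if ← leq (st.lev p) (← nat (2 * D)) then pure st else do
      let s ← div (← nat (2 * r)) (← nat (2 * r - 1))
      let den ← add (← nat (2 * r - 1)) (st.lev p)
      let g ← mulVec st.inv (c p)
      let H ← tab₂ D D fun i j => do
        mul s (← sub (st.inv i j) (← div (← mul (g i) (g j)) den))
      let lev ← tab n fun i => do
        let q ← dot (c i) g
        mul s (← sub (st.lev i) (← div (← mul q q) den))
      let step ← div (← nat 1) (← nat (2 * r))
      let w ← tab n fun i => do
        let v ← div (st.weight i) s
        if i = p then add v step else pure v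
      designLoop c r a l fuel ⟨w, H, lev⟩

/-! ### Phased elimination -/

/-- `(H⁻¹ + w v vᵀ)⁻¹` by the Sherman-Morrison formula. -/
def rankOne {D : ℕ} (H : Fin D → Fin D → V) (w : V) (v : Fin D → V) :
    Prog V n (Fin D → Fin D → V) := do
  let g ← mulVec H v
  let den ← add (← nat 1) (← mul w (← dot v g))
  let q ← div w den
  tab₂ D D fun i j => do sub (H i j) (← mul q (← mul (g i) (g j)))

/-- The phases from phase `ph` on, with active arms `S` and `N` remaining rounds. At most `fuel`
phases are run. Here `conf` is the confidence term. -/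
def phaseLoop {D : ℕ} (φ : Fin n → Fin D → V) (R conf : V) :
    (fuel ph : ℕ) → (S : List (Fin n)) → (N : ℕ) → Prog V n Unit
  | 0, _, _, _ => pure ()
  | _ + 1, _, [], _ => pure ()
  | fuel + 1, ph, a :: l, N => do
    -- the design
    let el ← coordinates φ a l
    let c := el.coord
    let d ← designLoop c el.pivots.length a l
      (15 * D * (1 + Nat.log 2 (Nat.log 2 D + 1))) (← designInit el a)
    -- the number of pulls for each arm
    let m ← nat (phaseLength D ph)
    let mw ← tab n fun i => mul m (d.weight i)
    let u ← tab n fun i => ceil (mw i) (phaseLength D ph) 0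
    -- the inverse of the matrix of the normal equations (in coordinates)
    let H₀ ← tab₂ D D fun i j => div (d.inv i j) m
    let H ← loop (a :: l) H₀ fun H i => do
      rankOne H (← sub (← nat (u i)) (mw i)) (c i)
    -- the pulls
    let new := (pullList u).take N
    let b₀ ← tab D fun _ => nat 0
    let b ← loop new b₀ fun b i => do
      let y ← pullArm i
      tab D fun j => do add (b j) (← mul y (c i j))
    if N ≤ new.length then pure () else do
      -- the estimate and the elimination
      let θ ← mulVec H b
      let score ← tab n fun i => dot (c i) θ
      let best ← argmax score a l
      let thr ← mul (← mul (← nat 4) R) (← sqrt (← mul (← div (← nat D) m) conf))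
      let S' ← loop (a :: l) [] fun S' i => do
        if ← leq (← sub (score best) (score i)) thr then pure (S' ++ [i]) else pure S'
      phaseLoop φ R conf fuel (ph + 1) S' (N - new.length)

/-- APG-PE with `q = 1 / 2`: horizon `T`, sub-Gaussian parameter `R`, admissible error
`α / T ^ (1 / 2)`, confidence parameter `δ`. -/
def apgPE [NeZero n] (T : ℕ) (R α δ : V) : Prog V n Unit := do
  let e2 ← div (← mul α α) (← nat T)
  let st ← greedy e2
  let D := st.basis.length
  if T ≤ firstPhase D then
    loop (List.range T) () fun _ t => do
      let _ ← pullArm (st.points.getD (t % D) 0)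
      pure ()
  else
    let conf ← log (← div (← nat (2 * n * (Nat.log 2 T + 1))) δ)
    phaseLoop (fun i (k : Fin D) => st.basis.get k i) R conf T 0 (List.finRange n) T

end Code

end APG

/-!
# Regret and running time of APG-PE

*Regret.* In the space of a feature map of the kernel, the Newton basis is a Gram-Schmidt
orthonormalization, and the power function is the distance to the span of the selected points
(`inner_newtonVec_aux`). When the P-greedy algorithm stops, a function of norm `B` is therefore
linear in the features up to an error of `α B / √T` at all arms (`exists_abs_inner_sub_le`). For
phased elimination this is a misspecified linear bandit. The prediction of the least-squares
estimate is a linear function of the rewards with coefficients `⟨φ, w⟩`, where `w` solves the normal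
equations; the design makes the sum of the squared coefficients at most `2 D / m`, so that the
misspecification costs at most `1 + 2 √D` times its size (`abs_leastSquares_sub_le`). The noise part
is sub-Gaussian after conditioning on the history of the earlier phases, which determines the active
arms and is independent of the noise of the current phase (`measure_phase_noise_le`). A union bound
over arms and phases shows that all predictions are accurate with probability `1 - δ`
(`measure_forall_isAccurate`). Then the arms that survive phase `l` are near-optimal, and each of
the `O(log T)` phases contributes a regret of the order `√(T D)`, up to logarithms
(`sum_take_phases_le`).

*Running time.* `Spec` and `Runs` are a small program logic that bounds the steps of a program
together with its result; it is applied to the code part by part. Two points are not bookkeeping.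

* The program computes designs by `15 D (1 + log log D)` steps of a Frank-Wolfe iteration with the
  fixed step size `1 / (2 r)`, and these must suffice. While some squared Mahalanobis norm exceeds
  `2 D`, a step multiplies `1 + δ` by at most `1 - 1 / (20 r)`, where `r δ` is the amount by which
  the logarithm of the determinant stays behind that of the last design (`one_add_gap_le`; the gap
  is bounded by `r log (max norm / r)`, see `det_wgram_le`). Initially `δ ≤ log r`: the elimination
  by columns chooses maximal pivots, so that a unitriangular change of coordinates maps all active
  arms to the cube `[-1, 1] ^ r`, hence no design has a determinant greater than `1`
  (`ElimInv.det_le_one`), and the uniform distribution on the pivots has determinant `r ^ (-r)`. If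
  the iteration used up its steps, this would contradict `one_add_log_mul_pow_lt_one`.
* Each phase costs `O(n D²)` for the inverse of the matrix of the normal equations. It is not
  computed from scratch: it is the inverse for the design, divided by `m`, after one
  Sherman-Morrison update per arm that accounts for the rounding of the pull counts
  (`IsInv.update`, `spec_updates`). All this happens in coordinates with respect to the pivots, in
  which the matrix is invertible on the span of the active arms; `ElimInv.exists_gram_mulVec_eq`
  translates solutions of the normal equations back.
-/

namespace APG

/-! ### Weighted Gram matrices and least squares -/

/-- A real symmetric matrix maps onto the orthogonal complement of its kernel. -/
lemma exists_mulVec_eq_of_symm {ι : Type*} [Fintype ι] {A : Matrix ι ι ℝ}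
    (hA : A.transpose = A) (b : ι → ℝ) (hb : ∀ v, A *ᵥ v = 0 → b ⬝ᵥ v = 0) :
    ∃ w, A *ᵥ w = b := by
  classical
  by_contra h
  have hnot : b ∉ LinearMap.range A.mulVecLin := by
    rintro ⟨w, hw⟩
    exact h ⟨w, hw⟩
  obtain ⟨f, hf, hle⟩ := Submodule.exists_le_ker_of_notMem hnot
  obtain ⟨v, hv⟩ := (dotProductEquiv ℝ ι).surjective f
  have hfv : ∀ x, f x = v ⬝ᵥ x := fun x => by rw [← hv]; rfl
  have hAv : A *ᵥ v = 0 := by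
    apply dotProduct_eq_zero
    intro u
    have h1 : f (A *ᵥ u) = 0 := hle ⟨u, rfl⟩
    rw [hfv, Matrix.dotProduct_mulVec, ← Matrix.mulVec_transpose, hA] at h1
    exact h1
  apply hf
  rw [hfv, dotProduct_comm]
  exact hb v hAv

lemma gram_mulVec {n D : ℕ} (φ : Fin n → Fin D → ℝ) (w : Fin n → ℝ) (v : Fin D → ℝ) :
    gram φ w *ᵥ v = ∑ i, (w i * (φ i ⬝ᵥ v)) • φ i := by
  unfold gram
  rw [Matrix.sum_mulVec]
  refine Finset.sum_congr rfl fun i _ => ?_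
  rw [Matrix.smul_mulVec, Matrix.vecMulVec_mulVec, op_smul_eq_smul, smul_smul]

lemma dotProduct_gram_mulVec {n D : ℕ} (φ : Fin n → Fin D → ℝ) (w : Fin n → ℝ)
    (u v : Fin D → ℝ) :
    u ⬝ᵥ gram φ w *ᵥ v = ∑ i, w i * ((φ i ⬝ᵥ u) * (φ i ⬝ᵥ v)) := by
  rw [gram_mulVec, dotProduct_sum]
  refine Finset.sum_congr rfl fun i _ => ?_
  rw [dotProduct_smul, smul_eq_mul, dotProduct_comm u]
  ring

lemma gram_transpose {n D : ℕ} (φ : Fin n → Fin D → ℝ) (w : Fin n → ℝ) :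
    (gram φ w).transpose = gram φ w := by
  unfold gram
  rw [Matrix.transpose_sum]
  refine Finset.sum_congr rfl fun i _ => ?_
  rw [Matrix.transpose_smul, Matrix.transpose_vecMulVec]

lemma dotProduct_gram_mulVec_comm {n D : ℕ} (φ : Fin n → Fin D → ℝ) (w : Fin n → ℝ)
    (u v : Fin D → ℝ) : u ⬝ᵥ gram φ w *ᵥ v = v ⬝ᵥ gram φ w *ᵥ u := by
  simp only [dotProduct_gram_mulVec]
  exact Finset.sum_congr rfl fun i _ => by ring

lemma dotProduct_gram_mulVec_self_nonneg {n D : ℕ} (φ : Fin n → Fin D → ℝ) {w : Fin n → ℝ}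
    (hw : ∀ i, 0 ≤ w i) (u : Fin D → ℝ) : 0 ≤ u ⬝ᵥ gram φ w *ᵥ u := by
  rw [dotProduct_gram_mulVec]
  exact Finset.sum_nonneg fun i _ => mul_nonneg (hw i) (mul_self_nonneg _)

/-- The range of a Gram matrix contains the combinations of the vectors with non-zero weight. -/
lemma exists_gram_mulVec_eq_sum {n D : ℕ} (φ : Fin n → Fin D → ℝ) {w : Fin n → ℝ}
    (hw : ∀ i, 0 ≤ w i) (a : Fin n → ℝ) (ha : ∀ i, w i = 0 → a i = 0) :
    ∃ v, gram φ w *ᵥ v = ∑ i, a i • φ i := by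
  refine exists_mulVec_eq_of_symm (gram_transpose φ w) _ fun v hv => ?_
  have h0 : v ⬝ᵥ gram φ w *ᵥ v = 0 := by rw [hv, dotProduct_zero]
  rw [dotProduct_gram_mulVec, Finset.sum_eq_zero_iff_of_nonneg
    (fun i _ => mul_nonneg (hw i) (mul_self_nonneg _))] at h0
  rw [sum_dotProduct]
  refine Finset.sum_eq_zero fun i hi => ?_
  rw [smul_dotProduct, smul_eq_mul]
  rcases mul_eq_zero.1 (h0 i hi) with h | h
  · rw [ha i h, zero_mul]
  · rw [mul_self_eq_zero.1 h, mul_zero]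

/-- If the weights `u` dominate `m • ρ`, then the Mahalanobis norm for `u` is smaller than the one
for `ρ` by the factor `m`. -/
lemma exists_gram_mulVec_eq_of_le {n D : ℕ} (φ : Fin n → Fin D → ℝ) {ρ u : Fin n → ℝ} {m c : ℝ}
    (hm : 0 < m) (hρ : ∀ i, 0 ≤ ρ i) (hu : ∀ i, m * ρ i ≤ u i) {b v : Fin D → ℝ}
    (hv : gram φ ρ *ᵥ v = b) (hc : b ⬝ᵥ v ≤ c) :
    ∃ w, gram φ u *ᵥ w = b ∧ b ⬝ᵥ w ≤ c / m ∧ 0 ≤ b ⬝ᵥ w := by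
  have hu0 : ∀ i, 0 ≤ u i := fun i => (mul_nonneg hm.le (hρ i)).trans (hu i)
  obtain ⟨w, hw⟩ := exists_gram_mulVec_eq_sum φ hu0 (fun i => ρ i * (φ i ⬝ᵥ v)) (by
    intro i hi
    have : ρ i = 0 := by
      have := hu i
      rw [hi] at this
      nlinarith [hρ i]
    simp [this])
  rw [← gram_mulVec, hv] at hw
  have hq0 : 0 ≤ b ⬝ᵥ w := by
    have := dotProduct_gram_mulVec_self_nonneg φ hu0 w
    rwa [hw, dotProduct_comm] at this
  refine ⟨w, hw, ?_, hq0⟩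
  -- Cauchy-Schwarz for the quadratic form of `ρ`
  have hcs : (b ⬝ᵥ w) ^ 2 ≤ (b ⬝ᵥ v) * (w ⬝ᵥ gram φ ρ *ᵥ w) := by
    have e1 : b ⬝ᵥ w = ∑ i, (Real.sqrt (ρ i) * (φ i ⬝ᵥ v)) * (Real.sqrt (ρ i) * (φ i ⬝ᵥ w)) := by
      rw [dotProduct_comm, ← hv, dotProduct_gram_mulVec]
      refine Finset.sum_congr rfl fun i _ => ?_
      nth_rewrite 1 [← Real.mul_self_sqrt (hρ i)]
      ring
    have e2 : b ⬝ᵥ v = ∑ i, (Real.sqrt (ρ i) * (φ i ⬝ᵥ v)) ^ 2 := by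
      rw [dotProduct_comm, ← hv, dotProduct_gram_mulVec]
      refine Finset.sum_congr rfl fun i _ => ?_
      rw [mul_pow, Real.sq_sqrt (hρ i), sq]
    have e3 : w ⬝ᵥ gram φ ρ *ᵥ w = ∑ i, (Real.sqrt (ρ i) * (φ i ⬝ᵥ w)) ^ 2 := by
      rw [dotProduct_gram_mulVec]
      refine Finset.sum_congr rfl fun i _ => ?_
      rw [mul_pow, Real.sq_sqrt (hρ i), sq]
    rw [e1, e2, e3]
    exact Finset.sum_mul_sq_le_sq_mul_sq _ _ _
  have hmono : m * (w ⬝ᵥ gram φ ρ *ᵥ w) ≤ b ⬝ᵥ w := by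
    have : b ⬝ᵥ w = w ⬝ᵥ gram φ u *ᵥ w := by rw [hw, dotProduct_comm]
    rw [this, dotProduct_gram_mulVec, dotProduct_gram_mulVec, Finset.mul_sum]
    refine Finset.sum_le_sum fun i _ => ?_
    rw [← mul_assoc]
    exact mul_le_mul_of_nonneg_right (hu i) (mul_self_nonneg _)
  have hv0 : 0 ≤ b ⬝ᵥ v := by
    have := dotProduct_gram_mulVec_self_nonneg φ hρ v
    rwa [hv, dotProduct_comm] at this
  rw [le_div_iff₀ hm]
  by_cases h0 : b ⬝ᵥ w = 0
  · rw [h0, zero_mul]; exact hv0.trans hc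
  · have hpos : 0 < b ⬝ᵥ w := lt_of_le_of_ne hq0 (Ne.symm h0)
    have h3 : m * (b ⬝ᵥ w) ^ 2 ≤ (b ⬝ᵥ v) * (b ⬝ᵥ w) := by
      calc m * (b ⬝ᵥ w) ^ 2 ≤ m * ((b ⬝ᵥ v) * (w ⬝ᵥ gram φ ρ *ᵥ w)) := by gcongr
        _ = (b ⬝ᵥ v) * (m * (w ⬝ᵥ gram φ ρ *ᵥ w)) := by ring
        _ ≤ _ := by gcongr
    have h4 : (b ⬝ᵥ w) * (b ⬝ᵥ w * m) ≤ (b ⬝ᵥ w) * (b ⬝ᵥ v) := by nlinarith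
    exact (le_of_mul_le_mul_left h4 hpos).trans hc

lemma sum_fin_get {α β : Type*} [AddCommMonoid β] (l : List α) (f : α → β) :
    ∑ s : Fin l.length, f (l.get s) = (l.map f).sum := by
  rw [← List.sum_ofFn]
  congr 1
  rw [List.ofFn_comp' (f := l.get) f]
  simp

lemma sum_map_pullList {n : ℕ} {β : Type*} [AddCommMonoid β] (u : Fin n → ℕ) (f : Fin n → β) :
    ((pullList u).map f).sum = ∑ i, u i • f i := by
  unfold pullList
  rw [List.map_flatMap, List.flatMap_def, List.sum_flatten, ← List.sum_ofFn, List.ofFn_eq_map]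
  simp [Function.comp_def]

lemma length_pullList {n : ℕ} (u : Fin n → ℕ) : (pullList u).length = ∑ i, u i := by
  have := sum_map_pullList u (fun _ => (1 : ℕ))
  simpa using this

lemma mem_pullList {n : ℕ} {u : Fin n → ℕ} {i : Fin n} (h : i ∈ pullList u) : u i ≠ 0 := by
  unfold pullList at h
  simp only [List.mem_flatMap, List.mem_replicate] at h
  obtain ⟨j, -, h1, rfl⟩ := h
  exact h1

/-- The matrix of the normal equations, for the arms in `pullList u`, is a Gram matrix. -/
lemma sum_vecMulVec_pullList {n D : ℕ} (φ : Fin n → Fin D → ℝ) (u : Fin n → ℕ) :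
    ∑ s : Fin (pullList u).length, Matrix.vecMulVec (φ ((pullList u).get s))
      (φ ((pullList u).get s)) = gram φ fun i => (u i : ℝ) := by
  rw [sum_fin_get (pullList u) fun i => Matrix.vecMulVec (φ i) (φ i), sum_map_pullList]
  simp [gram, Nat.cast_smul_eq_nsmul]

lemma leastSquares_spec {n D : ℕ} (φ : Fin n → Fin D → ℝ) (l : List (Fin n))
    (r : Fin l.length → ℝ) :
    (∑ s, Matrix.vecMulVec (φ (l.get s)) (φ (l.get s))) *ᵥ leastSquares φ l r =
      ∑ s, r s • φ (l.get s) := by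
  have h := exists_gram_mulVec_eq_sum (fun s => φ (l.get s)) (w := fun _ => 1)
    (fun _ => zero_le_one) r (by simp)
  simp only [gram, one_smul] at h
  exact Classical.epsilon_spec h

/-- The least-squares prediction is a linear function of the rewards. -/
lemma leastSquares_dotProduct {n D : ℕ} (φ : Fin n → Fin D → ℝ) (u : Fin n → ℕ)
    (r : Fin (pullList u).length → ℝ) {b w : Fin D → ℝ}
    (hw : gram φ (fun i => (u i : ℝ)) *ᵥ w = b) :
    leastSquares φ (pullList u) r ⬝ᵥ b = ∑ s, r s * (φ ((pullList u).get s) ⬝ᵥ w) := by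
  have h := leastSquares_spec φ (pullList u) r
  rw [sum_vecMulVec_pullList] at h
  rw [← hw, dotProduct_gram_mulVec_comm, h, dotProduct_sum]
  refine Finset.sum_congr rfl fun s _ => ?_
  rw [dotProduct_smul, smul_eq_mul, dotProduct_comm]

/-! ### Geometry of the Newton basis -/

section Newton

variable {X E : Type*} [NormedAddCommGroup E] [InnerProductSpace ℝ E]

lemma newton_eq (K : X → X → ℝ) (ξ : ℕ → X) (m : ℕ) (x : X) :
    newton K ξ m x = (K x (ξ m) - ∑ k : Fin m, newton K ξ k (ξ m) * newton K ξ k x) /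
      Real.sqrt (powerSq K ξ m (ξ m)) := by
  rw [newton]
  rfl

lemma powerSq_zero (K : X → X → ℝ) (ξ : ℕ → X) (x : X) : powerSq K ξ 0 x = K x x := by
  simp [powerSq]

lemma powerSq_succ (K : X → X → ℝ) (ξ : ℕ → X) (m : ℕ) (x : X) :
    powerSq K ξ (m + 1) x = powerSq K ξ m x - newton K ξ m x ^ 2 := by
  simp only [powerSq, Fin.sum_univ_castSucc, Fin.val_castSucc, Fin.val_last]
  ring

/-- The Newton basis functions as vectors of a space `E` with feature map `κ`: Gram-Schmidt
orthonormalization of `κ (ξ 0), κ (ξ 1), …`, where a vector that depends on the previous ones gives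
`0`. -/
noncomputable def newtonVec (K : X → X → ℝ) (κ : X → E) (ξ : ℕ → X) (m : ℕ) : E :=
  (Real.sqrt (powerSq K ξ m (ξ m)))⁻¹ •
    (κ (ξ m) - ∑ k : Fin m, newton K ξ k (ξ m) • newtonVec K κ ξ k)
termination_by m
decreasing_by exact k.2

variable {K : X → X → ℝ} {κ : X → E}

lemma inner_newtonVec (hκ : ∀ x y, inner ℝ (κ x) (κ y) = K x y) (ξ : ℕ → X) (m : ℕ) (x : X) :
    inner ℝ (κ x) (newtonVec K κ ξ m) = newton K ξ m x := by
  induction m using Nat.strong_induction_on with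
  | _ m ih =>
    rw [newtonVec, newton_eq, inner_smul_right, inner_sub_right, hκ, inner_sum, div_eq_inv_mul]
    congr 2
    refine Finset.sum_congr rfl fun k _ => ?_
    rw [inner_smul_right, ih k k.2]

/-- The vectors of the Newton basis are orthogonal and of norm `0` or `1`, and the power function is
the distance to their span. -/
lemma inner_newtonVec_aux (hκ : ∀ x y, inner ℝ (κ x) (κ y) = K x y) (ξ : ℕ → X) (m : ℕ) :
    (∀ j < m, inner ℝ (newtonVec K κ ξ j) (newtonVec K κ ξ m) = 0) ∧
    (newtonVec K κ ξ m = 0 ∨ inner ℝ (newtonVec K κ ξ m) (newtonVec K κ ξ m) = 1) ∧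
    ∀ x, powerSq K ξ m x = ‖κ x - ∑ k : Fin m, newton K ξ k x • newtonVec K κ ξ k‖ ^ 2 := by
  induction m using Nat.strong_induction_on with
  | _ m ih =>
    have horth : ∀ i j : Fin m, i ≠ j →
        inner ℝ (newtonVec K κ ξ i) (newtonVec K κ ξ j) = 0 := by
      intro i j hij
      rcases lt_or_gt_of_ne (Fin.val_ne_of_ne hij) with h | h
      · exact (ih j j.2).1 i h
      · rw [real_inner_comm]; exact (ih i i.2).1 j h
    have hself : ∀ (i : Fin m) (x : X), newton K ξ i x *
        inner ℝ (newtonVec K κ ξ i) (newtonVec K κ ξ i) = newton K ξ i x := by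
      intro i x
      rcases (ih i i.2).2.1 with h | h
      · rw [← inner_newtonVec hκ, h]; simp
      · rw [h, mul_one]
    have hproj : ∀ (i : Fin m) (x : X), inner ℝ (newtonVec K κ ξ i)
        (κ x - ∑ k : Fin m, newton K ξ k x • newtonVec K κ ξ k) = 0 := by
      intro i x
      rw [inner_sub_right, inner_sum, real_inner_comm, inner_newtonVec hκ,
        Finset.sum_eq_single i, inner_smul_right, hself, sub_self]
      · intro k _ hk
        rw [inner_smul_right, horth i k hk.symm, mul_zero]
      · simp
    have hpow : ∀ x, powerSq K ξ m x =
        ‖κ x - ∑ k : Fin m, newton K ξ k x • newtonVec K κ ξ k‖ ^ 2 := by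
      intro x
      have h0 : inner ℝ (∑ k : Fin m, newton K ξ k x • newtonVec K κ ξ k)
          (κ x - ∑ k : Fin m, newton K ξ k x • newtonVec K κ ξ k) = 0 := by
        rw [sum_inner]
        refine Finset.sum_eq_zero fun k _ => ?_
        rw [inner_smul_left, hproj, mul_zero]
      rw [← real_inner_self_eq_norm_sq, inner_sub_left (κ x), h0, sub_zero, inner_sub_right, hκ,
        inner_sum, powerSq]
      congr 1
      refine Finset.sum_congr rfl fun k _ => ?_
      rw [inner_smul_right, inner_newtonVec hκ, sq]
    refine ⟨?_, ?_, hpow⟩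
    · intro j hj
      rw [newtonVec.eq_def K κ ξ m, inner_smul_right, hproj ⟨j, hj⟩, mul_zero]
    · have hv := hpow (ξ m)
      set r := κ (ξ m) - ∑ k : Fin m, newton K ξ k (ξ m) • newtonVec K κ ξ k with hr
      have hvm : newtonVec K κ ξ m = (Real.sqrt (powerSq K ξ m (ξ m)))⁻¹ • r := by
        rw [newtonVec]
      rw [hv, Real.sqrt_sq (norm_nonneg _)] at hvm
      by_cases h0 : r = 0
      · left; rw [hvm, h0, smul_zero]
      · right
        rw [hvm, inner_smul_left, inner_smul_right, real_inner_self_eq_norm_sq]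
        have : ‖r‖ ≠ 0 := norm_ne_zero_iff.2 h0
        simp only [conj_trivial]
        field_simp

/-- The power function is the distance from `κ x` to the span of the Newton basis. -/
lemma powerSq_eq_norm_sq (hκ : ∀ x y, inner ℝ (κ x) (κ y) = K x y) (ξ : ℕ → X) (m : ℕ) (x : X) :
    powerSq K ξ m x = ‖κ x - ∑ k : Fin m, newton K ξ k x • newtonVec K κ ξ k‖ ^ 2 :=
  (inner_newtonVec_aux hκ ξ m).2.2 x

lemma powerSq_nonneg (hκ : ∀ x y, inner ℝ (κ x) (κ y) = K x y) (ξ : ℕ → X) (m : ℕ) (x : X) :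
    0 ≤ powerSq K ξ m x := by
  rw [powerSq_eq_norm_sq hκ]
  positivity

/-- The power function vanishes at the points that have been used. -/
lemma powerSq_apply_point (hκ : ∀ x y, inner ℝ (κ x) (κ y) = K x y) (ξ : ℕ → X) {m j : ℕ}
    (hj : j < m) : powerSq K ξ m (ξ j) = 0 := by
  induction m with
  | zero => omega
  | succ m ih =>
    rcases Nat.lt_succ_iff_lt_or_eq.1 hj with h | rfl
    · refine le_antisymm ?_ (powerSq_nonneg hκ ξ _ _)
      rw [powerSq_succ, ih h]
      nlinarith [sq_nonneg (newton K ξ m (ξ j))]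
    · have hP := powerSq_nonneg hκ ξ j (ξ j)
      have hN : newton K ξ j (ξ j) = powerSq K ξ j (ξ j) / Real.sqrt (powerSq K ξ j (ξ j)) := by
        rw [newton_eq]
        congr 1
        rw [powerSq]
        congr 1
        exact Finset.sum_congr rfl fun k _ => (sq _).symm
      rw [powerSq_succ, hN, Real.div_sqrt, Real.sq_sqrt hP, sub_self]

/-- A function of the space differs from a linear function of the Newton features by at most the
power function times its norm. -/
lemma exists_abs_inner_sub_le (hκ : ∀ x y, inner ℝ (κ x) (κ y) = K x y) (ξ : ℕ → X) (D : ℕ)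
    (f : E) : ∃ θ : Fin D → ℝ, ∀ x,
      |inner ℝ f (κ x) - θ ⬝ᵥ feature K ξ D x| ≤ ‖f‖ * Real.sqrt (powerSq K ξ D x) := by
  refine ⟨fun k => inner ℝ f (newtonVec K κ ξ k), fun x => ?_⟩
  have h : inner ℝ f (κ x) - (fun k : Fin D => inner ℝ f (newtonVec K κ ξ k)) ⬝ᵥ feature K ξ D x =
      inner ℝ f (κ x - ∑ k : Fin D, newton K ξ k x • newtonVec K κ ξ k) := by
    rw [inner_sub_right, inner_sum]
    congr 1
    refine Finset.sum_congr rfl fun k _ => ?_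
    rw [inner_smul_right, feature, mul_comm]
  rw [h, powerSq_eq_norm_sq hκ, Real.sqrt_sq (norm_nonneg _)]
  exact abs_real_inner_le_norm _ _

end Newton

open scoped MatrixOrder Matrix.Norms.L2Operator in
/-- A positive semidefinite kernel on a finite set has a feature map. -/
lemma exists_inner_eq_of_posSemidef {n : ℕ} {K : Fin n → Fin n → ℝ}
    (hK : (Matrix.of K).PosSemidef) :
    ∃ κ : Fin n → EuclideanSpace ℝ (Fin n), ∀ i j, inner ℝ (κ i) (κ j) = K i j := by
  obtain ⟨A, hA⟩ := CStarAlgebra.nonneg_iff_eq_star_mul_self.1 hK.nonneg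
  refine ⟨fun i => WithLp.toLp 2 fun a => A a i, fun i j => ?_⟩
  have : K i j = (star A * A) i j := by rw [← hA]; rfl
  rw [this, Matrix.mul_apply]
  simp [PiLp.inner_apply, mul_comm]

/-! ### Phase lengths -/

lemma firstPhase_pos {D : ℕ} (hD : 1 ≤ D) : 1 ≤ firstPhase D := by
  unfold firstPhase
  have : 0 < 16 * D * (1 + Nat.log 2 (Nat.log 2 D + 1)) := by positivity
  omega

lemma phaseLength_pos {D : ℕ} (hD : 1 ≤ D) (l : ℕ) : 1 ≤ phaseLength D l := by
  unfold phaseLength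
  have := firstPhase_pos hD
  have : 0 < firstPhase D * 2 ^ l := by positivity
  omega

lemma phaseLength_succ (D l : ℕ) : phaseLength D (l + 1) = 2 * phaseLength D l := by
  unfold phaseLength; ring

lemma two_pow_le_phaseLength {D : ℕ} (hD : 1 ≤ D) (l : ℕ) : 2 ^ l ≤ phaseLength D l :=
  Nat.le_mul_of_pos_left _ (firstPhase_pos hD)

lemma le_log_of_phaseLength_le {D T l : ℕ} (hD : 1 ≤ D) (h : phaseLength D l ≤ T) :
    l ≤ Nat.log 2 T :=
  Nat.le_log_of_pow_le one_lt_two ((two_pow_le_phaseLength hD l).trans h)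

lemma phaseLength_le_length {n D : ℕ} (l : ℕ) {ρ : Fin n → ℝ} (h1 : ∑ i, ρ i = 1) :
    phaseLength D l ≤ (pullList (pullCount D l ρ)).length := by
  rw [length_pullList]
  have h : (phaseLength D l : ℝ) ≤ ((∑ i, pullCount D l ρ i : ℕ) : ℝ) := by
    push_cast
    calc (phaseLength D l : ℝ) = ∑ i, (phaseLength D l : ℝ) * ρ i := by
          rw [← Finset.mul_sum, h1, mul_one]
      _ ≤ _ := Finset.sum_le_sum fun i _ => Nat.le_ceil _
  exact_mod_cast h

lemma length_le_two_mul_phaseLength {n D : ℕ} (l : ℕ) {φ : Fin n → Fin D → ℝ}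
    {S : Finset (Fin n)} {ρ : Fin n → ℝ} (h : IsDesign φ S ρ) :
    (pullList (pullCount D l ρ)).length ≤ 2 * phaseLength D l := by
  obtain ⟨h0, -, h1, hc, -⟩ := h
  rw [length_pullList]
  have hle : ((∑ i, pullCount D l ρ i : ℕ) : ℝ) ≤ phaseLength D l + firstPhase D := by
    push_cast
    calc ∑ i, (pullCount D l ρ i : ℝ)
        ≤ ∑ i, ((phaseLength D l : ℝ) * ρ i + if ρ i ≠ 0 then 1 else 0) := by
          refine Finset.sum_le_sum fun i _ => ?_
          unfold pullCount
          split_ifs with hi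
          · exact (Nat.ceil_lt_add_one (mul_nonneg (Nat.cast_nonneg _) (h0 i))).le
          · rw [not_not] at hi
            simp [hi]
      _ = phaseLength D l + ((Finset.univ.filter fun i => ρ i ≠ 0).card : ℝ) := by
          rw [Finset.sum_add_distrib, ← Finset.mul_sum, h1, mul_one, Finset.sum_boole]
      _ ≤ _ := by gcongr
  have h2 : firstPhase D ≤ phaseLength D l :=
    Nat.le_mul_of_pos_right _ (by positivity)
  have : ∑ i, pullCount D l ρ i ≤ phaseLength D l + firstPhase D := by exact_mod_cast hle
  omega

lemma threshold_nonneg {n D T : ℕ} {R δ : ℝ} (hR : 0 ≤ R) (l : ℕ) :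
    0 ≤ threshold n D T R δ l := by
  unfold threshold; positivity

/-! ### Regret of phased elimination when the noise is small -/

section Phases

variable {n D T : ℕ} (φ : Fin n → Fin D → ℝ) (ρ : Finset (Fin n) → Fin n → ℝ) (R δ : ℝ)

lemma phases_succ (y : ℕ → Fin n → ℝ) (l : ℕ) :
    phases φ ρ T R δ y (l + 1) =
      ((phases φ ρ T R δ y l).1.filter fun i => ∀ j ∈ (phases φ ρ T R δ y l).1,
        (leastSquares φ (pullList (pullCount D l (ρ (phases φ ρ T R δ y l).1)))
          fun s => y ((phases φ ρ T R δ y l).2.length + s)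
            ((pullList (pullCount D l (ρ (phases φ ρ T R δ y l).1))).get s)) ⬝ᵥ φ j -
        (leastSquares φ (pullList (pullCount D l (ρ (phases φ ρ T R δ y l).1)))
          fun s => y ((phases φ ρ T R δ y l).2.length + s)
            ((pullList (pullCount D l (ρ (phases φ ρ T R δ y l).1))).get s)) ⬝ᵥ φ i ≤
          threshold n D T R δ l,
      (phases φ ρ T R δ y l).2 ++ pullList (pullCount D l (ρ (phases φ ρ T R δ y l).1))) := by
  rfl

variable {R}

lemma phases_nonempty [NeZero n] (hR : 0 ≤ R) (y : ℕ → Fin n → ℝ) (l : ℕ) :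
    (phases φ ρ T R δ y l).1.Nonempty := by
  induction l with
  | zero => exact Finset.univ_nonempty
  | succ l ih =>
    rw [phases_succ]
    set θ := leastSquares φ (pullList (pullCount D l (ρ (phases φ ρ T R δ y l).1)))
      fun s => y ((phases φ ρ T R δ y l).2.length + s)
        ((pullList (pullCount D l (ρ (phases φ ρ T R δ y l).1))).get s)
    obtain ⟨b, hb, hmax⟩ := Finset.exists_max_image _ (fun i => θ ⬝ᵥ φ i) ih
    refine ⟨b, Finset.mem_filter.2 ⟨hb, fun j hj => ?_⟩⟩
    exact (sub_nonpos.2 (hmax j hj)).trans (threshold_nonneg hR l)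

/-- The noise part of the prediction for an arm, after phase `l` with active arms `S` that starts
in round `t`; here `w` solves the normal equations for the feature vector of the arm, and `e` is
the noise. -/
noncomputable def noise {n D : ℕ} (φ : Fin n → Fin D → ℝ) (ρ : Finset (Fin n) → Fin n → ℝ)
    (l : ℕ) (S : Finset (Fin n)) (t : ℕ) (w : Fin D → ℝ) (e : ℕ → ℝ) : ℝ :=
  ∑ s : Fin (pullList (pullCount D l (ρ S))).length,
    e (t + s) * (φ ((pullList (pullCount D l (ρ S))).get s) ⬝ᵥ w)

/-- `w` solves the normal equations of phase `l` for the arm `i`, with small Mahalanobis norm. -/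
def IsDual {n D : ℕ} (φ : Fin n → Fin D → ℝ) (ρ : Finset (Fin n) → Fin n → ℝ)
    (l : ℕ) (S : Finset (Fin n)) (i : Fin n) (w : Fin D → ℝ) : Prop :=
  gram φ (fun j => (pullCount D l (ρ S) j : ℝ)) *ᵥ w = φ i ∧
    φ i ⬝ᵥ w ≤ 2 * D / phaseLength D l ∧ 0 ≤ φ i ⬝ᵥ w

lemma exists_isDual (hD : 1 ≤ D) {S : Finset (Fin n)} (h : IsDesign φ S (ρ S)) (l : ℕ)
    {i : Fin n} (hi : i ∈ S) : ∃ w, IsDual φ ρ l S i w := by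
  obtain ⟨v, hv, hle⟩ := h.2.2.2.2 i hi
  have hm : (0 : ℝ) < phaseLength D l := by exact_mod_cast phaseLength_pos hD l
  exact exists_gram_mulVec_eq_of_le φ hm h.1 (fun j => Nat.le_ceil _) hv hle

variable {φ ρ}

lemma IsDual.sum_sq {l : ℕ} {S : Finset (Fin n)} {i : Fin n} {w : Fin D → ℝ}
    (h : IsDual φ ρ l S i w) :
    ∑ s : Fin (pullList (pullCount D l (ρ S))).length,
      (φ ((pullList (pullCount D l (ρ S))).get s) ⬝ᵥ w) ^ 2 = φ i ⬝ᵥ w := by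
  rw [sum_fin_get _ fun j => (φ j ⬝ᵥ w) ^ 2, sum_map_pullList]
  conv_rhs => rw [dotProduct_comm, ← h.1, dotProduct_gram_mulVec]
  refine Finset.sum_congr rfl fun j _ => ?_
  rw [nsmul_eq_mul, sq]

/-- The error of a prediction is at most the noise part plus a multiple of the approximation
error `η` of the mean rewards by a linear function of the features. -/
lemma abs_leastSquares_sub_le {l : ℕ} {S : Finset (Fin n)} (hD : 1 ≤ D)
    (hS : IsDesign φ S (ρ S)) {i : Fin n}
    {w : Fin D → ℝ} (h : IsDual φ ρ l S i w) {g : Fin n → ℝ} {θ : Fin D → ℝ} {η : ℝ}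
    (hη : ∀ i, |g i - θ ⬝ᵥ φ i| ≤ η) (t : ℕ) (e : ℕ → ℝ) :
    |(leastSquares φ (pullList (pullCount D l (ρ S))) fun s =>
        g ((pullList (pullCount D l (ρ S))).get s) + e (t + s)) ⬝ᵥ φ i - g i| ≤
      |noise φ ρ l S t w e| + η * (1 + 2 * Real.sqrt D) := by
  set L := pullList (pullCount D l (ρ S)) with hL
  have hη0 : 0 ≤ η := (abs_nonneg _).trans (hη i)
  have hm : (0 : ℝ) < phaseLength D l := by exact_mod_cast phaseLength_pos hD l
  rw [leastSquares_dotProduct φ _ _ h.1]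
  have hlin : ∑ s : Fin L.length, (θ ⬝ᵥ φ (L.get s)) * (φ (L.get s) ⬝ᵥ w) = θ ⬝ᵥ φ i := by
    rw [sum_fin_get L fun j => (θ ⬝ᵥ φ j) * (φ j ⬝ᵥ w), sum_map_pullList, ← h.1,
      dotProduct_gram_mulVec]
    refine Finset.sum_congr rfl fun j _ => ?_
    rw [nsmul_eq_mul, dotProduct_comm θ]
  have hsplit : ∑ s : Fin L.length, (g (L.get s) + e (t + s)) * (φ (L.get s) ⬝ᵥ w) - g i =
      noise φ ρ l S t w e +
        ∑ s : Fin L.length, (g (L.get s) - θ ⬝ᵥ φ (L.get s)) * (φ (L.get s) ⬝ᵥ w) -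
        (g i - θ ⬝ᵥ φ i) := by
    rw [noise, ← hL, ← hlin, ← Finset.sum_add_distrib, sub_sub_eq_add_sub,
      ← Finset.sum_add_distrib]
    congr 1
    exact Finset.sum_congr rfl fun s _ => by ring
  have hbias : |∑ s : Fin L.length, (g (L.get s) - θ ⬝ᵥ φ (L.get s)) * (φ (L.get s) ⬝ᵥ w)| ≤
      η * (2 * Real.sqrt D) := by
    refine abs_le_of_sq_le_sq ?_ (by positivity)
    have h1 := Finset.sum_mul_sq_le_sq_mul_sq (Finset.univ : Finset (Fin L.length))
      (fun s => g (L.get s) - θ ⬝ᵥ φ (L.get s)) (fun s => φ (L.get s) ⬝ᵥ w)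
    rw [h.sum_sq] at h1
    refine h1.trans ?_
    have h2 : ∑ s : Fin L.length, (g (L.get s) - θ ⬝ᵥ φ (L.get s)) ^ 2 ≤
        (2 * phaseLength D l) * η ^ 2 := by
      calc _ ≤ ∑ s : Fin L.length, η ^ 2 := by
            refine Finset.sum_le_sum fun s _ => ?_
            rw [← sq_abs]
            exact pow_le_pow_left₀ (abs_nonneg _) (hη _) 2
        _ = (L.length : ℝ) * η ^ 2 := by simp
        _ ≤ _ := by
            gcongr
            exact_mod_cast length_le_two_mul_phaseLength l hS
    calc _ ≤ ((2 * phaseLength D l) * η ^ 2) * (2 * D / phaseLength D l) :=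
          mul_le_mul h2 h.2.1 h.2.2 (by positivity)
      _ = (η * (2 * Real.sqrt D)) ^ 2 := by
          rw [mul_pow, mul_pow, Real.sq_sqrt (Nat.cast_nonneg D)]
          field_simp
  change |∑ s : Fin L.length, (g (L.get s) + e (t + s)) * (φ (L.get s) ⬝ᵥ w) - g i| ≤ _
  rw [hsplit]
  calc _ ≤ |noise φ ρ l S t w e +
        ∑ s : Fin L.length, (g (L.get s) - θ ⬝ᵥ φ (L.get s)) * (φ (L.get s) ⬝ᵥ w)| +
        |g i - θ ⬝ᵥ φ i| := abs_sub _ _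
    _ ≤ _ := by
        have := abs_add_le (noise φ ρ l S t w e)
          (∑ s : Fin L.length, (g (L.get s) - θ ⬝ᵥ φ (L.get s)) * (φ (L.get s) ⬝ᵥ w))
        have := hη i
        linarith

/-- The prediction errors after phase `l` are at most half of the threshold plus `E`. -/
def IsAccurate (φ : Fin n → Fin D → ℝ) (ρ : Finset (Fin n) → Fin n → ℝ) (T : ℕ) (R δ : ℝ)
    (g : Fin n → ℝ) (y : ℕ → Fin n → ℝ) (E : ℝ) (l : ℕ) : Prop :=
  ∀ i ∈ (phases φ ρ T R δ y l).1,
    |(leastSquares φ (pullList (pullCount D l (ρ (phases φ ρ T R δ y l).1)))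
      fun s => y ((phases φ ρ T R δ y l).2.length + s)
        ((pullList (pullCount D l (ρ (phases φ ρ T R δ y l).1))).get s)) ⬝ᵥ φ i - g i| ≤
      threshold n D T R δ l / 2 + E

variable {δ} {g : Fin n → ℝ} {y : ℕ → Fin n → ℝ} {E : ℝ}

/-- Each accurate phase lowers the best mean reward of the active arms by at most `2 * E`. -/
lemma exists_active_arm [NeZero n] (hR : 0 ≤ R) (hE : 0 ≤ E) (i : Fin n) (l : ℕ)
    (h : ∀ k < l, IsAccurate φ ρ T R δ g y E k) :
    ∃ z ∈ (phases φ ρ T R δ y l).1, g i - 2 * l * E ≤ g z := by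
  induction l with
  | zero => exact ⟨i, Finset.mem_univ _, by simp⟩
  | succ l ih =>
    obtain ⟨z, hz, hgz⟩ := ih fun k hk => h k (hk.trans (Nat.lt_succ_self l))
    have hacc := h l (Nat.lt_succ_self l)
    have hne := phases_nonempty (T := T) φ ρ δ hR y l
    rw [phases_succ]
    unfold IsAccurate at hacc
    set θ := leastSquares φ (pullList (pullCount D l (ρ (phases φ ρ T R δ y l).1)))
      fun s => y ((phases φ ρ T R δ y l).2.length + s)
        ((pullList (pullCount D l (ρ (phases φ ρ T R δ y l).1))).get s)
    obtain ⟨b, hb, hmax⟩ := Finset.exists_max_image _ (fun i => θ ⬝ᵥ φ i) hne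
    push_cast
    by_cases hzin : ∀ j ∈ (phases φ ρ T R δ y l).1,
        θ ⬝ᵥ φ j - θ ⬝ᵥ φ z ≤ threshold n D T R δ l
    · exact ⟨z, Finset.mem_filter.2 ⟨hz, hzin⟩, by nlinarith⟩
    · push Not at hzin
      obtain ⟨j, hj, hlt⟩ := hzin
      refine ⟨b, Finset.mem_filter.2 ⟨hb, fun j hj =>
        (sub_nonpos.2 (hmax j hj)).trans (threshold_nonneg hR l)⟩, ?_⟩
      have h1 := abs_le.1 (hacc b hb)
      have h2 := abs_le.1 (hacc z hz)
      have h3 := hmax j hj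
      nlinarith [h1.1, h1.2, h2.1, h2.2]

/-- The arms that survive an accurate phase are near-optimal. -/
lemma sub_le_of_mem_phases [NeZero n] (hR : 0 ≤ R) (hE : 0 ≤ E) (i : Fin n) (l : ℕ)
    (h : ∀ k ≤ l, IsAccurate φ ρ T R δ g y E k) {x : Fin n}
    (hx : x ∈ (phases φ ρ T R δ y (l + 1)).1) :
    g i - g x ≤ 2 * threshold n D T R δ l + 2 * (l + 1) * E := by
  obtain ⟨z, hz, hgz⟩ := exists_active_arm hR hE i l fun k hk => h k hk.le
  have hacc := h l le_rfl
  rw [phases_succ] at hx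
  obtain ⟨hx, hxz⟩ := Finset.mem_filter.1 hx
  have h0 := hxz z hz
  have h1 := abs_le.1 (hacc x hx)
  have h2 := abs_le.1 (hacc z hz)
  nlinarith [h1.1, h1.2, h2.1, h2.2]

lemma mem_of_mem_pullList {S : Finset (Fin n)} (hS : IsDesign φ S (ρ S)) {l : ℕ} {j : Fin n}
    (hj : j ∈ pullList (pullCount D l (ρ S))) : j ∈ S := by
  by_contra h
  refine mem_pullList hj ?_
  simp [pullCount, hS.2.1 j h]

/-- Regret of phased elimination, if all phases that end before the horizon are accurate. -/
lemma sum_take_phases_le [NeZero n] (hD : 1 ≤ D) (hR : 0 ≤ R) (hE : 0 ≤ E)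
    (hρ : IsDesignRule φ ρ) {B Q : ℝ} (hB : ∀ i, |g i| ≤ B)
    (h : ∀ k ≤ Nat.log 2 T, IsAccurate φ ρ T R δ g y E k)
    (hQ0 : 4 * B * firstPhase D ≤ Q)
    (hQ : ∀ l, phaseLength D l ≤ T →
      8 * threshold n D T R δ l * phaseLength D l + 2 * (l + 1) * E * T ≤ Q)
    (i : Fin n) (l : ℕ) :
    (((phases φ ρ T R δ y l).2.take T).map fun j => g i - g j).sum ≤
      (min l (Nat.log 2 T + 2) : ℕ) * Q := by
  have hB0 : 0 ≤ B := (abs_nonneg _).trans (hB i)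
  have hQ00 : 0 ≤ Q := le_trans (by positivity) hQ0
  induction l with
  | zero => simp [phases]
  | succ l ih =>
    have hS := hρ _ (phases_nonempty (T := T) φ ρ δ hR y l)
    have hmem : ∀ j ∈ pullList (pullCount D l (ρ (phases φ ρ T R δ y l).1)),
        j ∈ (phases φ ρ T R δ y l).1 := fun j hj => mem_of_mem_pullList hS hj
    have hlen := length_le_two_mul_phaseLength l hS
    rw [phases_succ, List.take_append, List.map_append, List.sum_append]
    set new := pullList (pullCount D l (ρ (phases φ ρ T R δ y l).1)) with hnew
    rcases le_or_gt T (phases φ ρ T R δ y l).2.length with hT | hT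
    · rw [Nat.sub_eq_zero_of_le hT, List.take_zero, List.map_nil, List.sum_nil, add_zero]
      refine ih.trans ?_
      gcongr
      omega
    · have hl : l ≤ Nat.log 2 T + 1 ∧ ((new.take (T - (phases φ ρ T R δ y l).2.length)).map
          fun j => g i - g j).sum ≤ Q := by
        have hbound : ∀ r : ℝ, (∀ x ∈ (phases φ ρ T R δ y l).1, g i - g x ≤ r) →
            ((new.take (T - (phases φ ρ T R δ y l).2.length)).map fun j => g i - g j).sum ≤
              (new.take (T - (phases φ ρ T R δ y l).2.length)).length * r := by
          intro r hr
          have := List.sum_le_card_nsmul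
            ((new.take (T - (phases φ ρ T R δ y l).2.length)).map fun j => g i - g j) r (by
              intro a ha
              obtain ⟨j, hj, rfl⟩ := List.mem_map.1 ha
              exact hr j (hmem j (List.mem_of_mem_take hj)))
          simpa using this
        set k := (new.take (T - (phases φ ρ T R δ y l).2.length)).length with hk
        have hkT : (k : ℝ) ≤ T := by
          have : k ≤ T := by rw [hk, List.length_take]; omega
          exact_mod_cast this
        have hkm : (k : ℝ) ≤ 2 * phaseLength D l := by
          have : k ≤ 2 * phaseLength D l := by rw [hk, List.length_take]; omega
          exact_mod_cast this
        cases l with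
        | zero =>
          refine ⟨by omega, (hbound (2 * B) fun x _ => ?_).trans ?_⟩
          · have h1 := abs_le.1 (hB i)
            have h2 := abs_le.1 (hB x)
            linarith [h1.2, h2.1]
          · refine le_trans ?_ hQ0
            have : (phaseLength D 0 : ℝ) = firstPhase D := by simp [phaseLength]
            rw [this] at hkm
            nlinarith
        | succ l =>
          have hS' := hρ _ (phases_nonempty (T := T) φ ρ δ hR y l)
          have hm : phaseLength D l ≤ T := by
            have h1 := phaseLength_le_length (n := n) (D := D) l hS'.2.2.1
            have h2 : (phases φ ρ T R δ y (l + 1)).2.length =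
              (phases φ ρ T R δ y l).2.length +
                (pullList (pullCount D l (ρ (phases φ ρ T R δ y l).1))).length := by
              rw [phases_succ, List.length_append]
            omega
          have hlog := le_log_of_phaseLength_le hD hm
          refine ⟨by omega, (hbound _ fun x hx =>
            sub_le_of_mem_phases hR hE i l (fun k hk => h k (hk.trans hlog)) hx).trans ?_⟩
          refine le_trans ?_ (hQ l hm)
          rw [phaseLength_succ] at hkm
          push_cast at hkm
          have ht := threshold_nonneg (n := n) (D := D) (T := T) (δ := δ) hR l
          have h1 : (k : ℝ) * (2 * threshold n D T R δ l) ≤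
              (2 * (2 * phaseLength D l)) * (2 * threshold n D T R δ l) := by gcongr
          have h2 : (k : ℝ) * (2 * (l + 1) * E) ≤ T * (2 * (l + 1) * E) := by gcongr
          linarith
      have hmin : min (l + 1) (Nat.log 2 T + 2) = min l (Nat.log 2 T + 2) + 1 := by omega
      rw [hmin]
      push_cast
      push_cast at ih
      linarith [hl.2]

end Phases

/-! ### The noise of a phase is small with high probability -/

section Noise

open MeasureTheory ProbabilityTheory

variable {n D T : ℕ} {φ : Fin n → Fin D → ℝ} {ρ : Finset (Fin n) → Fin n → ℝ} {R δ : ℝ}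

/-- The σ-algebra of the noise before round `t`. -/
abbrev pastNoise {Ψ : Type*} (ε : ℕ → Ψ → ℝ) (t : ℕ) : MeasurableSpace Ψ :=
  ⨆ s ∈ {s | s < t}, MeasurableSpace.comap (ε s) inferInstance

/-- The σ-algebra of the noise from round `t` on. -/
abbrev futureNoise {Ψ : Type*} (ε : ℕ → Ψ → ℝ) (t : ℕ) : MeasurableSpace Ψ :=
  ⨆ s ∈ {s | t ≤ s}, MeasurableSpace.comap (ε s) inferInstance

lemma measurable_pastNoise {Ψ : Type*} (ε : ℕ → Ψ → ℝ) {s t : ℕ} (h : s < t) :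
    Measurable[pastNoise ε t] (ε s) :=
  Measurable.mono (comap_measurable (ε s))
    (le_iSup₂_of_le (f := fun s (_ : s ∈ {s | s < t}) =>
      MeasurableSpace.comap (ε s) inferInstance) s h le_rfl) le_rfl

lemma measurable_futureNoise {Ψ : Type*} (ε : ℕ → Ψ → ℝ) {s t : ℕ} (h : t ≤ s) :
    Measurable[futureNoise ε t] (ε s) :=
  Measurable.mono (comap_measurable (ε s))
    (le_iSup₂_of_le (f := fun s (_ : s ∈ {s | t ≤ s}) =>
      MeasurableSpace.comap (ε s) inferInstance) s h le_rfl) le_rfl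

lemma pastNoise_mono {Ψ : Type*} (ε : ℕ → Ψ → ℝ) {s t : ℕ} (h : s ≤ t) :
    pastNoise ε s ≤ pastNoise ε t :=
  biSup_mono fun _ hi => lt_of_lt_of_le hi h

lemma measurableSet_elimination {Ψ : Type*} [MeasurableSpace Ψ] {e : ℕ → Ψ → ℝ}
    (hD : 1 ≤ D) (hρ : IsDesignRule φ ρ) (g : Fin n → ℝ) (l t : ℕ) (S S' : Finset (Fin n))
    (he : ∀ s < t + (pullList (pullCount D l (ρ S))).length, Measurable (e s)) (thr : ℝ) :
    MeasurableSet {ψ | (S.filter fun i => ∀ j ∈ S,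
      (leastSquares φ (pullList (pullCount D l (ρ S))) fun s =>
        g ((pullList (pullCount D l (ρ S))).get s) + e (t + s) ψ) ⬝ᵥ φ j -
      (leastSquares φ (pullList (pullCount D l (ρ S))) fun s =>
        g ((pullList (pullCount D l (ρ S))).get s) + e (t + s) ψ) ⬝ᵥ φ i ≤ thr) = S'} := by
  set L := pullList (pullCount D l (ρ S)) with hL
  have hlin : ∀ i ∈ S, Measurable fun ψ =>
      (leastSquares φ L fun s => g (L.get s) + e (t + s) ψ) ⬝ᵥ φ i := by
    intro i hi
    obtain ⟨w, hw⟩ := exists_isDual φ ρ hD (hρ S ⟨i, hi⟩) l hi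
    have : (fun ψ => (leastSquares φ L fun s => g (L.get s) + e (t + s) ψ) ⬝ᵥ φ i) =
        fun ψ => ∑ s : Fin L.length, (g (L.get s) + e (t + s) ψ) * (φ (L.get s) ⬝ᵥ w) := by
      funext ψ
      exact leastSquares_dotProduct φ _ _ hw.1
    rw [this]
    refine Finset.measurable_sum _ fun s _ => ?_
    have := he (t + s) (by have := s.2; omega)
    fun_prop
  simp only [Finset.ext_iff, Finset.mem_filter]
  refine measurableSet_setOfPred.2 (Measurable.forall fun i => ?_)
  refine Measurable.iff ?_ measurable_const
  by_cases hi : i ∈ S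
  · simp only [hi, true_and]
    refine Measurable.forall fun j => ?_
    by_cases hj : j ∈ S
    · simp only [hj, forall_true_left]
      exact measurableSet_setOfPred.1 (measurableSet_le ((hlin j hj).sub (hlin i hi))
        measurable_const)
    · simp only [hj, IsEmpty.forall_iff]
      exact measurable_const
  · simp only [hi, false_and]
    exact measurable_const

/-- The state after `l` phases depends only on the noise of the rounds of these phases. -/
lemma measurableSet_phases_eq {Ψ : Type*} {ε : ℕ → Ψ → ℝ} (hD : 1 ≤ D)
    (hρ : IsDesignRule φ ρ) (g : Fin n → ℝ) (l : ℕ) (σ : Finset (Fin n) × List (Fin n)) :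
    MeasurableSet[pastNoise ε σ.2.length]
      {ψ | phases φ ρ T R δ (fun t i => g i + ε t ψ) l = σ} := by
  induction l generalizing σ with
  | zero => simp only [phases]; exact @MeasurableSet.const _ (pastNoise ε σ.2.length) _
  | succ l ih =>
    have hset : {ψ | phases φ ρ T R δ (fun t i => g i + ε t ψ) (l + 1) = σ} =
        ⋃ τ : Finset (Fin n) × List (Fin n),
          ({ψ | phases φ ρ T R δ (fun t i => g i + ε t ψ) l = τ} ∩
            {ψ | (τ.1.filter fun i => ∀ j ∈ τ.1,
              (leastSquares φ (pullList (pullCount D l (ρ τ.1))) fun s =>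
                g ((pullList (pullCount D l (ρ τ.1))).get s) + ε (τ.2.length + s) ψ) ⬝ᵥ φ j -
              (leastSquares φ (pullList (pullCount D l (ρ τ.1))) fun s =>
                g ((pullList (pullCount D l (ρ τ.1))).get s) + ε (τ.2.length + s) ψ) ⬝ᵥ φ i ≤
                threshold n D T R δ l) = σ.1}) ∩
            {_ψ | τ.2 ++ pullList (pullCount D l (ρ τ.1)) = σ.2} := by
      ext ψ
      simp only [Set.mem_iUnion, Set.mem_inter_iff, Set.mem_ofPred_eq]
      constructor
      · intro h
        rw [phases_succ] at h
        exact ⟨_, ⟨rfl, congrArg Prod.fst h⟩, congrArg Prod.snd h⟩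
      · rintro ⟨τ, ⟨rfl, h1⟩, h2⟩
        rw [phases_succ]
        exact Prod.ext h1 h2
    rw [hset]
    refine @MeasurableSet.iUnion _ _ (pastNoise ε σ.2.length) _ _ fun τ => ?_
    by_cases hlen : τ.2 ++ pullList (pullCount D l (ρ τ.1)) = σ.2
    · have hl : σ.2.length = τ.2.length + (pullList (pullCount D l (ρ τ.1))).length := by
        rw [← hlen, List.length_append]
      refine @MeasurableSet.inter _ (pastNoise ε σ.2.length) _ _ ?_
        (@MeasurableSet.const _ (pastNoise ε σ.2.length) _)
      refine @MeasurableSet.inter _ (pastNoise ε σ.2.length) _ _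
        (pastNoise_mono ε (by omega) _ (ih τ)) ?_
      refine @measurableSet_elimination n D φ ρ _ (pastNoise ε σ.2.length) _ hD hρ g l _ _ _ ?_ _
      intro s hs
      exact measurable_pastNoise ε (by omega)
    · simp only [hlen, Set.ofPred_false, Set.inter_empty]
      exact @MeasurableSet.empty _ (pastNoise ε σ.2.length)

lemma measure_lt_abs_le_of_hasSubgaussianMGF {Ψ : Type*} [MeasurableSpace Ψ] {μ : Measure Ψ}
    [IsProbabilityMeasure μ] {X : Ψ → ℝ} {v : ℝ≥0} (hX : HasSubgaussianMGF X v μ) {W L : ℝ}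
    (hW : 0 ≤ W) (hL : 2 * v * L ≤ W ^ 2) :
    μ {ψ | W < |X ψ|} ≤ ENNReal.ofReal (2 * Real.exp (-L)) := by
  rcases eq_or_ne v 0 with rfl | hv
  · -- in the degenerate case the Chernoff bound is void, and `X = 0` almost surely
    have h0 := hX.ae_eq_zero_of_hasSubgaussianMGF_zero
    have : μ {ψ | W < |X ψ|} = 0 := by
      refine measure_mono_null (fun ψ hψ => ?_) (ae_iff.1 h0)
      simp only [Set.mem_ofPred_eq] at hψ ⊢
      intro h
      rw [h] at hψ
      simp only [Pi.zero_apply, abs_zero] at hψ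
      linarith
    rw [this]; exact zero_le
  · have hv' : (0 : ℝ) < v := by exact_mod_cast pos_iff_ne_zero.2 hv
    have hexp : Real.exp (-W ^ 2 / (2 * v)) ≤ Real.exp (-L) := by
      rw [Real.exp_le_exp, div_le_iff₀ (by positivity)]
      nlinarith
    have h1 := hX.measure_ge_le hW
    have h2 := hX.neg.measure_ge_le hW
    have hsub : {ψ | W < |X ψ|} ⊆ {ψ | W ≤ X ψ} ∪ {ψ | W ≤ (-X) ψ} := by
      intro ψ hψ
      rcases lt_abs.1 (show W < |X ψ| from hψ) with h | h
      · exact Or.inl h.le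
      · exact Or.inr h.le
    have h3 : μ.real {ψ | W < |X ψ|} ≤ 2 * Real.exp (-L) := by
      have := (measureReal_mono (μ := μ) hsub).trans (measureReal_union_le _ _)
      linarith
    rw [← ofReal_measureReal]
    exact ENNReal.ofReal_le_ofReal h3

lemma measurable_abs_noise {Ψ : Type*} [MeasurableSpace Ψ] {e : ℕ → Ψ → ℝ} {t : ℕ}
    (he : ∀ t' ≥ t, Measurable (e t')) (l : ℕ) (S : Finset (Fin n)) (w : Fin D → ℝ) :
    Measurable fun ψ => |noise φ ρ l S t w (e · ψ)| :=
  Measurable.abs (Finset.measurable_sum _ fun _ _ => (he _ (Nat.le_add_right _ _)).mul_const _)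

lemma hasSubgaussianMGF_noise {Ψ : Type*} [MeasurableSpace Ψ] {μ : Measure Ψ} {ε : ℕ → Ψ → ℝ}
    {R : ℝ≥0} (hind : iIndepFun ε μ)
    (hsub : ∀ t, HasSubgaussianMGF (ε t) (R ^ 2) μ) (l : ℕ) (S : Finset (Fin n)) (t : ℕ)
    (w : Fin D → ℝ) :
    ∃ v : ℝ≥0, HasSubgaussianMGF (fun ψ => noise φ ρ l S t w fun s => ε s ψ) v μ ∧
      (v : ℝ) = R ^ 2 * ∑ s : Fin (pullList (pullCount D l (ρ S))).length,
        (φ ((pullList (pullCount D l (ρ S))).get s) ⬝ᵥ w) ^ 2 := by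
  set L := pullList (pullCount D l (ρ S)) with hL
  have h1 : iIndepFun (fun (s : Fin L.length) ψ => (φ (L.get s) ⬝ᵥ w) * ε (t + s) ψ) μ :=
    (hind.precomp (g := fun s : Fin L.length => t + s)
      (fun a b hab => Fin.ext (Nat.add_left_cancel hab))).comp
      (fun s x => (φ (L.get s) ⬝ᵥ w) * x) fun s => measurable_const_mul _
  have h2 := HasSubgaussianMGF.sum_of_iIndepFun h1 (s := Finset.univ)
    (fun s _ => (hsub (t + s)).const_mul (φ (L.get s) ⬝ᵥ w))
  refine ⟨_, h2.congr (Filter.Eventually.of_forall fun ψ => ?_), ?_⟩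
  · exact Finset.sum_congr rfl fun s _ => mul_comm _ _
  · push_cast
    rw [Finset.mul_sum]
    exact Finset.sum_congr rfl fun s _ => mul_comm _ _

variable {Ψ : Type*} [MeasurableSpace Ψ] {μ : Measure Ψ} [IsProbabilityMeasure μ]
  {ε : ℕ → Ψ → ℝ}

lemma confidence_pos [NeZero n] (h0 : 0 < δ) (h1 : δ < 1) : 0 < confidence n T δ := by
  unfold confidence
  apply Real.log_pos
  rw [one_lt_div h0]
  have hn : (1 : ℝ) ≤ n := by exact_mod_cast Nat.one_le_iff_ne_zero.2 (NeZero.ne n)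
  have hT : (1 : ℝ) ≤ ((Nat.log 2 T + 1 : ℕ) : ℝ) := by exact_mod_cast Nat.le_add_left 1 _
  nlinarith

/-- Concentration for one arm and one phase whose beginning is known. -/
lemma measure_noise_le [NeZero n] {R : ℝ≥0} (hD : 1 ≤ D) (h0 : 0 < δ) (h1 : δ < 1)
    (hind : iIndepFun ε μ)
    (hsub : ∀ t, HasSubgaussianMGF (ε t) (R ^ 2) μ) {l : ℕ} {S : Finset (Fin n)} (t : ℕ)
    {i : Fin n} {w : Fin D → ℝ} (hw : IsDual φ ρ l S i w) :
    μ {ψ | threshold n D T R δ l / 2 < |noise φ ρ l S t w fun s => ε s ψ|} ≤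
      ENNReal.ofReal (2 * Real.exp (-confidence n T δ)) := by
  obtain ⟨v, hv, hvc⟩ := hasSubgaussianMGF_noise (φ := φ) (ρ := ρ) hind hsub l S t w
  rw [hw.sum_sq] at hvc
  have hc := confidence_pos (n := n) (T := T) h0 h1
  refine measure_lt_abs_le_of_hasSubgaussianMGF hv
    (div_nonneg (threshold_nonneg R.2 l) zero_le_two) ?_
  have hm : (0 : ℝ) < phaseLength D l := by exact_mod_cast phaseLength_pos hD l
  calc 2 * (v : ℝ) * confidence n T δ
      ≤ 2 * (R ^ 2 * (2 * D / phaseLength D l)) * confidence n T δ := by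
        rw [hvc]
        gcongr
        exact hw.2.1
    _ = (threshold n D T R δ l / 2) ^ 2 := by
        have : threshold n D T R δ l / 2 =
            2 * R * Real.sqrt (D / phaseLength D l * confidence n T δ) := by
          unfold threshold; ring
        rw [this, mul_pow, Real.sq_sqrt (by positivity)]
        ring

/-- Concentration for one arm and one phase: conditioned on the history of the earlier phases, the
noise of the phase is still independent sub-Gaussian. -/
lemma measure_phase_noise_le [NeZero n] {R : ℝ≥0} (hD : 1 ≤ D) (h0 : 0 < δ) (h1 : δ < 1)
    (hρ : IsDesignRule φ ρ) (g : Fin n → ℝ) (hmeas : ∀ t, Measurable (ε t))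
    (hind : iIndepFun ε μ) (hsub : ∀ t, HasSubgaussianMGF (ε t) (R ^ 2) μ)
    (w : ℕ → Finset (Fin n) → Fin n → Fin D → ℝ)
    (hw : ∀ l S, ∀ i ∈ S, IsDual φ ρ l S i (w l S i)) (l : ℕ) (i : Fin n) :
    μ {ψ | i ∈ (phases φ ρ T R δ (fun t i => g i + ε t ψ) l).1 ∧
        threshold n D T R δ l / 2 <
          |noise φ ρ l (phases φ ρ T R δ (fun t i => g i + ε t ψ) l).1
            (phases φ ρ T R δ (fun t i => g i + ε t ψ) l).2.length
            (w l (phases φ ρ T R δ (fun t i => g i + ε t ψ) l).1 i) fun s => ε s ψ|} ≤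
      ENNReal.ofReal (2 * Real.exp (-confidence n T δ)) := by
  set p := ENNReal.ofReal (2 * Real.exp (-confidence n T δ)) with hp
  set A : Finset (Fin n) × List (Fin n) → Set Ψ := fun σ =>
    {ψ | phases φ ρ T R δ (fun t i => g i + ε t ψ) l = σ} with hA
  set N : Finset (Fin n) × List (Fin n) → Set Ψ := fun σ =>
    {ψ | threshold n D T R δ l / 2 < |noise φ ρ l σ.1 σ.2.length (w l σ.1 i) fun s => ε s ψ|}
    with hN
  have hle : ∀ t, pastNoise ε t ≤ ‹MeasurableSpace Ψ› := fun t =>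
    iSup₂_le fun s _ => (hmeas s).comap_le
  have hAmeas : ∀ σ, MeasurableSet[pastNoise ε σ.2.length] (A σ) := fun σ =>
    measurableSet_phases_eq hD hρ g l σ
  have hNmeas : ∀ σ, MeasurableSet[futureNoise ε σ.2.length] (N σ) := by
    intro σ
    exact @measurable_abs_noise n D φ ρ Ψ (futureNoise ε σ.2.length) ε σ.2.length
      (fun _ hs => measurable_futureNoise ε hs) l σ.1 (w l σ.1 i) _ measurableSet_Ioi
  have hindep : ∀ σ, μ (A σ ∩ N σ) = μ (A σ) * μ (N σ) := by
    intro σ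
    have hdisj : Disjoint {s : ℕ | s < σ.2.length} {s | σ.2.length ≤ s} :=
      Set.disjoint_left.2 fun s hs hs' => lt_irrefl s (lt_of_lt_of_le hs hs')
    exact (Indep_iff _ _ μ).1 (indep_iSup_of_disjoint (fun s => (hmeas s).comap_le)
      hind.iIndep hdisj) _ _ (hAmeas σ) (hNmeas σ)
  have hsub' : {ψ | i ∈ (phases φ ρ T R δ (fun t i => g i + ε t ψ) l).1 ∧
        threshold n D T R δ l / 2 <
          |noise φ ρ l (phases φ ρ T R δ (fun t i => g i + ε t ψ) l).1
            (phases φ ρ T R δ (fun t i => g i + ε t ψ) l).2.length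
            (w l (phases φ ρ T R δ (fun t i => g i + ε t ψ) l).1 i) fun s => ε s ψ|} ⊆
      ⋃ σ : Finset (Fin n) × List (Fin n), {ψ | i ∈ σ.1} ∩ (A σ ∩ N σ) := by
    rintro ψ ⟨h2, h3⟩
    exact Set.mem_iUnion.2 ⟨_, h2, rfl, h3⟩
  refine (measure_mono hsub').trans ((measure_iUnion_le _).trans ?_)
  calc ∑' σ : Finset (Fin n) × List (Fin n), μ ({ψ | i ∈ σ.1} ∩ (A σ ∩ N σ))
      ≤ ∑' σ : Finset (Fin n) × List (Fin n), μ (A σ) * p := by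
        refine ENNReal.tsum_le_tsum fun σ => ?_
        by_cases hi : i ∈ σ.1
        · refine (measure_mono Set.inter_subset_right).trans ?_
          rw [hindep]
          gcongr
          exact measure_noise_le hD h0 h1 hind hsub _ (hw l σ.1 i hi)
        · simp [hi]
    _ = (∑' σ : Finset (Fin n) × List (Fin n), μ (A σ)) * p := ENNReal.tsum_mul_right
    _ ≤ 1 * p := by
        gcongr
        rw [← measure_iUnion]
        · exact prob_le_one
        · intro σ τ hστ
          exact Set.disjoint_left.2 fun ψ h2 h3 => hστ (h2.symm.trans h3)
        · exact fun σ => hle _ _ (hAmeas σ)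
    _ = p := one_mul p

/-- With probability at least `1 - δ`, all predictions that are used before the horizon are
accurate. -/
lemma measure_forall_isAccurate [NeZero n] {R : ℝ≥0} (hD : 1 ≤ D) (h0 : 0 < δ) (h1 : δ < 1)
    (hρ : IsDesignRule φ ρ) {g : Fin n → ℝ} {θ : Fin D → ℝ} {η : ℝ}
    (hη : ∀ i, |g i - θ ⬝ᵥ φ i| ≤ η) (hmeas : ∀ t, Measurable (ε t))
    (hind : iIndepFun ε μ) (hsub : ∀ t, HasSubgaussianMGF (ε t) (R ^ 2) μ) :
    ENNReal.ofReal (1 - δ) ≤ μ {ψ | ∀ l ≤ Nat.log 2 T,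
      IsAccurate φ ρ T R δ g (fun t i => g i + ε t ψ) (η * (1 + 2 * Real.sqrt D)) l} := by
  have hex : ∀ l S i, ∃ w, i ∈ S → IsDual φ ρ l S i w := by
    intro l S i
    by_cases hi : i ∈ S
    · obtain ⟨w, hw⟩ := exists_isDual φ ρ hD (hρ S ⟨i, hi⟩) l hi
      exact ⟨w, fun _ => hw⟩
    · exact ⟨0, fun h => absurd h hi⟩
  choose w hw using hex
  set G := {ψ | ∀ l ≤ Nat.log 2 T,
    IsAccurate φ ρ T R δ g (fun t i => g i + ε t ψ) (η * (1 + 2 * Real.sqrt D)) l} with hG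
  set bad : ℕ → Fin n → Set Ψ := fun l i =>
    {ψ | i ∈ (phases φ ρ T R δ (fun t i => g i + ε t ψ) l).1 ∧
        threshold n D T R δ l / 2 <
          |noise φ ρ l (phases φ ρ T R δ (fun t i => g i + ε t ψ) l).1
            (phases φ ρ T R δ (fun t i => g i + ε t ψ) l).2.length
            (w l (phases φ ρ T R δ (fun t i => g i + ε t ψ) l).1 i) fun s => ε s ψ|} with hbad
  have hcover : (Set.univ : Set Ψ) ⊆
      G ∪ ⋃ l ∈ Finset.range (Nat.log 2 T + 1), ⋃ i ∈ (Finset.univ : Finset (Fin n)), bad l i := by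
    intro ψ _
    by_contra hψ
    simp only [Set.mem_union, Set.mem_iUnion, not_or, not_exists] at hψ
    apply hψ.1
    intro l hl i hi
    have h3 := hψ.2 l (Finset.mem_range.2 (Nat.lt_succ_of_le hl)) i (Finset.mem_univ i)
    have h4 : |noise φ ρ l (phases φ ρ T R δ (fun t i => g i + ε t ψ) l).1
            (phases φ ρ T R δ (fun t i => g i + ε t ψ) l).2.length
            (w l (phases φ ρ T R δ (fun t i => g i + ε t ψ) l).1 i) fun s => ε s ψ| ≤
        threshold n D T R δ l / 2 := by
      by_contra h
      exact h3 ⟨hi, not_le.1 h⟩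
    have h5 := abs_leastSquares_sub_le hD
      (hρ _ (phases_nonempty (T := T) φ ρ δ R.2 (fun t i => g i + ε t ψ) l)) (hw l _ i hi) hη
      (phases φ ρ T R δ (fun t i => g i + ε t ψ) l).2.length fun s => ε s ψ
    exact h5.trans (add_le_add h4 le_rfl)
  have hsum : μ (⋃ l ∈ Finset.range (Nat.log 2 T + 1),
      ⋃ i ∈ (Finset.univ : Finset (Fin n)), bad l i) ≤ ENNReal.ofReal δ := by
    calc _ ≤ ∑ l ∈ Finset.range (Nat.log 2 T + 1), ∑ i : Fin n, μ (bad l i) :=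
          (measure_biUnion_finset_le _ _).trans
            (Finset.sum_le_sum fun l _ => measure_biUnion_finset_le _ _)
      _ ≤ ∑ l ∈ Finset.range (Nat.log 2 T + 1), ∑ i : Fin n,
            ENNReal.ofReal (2 * Real.exp (-confidence n T δ)) :=
          Finset.sum_le_sum fun l _ => Finset.sum_le_sum fun i _ =>
            measure_phase_noise_le hD h0 h1 hρ g hmeas hind hsub w (fun l S i => hw l S i) l i
      _ = ENNReal.ofReal δ := by
          have hn : (n : ℝ) ≠ 0 := by exact_mod_cast NeZero.ne n
          have hT : ((Nat.log 2 T + 1 : ℕ) : ℝ) ≠ 0 := by positivity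
          simp only [Finset.sum_const, Finset.card_range, Finset.card_univ, Fintype.card_fin,
            nsmul_eq_mul]
          rw [← ENNReal.ofReal_natCast, ← ENNReal.ofReal_natCast,
            ← ENNReal.ofReal_mul (by positivity), ← ENNReal.ofReal_mul (by positivity)]
          congr 1
          unfold confidence
          rw [Real.exp_neg, Real.exp_log (by positivity)]
          field_simp
  have htot : 1 ≤ μ G + ENNReal.ofReal δ := by
    calc (1 : ENNReal) = μ Set.univ := measure_univ.symm
      _ ≤ _ := (measure_mono hcover).trans (measure_union_le _ _)
      _ ≤ _ := by gcongr
  rw [ENNReal.ofReal_sub _ h0.le, ENNReal.ofReal_one]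
  exact tsub_le_iff_right.2 htot

end Noise

/-! ### The regret bound -/

section Regret

open MeasureTheory ProbabilityTheory

lemma natLog_le {T : ℕ} (hT : 1 ≤ T) : (Nat.log 2 T : ℝ) + 2 ≤ 2 * (1 + Real.log T) := by
  have h1 : ((2 : ℕ) : ℝ) ^ Nat.log 2 T ≤ T := by exact_mod_cast Nat.pow_log_le_self 2 (by omega)
  have h2 := Real.log_le_log (by positivity) h1
  rw [Real.log_pow] at h2
  have h3 := Real.log_two_gt_d9
  push_cast at h2
  have h4 : (0 : ℝ) ≤ Nat.log 2 T := Nat.cast_nonneg _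
  nlinarith

/-- `log log D ≤ log T`, for the length of the first phase. -/
lemma firstPhase_le {D T : ℕ} (hT : 1 ≤ T) (hD : D ≤ T) :
    (firstPhase D : ℝ) ≤ 32 * D * (1 + Real.log T) := by
  have h1 : Nat.log 2 (Nat.log 2 D + 1) ≤ Nat.log 2 T := by
    refine le_trans ?_ (Nat.log_mono_right hD)
    rcases Nat.eq_zero_or_pos (Nat.log 2 D) with h | h
    · simp [h]
    · exact Nat.lt_succ_iff.1 (Nat.log_lt_self 2 (by omega))
  have h2 : (Nat.log 2 (Nat.log 2 D + 1) : ℝ) ≤ Nat.log 2 T := by exact_mod_cast h1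
  have h3 := natLog_le hT
  unfold firstPhase
  push_cast
  have h4 : (1 : ℝ) + Nat.log 2 (Nat.log 2 D + 1) ≤ 2 * (1 + Real.log T) := by linarith
  calc (16 : ℝ) * D * (1 + Nat.log 2 (Nat.log 2 D + 1))
      ≤ 16 * D * (2 * (1 + Real.log T)) := by gcongr
    _ = _ := by ring

lemma half_le_log_div {n : ℕ} {δ : ℝ} (hn : 2 ≤ n) (h0 : 0 < δ) (h1 : δ < 1) :
    1 / 2 ≤ Real.log (n / δ) := by
  have h2 : (2 : ℝ) ≤ n := by exact_mod_cast hn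
  have h3 : (2 : ℝ) ≤ n / δ := by
    rw [le_div_iff₀ h0]; nlinarith
  have h4 := Real.log_le_log (by norm_num) h3
  have := Real.log_two_gt_d9
  linarith

lemma confidence_le {n T : ℕ} {δ : ℝ} (hT : 1 ≤ T) (hn : 2 ≤ n) (h0 : 0 < δ) (h1 : δ < 1) :
    confidence n T δ ≤ 9 * (1 + Real.log T) * Real.log (n / δ) := by
  have hl := half_le_log_div hn h0 h1
  have hn' : (0 : ℝ) < n := by exact_mod_cast (by omega : 0 < n)
  have hk := natLog_le hT
  have hlogT : 0 ≤ Real.log T := Real.log_nonneg (by exact_mod_cast hT)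
  have heq : confidence n T δ = Real.log 2 + Real.log ((Nat.log 2 T + 1 : ℕ) : ℝ) +
      Real.log (n / δ) := by
    unfold confidence
    rw [← Real.log_mul (by norm_num) (by positivity), ← Real.log_mul (by positivity)
      (by positivity)]
    congr 1
    ring
  have h2 : Real.log ((Nat.log 2 T + 1 : ℕ) : ℝ) ≤ Nat.log 2 T := by
    have := Real.log_le_sub_one_of_pos (x := ((Nat.log 2 T + 1 : ℕ) : ℝ)) (by positivity)
    push_cast at this ⊢
    linarith
  have h3 := Real.log_two_lt_d9
  rw [heq]
  nlinarith [mul_nonneg hlogT (by linarith : 0 ≤ Real.log (n / δ) - 1 / 2)]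

variable {n D T : ℕ}

lemma regret_le_of_forall [NeZero n] {g : Fin n → ℝ} {a : List (Fin n)} {b : ℝ}
    (h : ∀ i, (a.map fun j => g i - g j).sum ≤ b) : regret g a ≤ b :=
  ciSup_le h

lemma sum_map_sub_le {g : Fin n → ℝ} {B : ℝ} (hB : ∀ i, |g i| ≤ B) (a : List (Fin n))
    (i : Fin n) : (a.map fun j => g i - g j).sum ≤ a.length * (2 * B) := by
  have := List.sum_le_card_nsmul (a.map fun j => g i - g j) (2 * B) (by
    intro r hr
    obtain ⟨j, _, rfl⟩ := List.mem_map.1 hr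
    have h1 := abs_le.1 (hB i)
    have h2 := abs_le.1 (hB j)
    linarith [h1.2, h2.1])
  simpa using this

lemma le_of_sq_le_firstPhase {T : ℕ} {ℓ x : ℝ} (hT : 1 ≤ T) (hℓ : 1 / 2 ≤ ℓ)
    (hx : x ^ 2 ≤ T * (32 * D * (1 + Real.log T))) :
    x ≤ 12 * (1 + Real.log T) * Real.sqrt (T * D * ℓ) := by
  have hlogT : 0 ≤ Real.log T := Real.log_nonneg (by exact_mod_cast hT)
  refine le_of_abs_le (abs_le_of_sq_le_sq ?_ (by positivity))
  rw [mul_pow, Real.sq_sqrt (by positivity)]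
  have h1 : (0 : ℝ) ≤ T * D := by positivity
  refine hx.trans ?_
  have h2 : (1 : ℝ) + Real.log T ≤ (1 + Real.log T) ^ 2 := by nlinarith
  calc (T : ℝ) * (32 * D * (1 + Real.log T)) = (T * D) * (32 * (1 + Real.log T)) := by ring
    _ ≤ (T * D) * (144 * (1 + Real.log T) ^ 2 * ℓ) := by
        refine mul_le_mul_of_nonneg_left ?_ h1
        nlinarith
    _ = _ := by ring

/-- The regret bound in terms of the mean rewards, for bounded mean rewards that are close to a
linear function of the features. -/
lemma measure_regret_le [NeZero n] (hn : 2 ≤ n) {K : Fin n → Fin n → ℝ} {ξ : ℕ → Fin n}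
    {ρ : Finset (Fin n) → Fin n → ℝ} {R : ℝ≥0} {α δ B : ℝ} {g : Fin n → ℝ} {θ : Fin D → ℝ}
    (hT : 1 ≤ T) (hD : 1 ≤ D) (hα : 0 < α) (h0 : 0 < δ) (h1 : δ < 1)
    (hρ : IsDesignRule (feature K ξ D) ρ) (hB : ∀ i, |g i| ≤ B)
    (hη : ∀ i, |g i - θ ⬝ᵥ feature K ξ D i| ≤ B * (α / Real.sqrt T))
    {Ψ : Type*} [MeasurableSpace Ψ] {μ : Measure Ψ} [IsProbabilityMeasure μ] {ε : ℕ → Ψ → ℝ}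
    (hmeas : ∀ t, Measurable (ε t)) (hind : iIndepFun ε μ)
    (hsub : ∀ t, HasSubgaussianMGF (ε t) (R ^ 2) μ) :
    ENNReal.ofReal (1 - δ) ≤ μ {ψ |
      regret g (arms K ξ D ρ T R δ fun t i => g i + ε t ψ) ≤
        192 * (R + (1 + α) * B) * (1 + Real.log T) ^ 2 *
          Real.sqrt (T * D * Real.log (n / δ))} := by
  have hlogT : 0 ≤ Real.log T := Real.log_nonneg (by exact_mod_cast hT)
  have hB0 : 0 ≤ B := (abs_nonneg _).trans (hB 0)
  have hT0 : (0 : ℝ) < T := by exact_mod_cast hT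
  have hℓ := half_le_log_div hn h0 h1
  set ℓ := Real.log (n / δ) with hℓdef
  set Z := Real.sqrt (T * D * ℓ) with hZ
  set Λ := 1 + Real.log T with hΛ
  have hZ0 : 0 ≤ Z := Real.sqrt_nonneg _
  have hRB : B ≤ R + (1 + α) * B := by nlinarith [R.2, mul_nonneg hα.le hB0]
  have hΛ1 : 1 ≤ Λ := by rw [hΛ]; linarith
  have hTD : Real.sqrt T * Real.sqrt D ≤ 2 * Z := by
    rw [← Real.sqrt_mul (Nat.cast_nonneg T), hZ]
    refine Real.sqrt_le_iff.2 ⟨by positivity, ?_⟩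
    rw [mul_pow, Real.sq_sqrt (by positivity)]
    have : (0 : ℝ) ≤ T * D := by positivity
    nlinarith
  by_cases hphase : T ≤ firstPhase D
  · -- the horizon ends within the first phase: the trivial bound suffices
    have hTle : (T : ℝ) ≤ 12 * Λ * Z := by
      refine le_of_sq_le_firstPhase hT hℓ ?_
      rw [sq]
      gcongr
      rcases le_or_gt T D with h | h
      · have : (T : ℝ) ≤ D := by exact_mod_cast h
        nlinarith
      · refine le_trans ?_ (firstPhase_le hT h.le)
        exact_mod_cast hphase
    refine le_trans ?_ (measure_mono (s := Set.univ) fun ψ _ => ?_)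
    · rw [measure_univ]
      exact ENNReal.ofReal_le_one.2 (by linarith)
    · refine regret_le_of_forall fun i => ?_
      refine (sum_map_sub_le hB _ i).trans ?_
      have hlen : (arms K ξ D ρ T R δ fun t i => g i + ε t ψ).length = T := by
        simp [arms, hphase]
      rw [hlen]
      calc (T : ℝ) * (2 * B) ≤ (12 * Λ * Z) * (2 * B) := by gcongr
        _ = 24 * B * Λ ^ 1 * Z := by ring
        _ ≤ 192 * (R + (1 + α) * B) * Λ ^ 2 * Z := by
            gcongr
            · norm_num
            · norm_num
  · push Not at hphase
    have hDT : D ≤ T := by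
      have : D ≤ firstPhase D := by
        unfold firstPhase
        calc D = D * 1 := (mul_one D).symm
          _ ≤ D * (16 * (1 + Nat.log 2 (Nat.log 2 D + 1))) := Nat.mul_le_mul_left _ (by omega)
          _ = _ := by ring
      omega
    refine (measure_forall_isAccurate (T := T) hD h0 h1 hρ hη hmeas hind hsub).trans
      (measure_mono fun ψ hψ => ?_)
    have hη0 : 0 ≤ B * (α / Real.sqrt T) := by positivity
    have hE0 : 0 ≤ B * (α / Real.sqrt T) * (1 + 2 * Real.sqrt D) := by positivity
    have hD1 : 1 ≤ Real.sqrt D := Real.one_le_sqrt.2 (by exact_mod_cast hD)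
    -- the approximation error accumulated over the horizon
    have hE : B * (α / Real.sqrt T) * (1 + 2 * Real.sqrt D) * T ≤ 6 * (α * B) * Z := by
      calc B * (α / Real.sqrt T) * (1 + 2 * Real.sqrt D) * T
          ≤ B * (α / Real.sqrt T) * (3 * Real.sqrt D) * T := by gcongr; linarith
        _ = 3 * (α * B) * ((T / Real.sqrt T) * Real.sqrt D) := by ring
        _ = 3 * (α * B) * (Real.sqrt T * Real.sqrt D) := by rw [Real.div_sqrt]
        _ ≤ 3 * (α * B) * (2 * Z) := by gcongr
        _ = _ := by ring
    have hlogk := natLog_le hT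
    refine regret_le_of_forall fun i => ?_
    have hfp : (firstPhase D : ℝ) ≤ 12 * Λ * Z := by
      refine le_of_sq_le_firstPhase hT hℓ ?_
      rw [sq]
      have : (firstPhase D : ℝ) ≤ T := by exact_mod_cast hphase.le
      exact mul_le_mul this (firstPhase_le hT hDT) (Nat.cast_nonneg _) hT0.le
    have key := sum_take_phases_le (T := T) (R := R) (δ := δ) (g := g)
      (y := fun t i => g i + ε t ψ)
      (Q := 96 * (R + (1 + α) * B) * Λ * Z) hD R.2 hE0 hρ hB hψ ?_ ?_ i T
    · rw [arms, if_neg (by omega)]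
      refine key.trans ?_
      have hmin : ((min T (Nat.log 2 T + 2) : ℕ) : ℝ) ≤ 2 * Λ := by
        refine le_trans ?_ hlogk
        have := min_le_right T (Nat.log 2 T + 2)
        exact_mod_cast this
      calc _ ≤ 2 * Λ * (96 * (R + (1 + α) * B) * Λ * Z) := by
            gcongr
        _ = _ := by ring
    · calc 4 * B * (firstPhase D : ℝ) ≤ 4 * B * (12 * Λ * Z) := by gcongr
        _ = (48 * B) * (Λ * Z) := by ring
        _ ≤ (96 * (R + (1 + α) * B)) * (Λ * Z) := by
            gcongr
            norm_num
        _ = _ := by ring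
    · intro l hl
      have hm : (0 : ℝ) < phaseLength D l := by exact_mod_cast phaseLength_pos hD l
      have hl1 : ((l : ℝ) + 1) ≤ 2 * Λ := by
        have : (l : ℝ) ≤ Nat.log 2 T := by exact_mod_cast le_log_of_phaseLength_le hD hl
        linarith
      have hlT : (phaseLength D l : ℝ) ≤ T := by exact_mod_cast hl
      have hc0 : 0 < confidence n T δ := confidence_pos h0 h1
      have hthr : threshold n D T R δ l * phaseLength D l ≤ 12 * R * (Λ * Z) := by
        have h3 : Real.sqrt (D / phaseLength D l * confidence n T δ) * phaseLength D l ≤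
            3 * (Λ * Z) := by
          rw [← Real.sqrt_sq hm.le, ← Real.sqrt_mul (by positivity)]
          refine Real.sqrt_le_iff.2 ⟨by positivity, ?_⟩
          rw [Real.sqrt_sq hm.le, mul_pow, mul_pow, Real.sq_sqrt (by positivity)]
          calc D / phaseLength D l * confidence n T δ * (phaseLength D l : ℝ) ^ 2
              = D * phaseLength D l * confidence n T δ := by field_simp
            _ ≤ D * T * (9 * Λ * ℓ) := by
                gcongr
                exact confidence_le hT hn h0 h1
            _ ≤ D * T * (9 * Λ ^ 2 * ℓ) := by
                gcongr
                nlinarith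
            _ = _ := by ring
        calc threshold n D T R δ l * phaseLength D l = 4 * R *
              (Real.sqrt (D / phaseLength D l * confidence n T δ) * phaseLength D l) := by
              unfold threshold; ring
          _ ≤ 4 * R * (3 * (Λ * Z)) := by gcongr
          _ = _ := by ring
      calc 8 * threshold n D T R δ l * phaseLength D l +
            2 * (l + 1) * (B * (α / Real.sqrt T) * (1 + 2 * Real.sqrt D)) * T
          = 8 * (threshold n D T R δ l * phaseLength D l) + 2 * (l + 1) *
            (B * (α / Real.sqrt T) * (1 + 2 * Real.sqrt D) * T) := by ring
        _ ≤ 8 * (12 * R * (Λ * Z)) + 2 * (2 * Λ) * (6 * (α * B) * Z) := by gcongr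
        _ = (96 * R + 24 * (α * B)) * (Λ * Z) := by ring
        _ ≤ (96 * (R + (1 + α) * B)) * (Λ * Z) := by
            gcongr
            nlinarith [mul_nonneg hα.le hB0]
        _ = _ := by ring

/-- The regret bound for a function of a reproducing kernel Hilbert space. -/
lemma measure_regret_le_of_rkhs {Ω : Type*} {K : Ω → Ω → ℝ} (hK1 : ∀ x, K x x ≤ 1)
    [NeZero n] (x : Fin n → Ω) {R : ℝ≥0} {α δ : ℝ} (hT : 1 ≤ T) (hα : 0 < α) (h0 : 0 < δ)
    (h1 : δ < 1) {ξ : ℕ → Fin n} {ρ : Finset (Fin n) → Fin n → ℝ}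
    (hξ : IsPGreedy (fun i j => K (x i) (x j)) (α / (T : ℝ) ^ (1 / 2 : ℝ)) ξ D)
    (hρ : IsDesignRule (feature (fun i j => K (x i) (x j)) ξ D) ρ)
    {H : Type*} [NormedAddCommGroup H] [InnerProductSpace ℝ H] [CompleteSpace H]
    [RKHS ℝ H Ω ℝ] (hK : ∀ p q, RKHS.kernel H p q 1 = K p q) {f : H} {B : ℝ} (hf : ‖f‖ ≤ B)
    {Ψ : Type*} [MeasurableSpace Ψ] {μ : Measure Ψ} [IsProbabilityMeasure μ] {ε : ℕ → Ψ → ℝ}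
    (hmeas : ∀ t, Measurable (ε t)) (hind : iIndepFun ε μ)
    (hsub : ∀ t, HasSubgaussianMGF (ε t) (R ^ 2) μ) :
    ENNReal.ofReal (1 - δ) ≤ μ {ψ |
      regret (fun i => f (x i)) (arms (fun i j => K (x i) (x j)) ξ D ρ T R δ
        fun t i => f (x i) + ε t ψ) ≤
        192 * (R + (1 + α) * B) * (1 + Real.log T) ^ 2 *
          Real.sqrt (T * D * Real.log (n / δ))} := by
  have hB0 : 0 ≤ B := (norm_nonneg f).trans hf
  have hlogT : 0 ≤ Real.log T := Real.log_nonneg (by exact_mod_cast hT)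
  obtain hn | hn : n = 1 ∨ 2 ≤ n := by
    have := NeZero.ne n
    omega
  · -- a single arm has no regret
    subst hn
    refine le_trans ?_ (measure_mono (s := Set.univ) fun ψ _ => ?_)
    · rw [measure_univ]
      exact ENNReal.ofReal_le_one.2 (by linarith)
    · refine regret_le_of_forall fun i => ?_
      have : ∀ l : List (Fin 1), (l.map fun j => f (x i) - f (x j)).sum = 0 := by
        intro l
        have : (fun j => f (x i) - f (x j)) = fun _ : Fin 1 => (0 : ℝ) := by
          funext j
          rw [Subsingleton.elim j i, sub_self]
        rw [this]
        simp
      rw [this]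
      have := R.2
      positivity
  · have hκ : ∀ i j, inner ℝ (RKHS.kerFun H (x i) (1 : ℝ)) (RKHS.kerFun H (x j) (1 : ℝ)) =
        K (x i) (x j) := by
      intro i j
      rw [real_inner_comm, ← RKHS.kernel_inner, hK]
      simp
    have hval : ∀ i, inner ℝ f (RKHS.kerFun H (x i) (1 : ℝ)) = f (x i) := by
      intro i
      rw [RKHS.inner_kerFun]
      simp
    obtain ⟨θ, hθ⟩ := exists_abs_inner_sub_le hκ ξ D f
    have he0 : 0 ≤ α / Real.sqrt T := by positivity
    refine measure_regret_le (θ := θ) hn hT hξ.1 hα h0 h1 hρ (fun i => ?_) (fun i => ?_)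
      hmeas hind hsub
    · rw [← hval]
      refine (abs_real_inner_le_norm _ _).trans ?_
      have h2 : ‖RKHS.kerFun H (x i) (1 : ℝ)‖ ≤ 1 := by
        have h3 := hκ i i
        rw [real_inner_self_eq_norm_sq] at h3
        have := hK1 (x i)
        nlinarith [norm_nonneg (RKHS.kerFun H (x i) (1 : ℝ))]
      calc _ ≤ B * 1 := mul_le_mul hf h2 (norm_nonneg _) hB0
        _ = B := mul_one B
    · rw [← hval]
      refine (hθ i).trans ?_
      have h2 := hξ.2.2.2 i
      rw [← Real.sqrt_eq_rpow] at h2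
      gcongr
      exact Real.sqrt_le_iff.2 ⟨he0, h2.le⟩

end Regret

/-! ### Executions of programs -/

section Spec

variable {n : ℕ} {α β σ : Type} {K : Fin n → Fin n → ℝ}

lemma exec_bind (K : Fin n → Fin n → ℝ) (y : ℕ → Fin n → ℝ) (p : Prog ℝ n α)
    (f : α → Prog ℝ n β) (t : ℕ) :
    (p >>= f).exec K y t =
      ⟨((f (p.exec K y t).value).exec K y (t + (p.exec K y t).pulled.length)).value,
        (p.exec K y t).steps +
          ((f (p.exec K y t).value).exec K y (t + (p.exec K y t).pulled.length)).steps,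
        (p.exec K y t).pulled ++
          ((f (p.exec K y t).value).exec K y (t + (p.exec K y t).pulled.length)).pulled⟩ := by
  change (p.bind f).exec K y t = _
  induction p generalizing t with
  | ret a => simp [Prog.bind, Prog.exec]
  | const k next ih => simp [Prog.bind, Prog.exec, ih, Outcome.charge]; omega
  | bin op x z next ih => simp [Prog.bind, Prog.exec, ih, Outcome.charge]; omega
  | un op x next ih => simp [Prog.bind, Prog.exec, ih, Outcome.charge]; omega
  | test x z next ih => simp [Prog.bind, Prog.exec, ih, Outcome.charge]; omega
  | kernel i j next ih => simp [Prog.bind, Prog.exec, ih, Outcome.charge]; omega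
  | pull i next ih =>
    simp only [Prog.bind, Prog.exec, ih, List.length_cons, List.cons_append, Outcome.mk.injEq]
    rw [show t + 1 + ((next (y t i)).exec K y (t + 1)).pulled.length =
      t + (((next (y t i)).exec K y (t + 1)).pulled.length + 1) by omega]
    refine ⟨rfl, by omega, rfl⟩
  | tick next ih => simp [Prog.bind, Prog.exec, ih, Outcome.charge]; omega

/-- The program `p` pulls no arm, takes at most `s` steps, and its result satisfies `Q`. The result
is required to be the same in all rounds and for all rewards. -/
def Spec (K : Fin n → Fin n → ℝ) (p : Prog ℝ n α) (s : ℕ) (Q : α → Prop) : Prop :=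
  ∃ v, (∀ y t, ∃ k ≤ s, p.exec K y t = ⟨v, k, []⟩) ∧ Q v

lemma Spec.mono {p : Prog ℝ n α} {s s' : ℕ} {Q Q' : α → Prop} (h : Spec K p s Q)
    (hs : s ≤ s') (hQ : ∀ v, Q v → Q' v) : Spec K p s' Q' := by
  obtain ⟨v, hv, hq⟩ := h
  refine ⟨v, fun y t => ?_, hQ v hq⟩
  obtain ⟨k, hk, he⟩ := hv y t
  exact ⟨k, hk.trans hs, he⟩

lemma Spec.exists_eq {p : Prog ℝ n α} {s : ℕ} {Q : α → Prop} (h : Spec K p s Q) :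
    ∃ v, Spec K p s (· = v) ∧ Q v := by
  obtain ⟨v, hv, hq⟩ := h
  exact ⟨v, ⟨v, hv, rfl⟩, hq⟩

lemma Spec.ret {a : α} {s : ℕ} {Q : α → Prop} (h : Q a) : Spec K (pure a) s Q :=
  ⟨a, fun _ _ => ⟨0, Nat.zero_le _, rfl⟩, h⟩

lemma Spec.bind {p : Prog ℝ n α} {f : α → Prog ℝ n β} {s s' b : ℕ} {Q : α → Prop}
    {Q' : β → Prop} (h : Spec K p s Q) (h' : ∀ v, Q v → Spec K (f v) s' Q')
    (hb : s + s' ≤ b) : Spec K (p >>= f) b Q' := by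
  obtain ⟨v, hv, hq⟩ := h
  obtain ⟨w, hw, hq'⟩ := h' v hq
  refine ⟨w, fun y t => ?_, hq'⟩
  obtain ⟨k, hk, he⟩ := hv y t
  obtain ⟨k', hk', he'⟩ := hw y t
  refine ⟨k + k', (Nat.add_le_add hk hk').trans hb, ?_⟩
  rw [exec_bind, he]
  simp [he']

/-- The rule for a sequential composition whose first part has a known value. -/
lemma Spec.bind_eq {p : Prog ℝ n α} {f : α → Prog ℝ n β} {s s' b : ℕ} {v : α}
    {Q' : β → Prop} (h : Spec K p s (· = v)) (h' : Spec K (f v) s' Q')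
    (hb : s + s' ≤ b) : Spec K (p >>= f) b Q' :=
  h.bind (fun w hw => by rw [hw]; exact h') hb

lemma Spec.tick {p : Prog ℝ n α} {s b : ℕ} {Q : α → Prop} (h : Spec K p s Q) (hb : s + 1 ≤ b) :
    Spec K (.tick p) b Q := by
  obtain ⟨v, hv, hq⟩ := h
  refine ⟨v, fun y t => ?_, hq⟩
  obtain ⟨k, hk, he⟩ := hv y t
  exact ⟨k + 1, by omega, by simp [Prog.exec, he, Outcome.charge]⟩

lemma spec_nat (k : ℕ) : Spec K (nat k) 1 (· = (k : ℝ)) :=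
  ⟨_, fun _ _ => ⟨1, le_rfl, rfl⟩, rfl⟩
lemma spec_add (x y : ℝ) : Spec K (add x y) 1 (· = x + y) :=
  ⟨_, fun _ _ => ⟨1, le_rfl, rfl⟩, rfl⟩
lemma spec_sub (x y : ℝ) : Spec K (sub x y) 1 (· = x - y) :=
  ⟨_, fun _ _ => ⟨1, le_rfl, rfl⟩, rfl⟩
lemma spec_mul (x y : ℝ) : Spec K (mul x y) 1 (· = x * y) :=
  ⟨_, fun _ _ => ⟨1, le_rfl, rfl⟩, rfl⟩
lemma spec_div (x y : ℝ) : Spec K (div x y) 1 (· = x / y) :=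
  ⟨_, fun _ _ => ⟨1, le_rfl, rfl⟩, rfl⟩
lemma spec_sqrt (x : ℝ) : Spec K (sqrt x) 1 (· = Real.sqrt x) :=
  ⟨_, fun _ _ => ⟨1, le_rfl, rfl⟩, rfl⟩
lemma spec_log (x : ℝ) : Spec K (log x) 1 (· = Real.log x) :=
  ⟨_, fun _ _ => ⟨1, le_rfl, rfl⟩, rfl⟩
lemma spec_ker (i j : Fin n) : Spec K (ker i j) 1 (· = K i j) :=
  ⟨_, fun _ _ => ⟨1, le_rfl, rfl⟩, rfl⟩
open Classical in
lemma spec_leq (x y : ℝ) : Spec K (leq x y) 1 (· = decide (x ≤ y)) :=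
  ⟨_, fun _ _ => ⟨1, le_rfl, by simp [leq, Prog.exec, Outcome.charge]⟩, rfl⟩

/-- The rule for a case distinction by a comparison. -/
lemma Spec.ite_leq {x y : ℝ} {p q : Prog ℝ n α} {s b : ℕ} {Q : α → Prop}
    (hp : x ≤ y → Spec K p s Q) (hq : y < x → Spec K q s Q) (hb : s + 1 ≤ b) :
    Spec K (leq x y >>= fun c => if c then p else q) b Q := by
  classical
  refine (spec_leq x y).bind_eq (s' := s) ?_ (by omega)
  by_cases h : x ≤ y
  · simpa [h] using hp h
  · simpa [h] using hq (not_le.1 h)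

lemma spec_tab_sum {k : ℕ} {f : Fin k → Prog ℝ n β} {s : Fin k → ℕ} {Q : Fin k → β → Prop}
    (h : ∀ i, Spec K (f i) (s i) (Q i)) :
    Spec K (tab k f) (∑ i, (s i + 1)) (fun v => ∀ i, Q i (v i)) := by
  induction k with
  | zero => exact Spec.ret fun i => i.elim0
  | succ k ih =>
    rw [Fin.sum_univ_succ]
    refine (h 0).bind (s' := ∑ i : Fin k, (s i.succ + 1) + 1) (fun x hx => ?_) (by omega)
    refine (ih fun i => h i.succ).bind (s' := 1) (fun v hv => ?_) le_rfl
    refine (Spec.ret (s := 0) ?_).tick le_rfl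
    intro i
    refine Fin.cases ?_ ?_ i
    · simpa using hx
    · intro j; simpa using hv j

lemma spec_tab {k : ℕ} {f : Fin k → Prog ℝ n β} {s b : ℕ} {Q : Fin k → β → Prop}
    (h : ∀ i, Spec K (f i) s (Q i)) (hb : k * (s + 1) ≤ b) :
    Spec K (tab k f) b (fun v => ∀ i, Q i (v i)) :=
  (spec_tab_sum h).mono (by simpa using hb) fun _ h => h

lemma spec_tab_eq {k : ℕ} {f : Fin k → Prog ℝ n β} {s b : ℕ} {v : Fin k → β}
    (h : ∀ i, Spec K (f i) s (· = v i)) (hb : k * (s + 1) ≤ b) :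
    Spec K (tab k f) b (· = v) :=
  (spec_tab h hb).mono le_rfl fun _ h => funext h

lemma spec_tab₂_eq {k m : ℕ} {f : Fin k → Fin m → Prog ℝ n ℝ} {s b : ℕ} {v : Fin k → Fin m → ℝ}
    (h : ∀ i j, Spec K (f i j) s (· = v i j)) (hb : k * (m * (s + 1) + 1) ≤ b) :
    Spec K (tab₂ k m f) b (· = v) :=
  spec_tab_eq (fun i => spec_tab_eq (h i) le_rfl) hb

/-- The rule for loops, with an invariant that may depend on the part of the list that has been
processed. -/
lemma spec_loop {l : List β} {s₀ : σ} {f : σ → β → Prog ℝ n σ} {c b : ℕ}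
    (Inv : List β → σ → Prop) (h0 : Inv [] s₀)
    (h : ∀ pre x post, l = pre ++ x :: post → ∀ s, Inv pre s →
      Spec K (f s x) c (Inv (pre ++ [x])))
    (hb : l.length * (c + 1) ≤ b) : Spec K (loop l s₀ f) b (Inv l) := by
  suffices H : ∀ (post pre : List β) (s : σ), l = pre ++ post → Inv pre s →
      Spec K (loop post s f) (post.length * (c + 1)) (Inv l) from
    (H l [] s₀ rfl h0).mono hb fun _ h => h
  intro post
  induction post with
  | nil =>
    intro pre s hl hs
    rw [List.append_nil] at hl
    rw [hl]
    exact Spec.ret hs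
  | cons x post ih =>
    intro pre s hl hs
    refine (h pre x post hl s hs).bind (s' := post.length * (c + 1) + 1) (fun s' hs' => ?_)
      (by rw [List.length_cons]; ring_nf; omega)
    exact (ih (pre ++ [x]) s' (by simpa using hl) hs').tick le_rfl

lemma spec_sumList {l : List β} {f : β → Prog ℝ n ℝ} {g : β → ℝ} {c b : ℕ}
    (h : ∀ x ∈ l, Spec K (f x) c (· = g x)) (hb : l.length * (c + 2) + 1 ≤ b) :
    Spec K (sumList l f) b (· = (l.map g).sum) := by
  refine (spec_nat 0).bind_eq (s' := l.length * (c + 2)) ?_ (by omega)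
  refine spec_loop (c := c + 1) (fun pre s => s = (pre.map g).sum) (by simp) ?_ le_rfl
  intro pre x post hl s hs
  refine (h x (by simp [hl])).bind_eq (s' := 1) ?_ le_rfl
  refine (spec_add _ _).mono le_rfl fun v hv => ?_
  rw [hv, hs]
  simp

lemma spec_dot {k : ℕ} (v w : Fin k → ℝ) : Spec K (dot v w) (3 * k + 1) (· = v ⬝ᵥ w) := by
  have : v ⬝ᵥ w = ((List.finRange k).map fun i => v i * w i).sum := by
    rw [← List.ofFn_eq_map, List.sum_ofFn]
    rfl
  rw [this]
  exact spec_sumList (c := 1) (fun i _ => spec_mul _ _) (by simp; omega)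

lemma spec_mulVec {k : ℕ} (H : Fin k → Fin k → ℝ) (v : Fin k → ℝ) :
    Spec K (mulVec H v) (k * (3 * k + 2)) (· = Matrix.of H *ᵥ v) :=
  spec_tab_eq (fun i => spec_dot (H i) v) le_rfl

lemma spec_argmax (v : Fin n → ℝ) (a : Fin n) (l : List (Fin n)) :
    Spec K (argmax v a l) (2 * l.length) fun p => p ∈ a :: l ∧ ∀ i ∈ a :: l, v i ≤ v p := by
  refine spec_loop (c := 1) (fun pre p => p ∈ a :: pre ∧ ∀ i ∈ a :: pre, v i ≤ v p)
    (by simp) ?_ (by omega)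
  intro pre x post _ s hs
  refine Spec.ite_leq (s := 0) (fun hle => Spec.ret ⟨?_, ?_⟩)
    (fun hlt => Spec.ret ⟨?_, ?_⟩) le_rfl
  · have := hs.1
    simp only [List.mem_cons, List.mem_append] at this ⊢
    tauto
  · intro i hi
    simp only [List.mem_cons, List.mem_append, List.not_mem_nil, or_false] at hi
    rcases hi with h | h | h
    · exact hs.2 i (by simp [h])
    · exact hs.2 i (by simp [h])
    · rw [h]; exact hle
  · simp
  · intro i hi
    simp only [List.mem_cons, List.mem_append, List.not_mem_nil, or_false] at hi
    rcases hi with h | h | h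
    · exact (hs.2 i (by simp [h])).trans hlt.le
    · exact (hs.2 i (by simp [h])).trans hlt.le
    · rw [h]

lemma spec_ceil {v : ℝ} (fuel k : ℕ) (hk : k ≤ ⌈v⌉₊) (hf : ⌈v⌉₊ ≤ k + fuel) :
    Spec K (ceil v fuel k) (2 * (⌈v⌉₊ - k + 1)) (· = ⌈v⌉₊) := by
  induction fuel generalizing k with
  | zero => exact Spec.ret (by omega)
  | succ fuel ih =>
    refine (spec_nat k).bind_eq (s' := 2 * (⌈v⌉₊ - k) + 1) ?_ (by omega)
    refine Spec.ite_leq (s := 2 * (⌈v⌉₊ - k)) (fun hle => ?_) (fun hlt => ?_) le_rfl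
    · exact Spec.ret (le_antisymm hk (Nat.ceil_le.2 hle))
    · have hlt' := Nat.lt_ceil.2 hlt
      exact (ih (k + 1) hlt' (by omega)).mono (by omega) fun _ h => h

end Spec

/-! ### The P-greedy program -/

section Greedy

variable {n : ℕ} {K : Fin n → Fin n → ℝ}

/-- The Newton basis function of the point `p`, as computed from the state `st`. -/
noncomputable def nextBasis (K : Fin n → Fin n → ℝ) (st : GreedyState ℝ n) (p i : Fin n) : ℝ :=
  (K i p - (st.basis.map fun b => b p * b i).sum) / Real.sqrt (st.power p)

lemma spec_greedyStep (st : GreedyState ℝ n) (p : Fin n) :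
    Spec K (greedyStep st p) (n * (3 * st.basis.length + 8) + 2)
      (· = ⟨st.points ++ [p], st.basis ++ [nextBasis K st p],
        fun i => st.power i - nextBasis K st p i * nextBasis K st p i⟩) := by
  refine (spec_sqrt _).bind_eq (s' := n * (3 * st.basis.length + 8) + 1) ?_ (by omega)
  refine (spec_tab_eq (v := nextBasis K st p) (s := 3 * st.basis.length + 4)
    (fun i => ?_) le_rfl).bind_eq (s' := n * 3 + 1) ?_ (by ring_nf; omega)
  · refine (spec_ker i p).bind_eq (s' := 3 * st.basis.length + 3) ?_ (by omega)
    refine (spec_sumList (c := 1) (fun b _ => spec_mul _ _) le_rfl).bind_eq (s' := 2) ?_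
      (by omega)
    exact (spec_sub _ _).bind_eq (spec_div _ _) le_rfl
  · refine (spec_tab_eq (s := 2)
      (v := fun i => st.power i - nextBasis K st p i * nextBasis K st p i) (fun i => ?_)
      le_rfl).bind_eq (s' := 1) ?_ (by omega)
    · exact (spec_mul _ _).bind_eq (spec_sub _ _) le_rfl
    · refine Spec.tick (s := 0) ?_ le_rfl
      exact Spec.ret rfl

/-- The state `st` is reached in some run of the P-greedy algorithm. The formulas hold for all
sequences that begin with the selected points. -/
structure GreedyInv (K : Fin n → Fin n → ℝ) (e2 : ℝ) (st : GreedyState ℝ n) : Prop where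
  length_eq : st.basis.length = st.points.length
  nodup : st.points.Nodup
  power_eq : ∀ ξ : ℕ → Fin n, (∀ m (h : m < st.points.length), ξ m = st.points[m]) →
    ∀ i, st.power i = powerSq K ξ st.points.length i
  basis_eq : ∀ ξ : ℕ → Fin n, (∀ m (h : m < st.points.length), ξ m = st.points[m]) →
    ∀ m (h : m < st.basis.length), st.basis[m] = newton K ξ m
  max : ∀ ξ : ℕ → Fin n, (∀ m (h : m < st.points.length), ξ m = st.points[m]) →
    ∀ m < st.points.length, ∀ x, powerSq K ξ m x ≤ powerSq K ξ m (ξ m)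
  large : ∀ ξ : ℕ → Fin n, (∀ m (h : m < st.points.length), ξ m = st.points[m]) →
    ∀ m, 1 ≤ m → m < st.points.length → ∃ x, e2 ≤ powerSq K ξ m x

lemma GreedyInv.step {e2 : ℝ} {st : GreedyState ℝ n} (h : GreedyInv K e2 st) {p : Fin n}
    (hp : ∀ i, st.power i ≤ st.power p) (hlarge : 1 ≤ st.points.length → e2 ≤ st.power p)
    (hnew : p ∉ st.points) :
    GreedyInv K e2 ⟨st.points ++ [p], st.basis ++ [nextBasis K st p],
        fun i => st.power i - nextBasis K st p i * nextBasis K st p i⟩ := by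
  have hpre : ∀ ξ : ℕ → Fin n,
      (∀ m (h : m < (st.points ++ [p]).length), ξ m = (st.points ++ [p])[m]) →
      (∀ m (h : m < st.points.length), ξ m = st.points[m]) ∧ ξ st.points.length = p := by
    intro ξ hξ
    refine ⟨fun m hm => ?_, ?_⟩
    · rw [hξ m (by simp; omega), List.getElem_append_left hm]
    · rw [hξ st.points.length (by simp)]
      simp
  have hN : ∀ ξ : ℕ → Fin n,
      (∀ m (h : m < (st.points ++ [p]).length), ξ m = (st.points ++ [p])[m]) →
      nextBasis K st p = newton K ξ st.points.length := by
    intro ξ hξ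
    obtain ⟨h1, h2⟩ := hpre ξ hξ
    funext i
    rw [newton_eq, h2, ← h.power_eq ξ h1, nextBasis]
    congr 2
    rw [← sum_fin_get, ← h.length_eq]
    refine Finset.sum_congr rfl fun k _ => ?_
    rw [List.get_eq_getElem, h.basis_eq ξ h1]
  constructor
  · simp [h.length_eq]
  · exact List.nodup_append.2 ⟨h.nodup, by simp, by
      intro a ha b hb
      rw [List.mem_singleton] at hb
      rintro rfl
      exact hnew (hb ▸ ha)⟩
  · intro ξ hξ i
    obtain ⟨h1, h2⟩ := hpre ξ hξ
    simp only [List.length_append, List.length_singleton, powerSq_succ]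
    rw [h.power_eq ξ h1, hN ξ hξ, sq]
  · intro ξ hξ m hm
    obtain ⟨h1, h2⟩ := hpre ξ hξ
    simp only [List.length_append, List.length_singleton] at hm
    rcases Nat.lt_succ_iff_lt_or_eq.1 hm with hm' | rfl
    · simp only
      rw [List.getElem_append_left hm', h.basis_eq ξ h1]
    · simp only [List.getElem_concat_length]
      rw [h.length_eq]
      exact hN ξ hξ
  · intro ξ hξ m hm x
    obtain ⟨h1, h2⟩ := hpre ξ hξ
    simp only [List.length_append, List.length_singleton] at hm
    rcases Nat.lt_succ_iff_lt_or_eq.1 hm with hm' | rfl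
    · exact h.max ξ h1 m hm' x
    · rw [h2, ← h.power_eq ξ h1, ← h.power_eq ξ h1]
      exact hp x
  · intro ξ hξ m hm1 hm
    obtain ⟨h1, h2⟩ := hpre ξ hξ
    simp only [List.length_append, List.length_singleton] at hm
    rcases Nat.lt_succ_iff_lt_or_eq.1 hm with hm' | rfl
    · exact h.large ξ h1 m hm1 hm'
    · exact ⟨p, by rw [← h.power_eq ξ h1]; exact hlarge hm1⟩

variable {E : Type*} [NormedAddCommGroup E] [InnerProductSpace ℝ E] {κ : Fin n → E}

/-- The squared power function vanishes at the selected points, so that none of them is selected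
again while the maximum is positive. -/
lemma GreedyInv.power_of_mem [NeZero n] (hκ : ∀ i j, inner ℝ (κ i) (κ j) = K i j) {e2 : ℝ}
    {st : GreedyState ℝ n} (h : GreedyInv K e2 st) {p : Fin n} (hp : p ∈ st.points) :
    st.power p = 0 := by
  obtain ⟨m, hm, rfl⟩ := List.getElem_of_mem hp
  have hξ : ∀ m (h : m < st.points.length), st.points.getD m 0 = st.points[m] := by
    intro m hm
    simp [List.getD_eq_getElem?_getD, hm]
  rw [h.power_eq _ hξ, ← hξ m hm]
  exact powerSq_apply_point hκ _ hm

lemma spec_greedyLoop [NeZero n] (hκ : ∀ i j, inner ℝ (κ i) (κ j) = K i j) {e2 : ℝ}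
    (he : 0 < e2) (fuel : ℕ) (st : GreedyState ℝ n) (h : GreedyInv K e2 st)
    (h1 : 1 ≤ st.points.length) (hf : st.points.length + fuel = n + 1) :
    ∃ st', GreedyInv K e2 st' ∧ 1 ≤ st'.points.length ∧ (∀ i, st'.power i < e2) ∧
      st.points.length ≤ st'.points.length ∧
      Spec K (greedyLoop e2 fuel st) ((st'.points.length - st.points.length + 1) *
        (n * (3 * st'.points.length + 10) + 3)) (· = st') := by
  induction fuel generalizing st with
  | zero =>
    have := h.nodup.length_le_card
    rw [Fintype.card_fin] at this
    omega
  | succ fuel ih =>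
    obtain ⟨p, hp, hmem, hmax⟩ := (spec_argmax (K := K) st.power 0 (List.finRange n)).exists_eq
    have hmax' : ∀ i, st.power i ≤ st.power p := fun i => hmax i (by simp)
    rw [List.length_finRange] at hp
    by_cases hle : e2 ≤ st.power p
    · have hnew : p ∉ st.points := fun hm => by
        rw [h.power_of_mem hκ hm] at hle
        linarith
      obtain ⟨st', hinv, hlen, hsmall, hmono, hspec⟩ := ih _
        (h.step hmax' (fun _ => hle) hnew) (by simp) (by simp; omega)
      simp only [List.length_append, List.length_singleton] at hmono hspec
      refine ⟨st', hinv, hlen, hsmall, by omega, ?_⟩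
      obtain ⟨d, hd⟩ := Nat.exists_eq_add_of_le hmono
      rw [show st'.points.length - (st.points.length + 1) + 1 = d + 1 by omega] at hspec
      rw [show st'.points.length - st.points.length + 1 = d + 2 by omega]
      set A := st'.points.length with hA
      refine hp.bind_eq (s' := n * (3 * st.points.length + 8) + 3 +
        (d + 1) * (n * (3 * A + 10) + 3)) ?_ ?_
      · refine Spec.ite_leq (s := n * (3 * st.points.length + 8) + 2 +
          (d + 1) * (n * (3 * A + 10) + 3)) (fun _ => ?_) (fun h => absurd hle (not_le.2 h))
          (by omega)
        have hs := spec_greedyStep (K := K) st p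
        rw [h.length_eq] at hs
        exact hs.bind_eq hspec le_rfl
      · have : n * (3 * st.points.length + 8) + 2 * n ≤ n * (3 * A + 10) := by
          calc _ = n * (3 * st.points.length + 10) := by ring
            _ ≤ _ := Nat.mul_le_mul_left _ (by omega)
        rw [show d + 2 = d + 1 + 1 by omega, Nat.succ_mul (d + 1)]
        omega
    · refine ⟨st, h, h1, fun i => (hmax' i).trans_lt (not_le.1 hle), le_rfl, ?_⟩
      refine hp.bind_eq (s' := 1) ?_ ?_
      · exact Spec.ite_leq (s := 0) (fun h => absurd h hle) (fun _ => Spec.ret rfl) le_rfl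
      · have : n * 2 ≤ n * (3 * st.points.length + 10) := Nat.mul_le_mul_left _ (by omega)
        rw [Nat.sub_self, zero_add, one_mul]
        omega

/-- The program for the P-greedy algorithm carries out the P-greedy algorithm. -/
lemma spec_greedy [NeZero n] (hκ : ∀ i j, inner ℝ (κ i) (κ j) = K i j) {e : ℝ} (he : 0 < e) :
    ∃ (st : GreedyState ℝ n), IsPGreedy K e (fun m => st.points.getD m 0) st.basis.length ∧
      st.basis.length ≤ n ∧
      (fun i (k : Fin st.basis.length) => st.basis.get k i) =
        feature K (fun m => st.points.getD m 0) st.basis.length ∧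
      Spec K (greedy (e ^ 2)) (40 * (n * st.basis.length ^ 2)) (· = st) := by
  have he2 : 0 < e ^ 2 := by positivity
  obtain ⟨p, hp, -, hmax⟩ := (spec_argmax (K := K) (fun i => K i i) 0 (List.finRange n)).exists_eq
  have hmax' : ∀ i, K i i ≤ K p p := fun i => hmax i (by simp)
  have h0 : GreedyInv K (e ^ 2) ⟨[], [], fun i => K i i⟩ :=
    ⟨rfl, by simp, fun ξ _ i => (powerSq_zero K ξ i).symm, by simp, by simp, by simp⟩
  obtain ⟨st, hinv, hlen, hsmall, hmono, hspec⟩ := spec_greedyLoop hκ he2 n _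
    (h0.step (p := p) hmax' (by simp) (by simp)) (by simp) (by simp; omega)
  have hξ : ∀ m (h : m < st.points.length), st.points.getD m 0 = st.points[m] := by
    intro m hm
    simp [List.getD_eq_getElem?_getD, hm]
  have hD : st.basis.length ≤ n := by
    have := hinv.nodup.length_le_card
    rw [Fintype.card_fin] at this
    exact hinv.length_eq.trans_le this
  refine ⟨st, ⟨by rw [hinv.length_eq]; exact hlen, ?_, ?_, ?_⟩, hD, ?_, ?_⟩
  · rw [hinv.length_eq]; exact hinv.max _ hξ
  · rw [hinv.length_eq]; exact hinv.large _ hξ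
  · intro x
    rw [hinv.length_eq, ← hinv.power_eq _ hξ]
    exact hsmall x
  · funext i k
    rw [feature, List.get_eq_getElem, hinv.basis_eq _ hξ]
  · refine (spec_tab_eq (s := 1) (fun i => spec_ker i i) le_rfl).bind_eq
      (s' := 2 * n + (n * 8 + 2) + (st.points.length) * (n * (3 * st.points.length + 10) + 3)) ?_ ?_
    · rw [List.length_finRange] at hp
      refine hp.bind_eq (s' := (n * 8 + 2) +
        (st.points.length) * (n * (3 * st.points.length + 10) + 3)) ?_ (by omega)
      refine (spec_greedyStep _ p).bind_eq hspec ?_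
      simp only [List.nil_append, List.length_singleton, List.length_nil]
      rw [Nat.sub_add_cancel hlen]
    · rw [hinv.length_eq]
      have hn : 1 ≤ n := Nat.one_le_iff_ne_zero.2 (NeZero.ne n)
      set A := st.points.length
      have h1 : n * 1 ≤ n * A ^ 2 := Nat.mul_le_mul_left _ (Nat.one_le_pow _ _ hlen)
      have h2 : n * A ≤ n * A ^ 2 := Nat.mul_le_mul_left _ (by nlinarith)
      have h3 : A ≤ n * A := Nat.le_mul_of_pos_left _ hn
      nlinarith

end Greedy

/-! ### Determinants along the Frank-Wolfe iteration -/

section Determinant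

variable {n : ℕ} {ι : Type*} [Fintype ι] [DecidableEq ι]

/-- The matrix `∑ i, w i • C i (C i)ᵀ`, for vectors with an arbitrary finite index set. -/
def wgram (C : Fin n → ι → ℝ) (w : Fin n → ℝ) : Matrix ι ι ℝ :=
  ∑ i, w i • Matrix.vecMulVec (C i) (C i)

omit [DecidableEq ι] in
lemma posSemidef_wgram (C : Fin n → ι → ℝ) {w : Fin n → ℝ} (hw : ∀ i, 0 ≤ w i) :
    (wgram C w).PosSemidef :=
  Matrix.posSemidef_sum _ fun i _ => (by
    have := Matrix.posSemidef_vecMulVec_self_star (R := ℝ) (C i)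
    rw [star_trivial] at this
    exact this.smul (hw i))

lemma det_le_exp_trace {A : Matrix ι ι ℝ} (hA : A.PosSemidef) :
    A.det ≤ Real.exp (A.trace - Fintype.card ι) := by
  have h1 : A.det = ∏ i, hA.1.eigenvalues i := by
    simpa using hA.1.det_eq_prod_eigenvalues
  have h2 : A.trace = ∑ i, hA.1.eigenvalues i := by
    simpa using hA.1.trace_eq_sum_eigenvalues
  have h3 : A.trace - Fintype.card ι = ∑ i, (hA.1.eigenvalues i - 1) := by
    rw [h2, Finset.sum_sub_distrib]
    simp
  rw [h3, Real.exp_sum, h1]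
  refine Finset.prod_le_prod (fun i _ => hA.eigenvalues_nonneg i) fun i _ => ?_
  have := Real.add_one_le_exp (hA.1.eigenvalues i - 1)
  linarith

/-- The inequality between the geometric and the arithmetic mean of the eigenvalues. -/
lemma det_le_pow_of_trace_le {A : Matrix ι ι ℝ} (hA : A.PosSemidef) {x : ℝ} (hx : 0 < x)
    (h : A.trace ≤ Fintype.card ι * x) : A.det ≤ x ^ Fintype.card ι := by
  have h1 := det_le_exp_trace (hA.smul (inv_nonneg.2 hx.le))
  rw [Matrix.det_smul, Matrix.trace_smul, smul_eq_mul] at h1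
  have h2 : x⁻¹ * A.trace - Fintype.card ι ≤ 0 := by
    rw [sub_nonpos, inv_mul_le_iff₀ hx, mul_comm]
    exact h
  have h3 := h1.trans (Real.exp_le_one_iff.2 h2)
  rw [inv_pow, inv_mul_le_iff₀ (by positivity), mul_one] at h3
  exact h3

omit [DecidableEq ι] in
lemma trace_mul_wgram (A : Matrix ι ι ℝ) (C : Fin n → ι → ℝ) (w : Fin n → ℝ) :
    (A * wgram C w).trace = ∑ i, w i * (C i ⬝ᵥ A *ᵥ C i) := by
  unfold wgram
  rw [Finset.mul_sum, Matrix.trace_sum]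
  refine Finset.sum_congr rfl fun i _ => ?_
  rw [Matrix.mul_smul, Matrix.trace_smul, Matrix.mul_vecMulVec, Matrix.trace_vecMulVec,
    smul_eq_mul, dotProduct_comm]

/-- If all Mahalanobis norms for `G` are at most `m`, then no design improves the determinant of
`G` by more than the factor `(m / r) ^ r`. -/
lemma det_wgram_le {G : Matrix ι ι ℝ} (hG : G.PosDef) (C : Fin n → ι → ℝ) {w : Fin n → ℝ}
    (hw : ∀ i, 0 ≤ w i) (h1 : ∑ i, w i = 1) {m : ℝ} (hm : 0 < m) (hr : 0 < Fintype.card ι)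
    (h : ∀ i, w i ≠ 0 → C i ⬝ᵥ G⁻¹ *ᵥ C i ≤ m) :
    (wgram C w).det ≤ G.det * (m / Fintype.card ι) ^ Fintype.card ι := by
  obtain ⟨X, hX⟩ : ∃ X : Matrix ι ι ℝ, G⁻¹ = X.conjTranspose * X := by
    open scoped MatrixOrder Matrix.Norms.L2Operator in
    exact CStarAlgebra.nonneg_iff_eq_star_mul_self.1 hG.inv.posSemidef.nonneg
  have hpsd : (X * wgram C w * X.conjTranspose).PosSemidef :=
    (posSemidef_wgram C hw).mul_mul_conjTranspose_same X
  have htr : (X * wgram C w * X.conjTranspose).trace =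
      ∑ i, w i * (C i ⬝ᵥ G⁻¹ *ᵥ C i) := by
    rw [Matrix.trace_mul_comm, ← Matrix.mul_assoc, ← hX, trace_mul_wgram]
  have hr' : (0 : ℝ) < Fintype.card ι := by exact_mod_cast hr
  have h2 : (X * wgram C w * X.conjTranspose).trace ≤
      Fintype.card ι * (m / Fintype.card ι) := by
    rw [htr, mul_div_cancel₀ _ hr'.ne']
    calc ∑ i, w i * (C i ⬝ᵥ G⁻¹ *ᵥ C i) ≤ ∑ i, w i * m := by
          refine Finset.sum_le_sum fun i _ => ?_
          by_cases hi : w i = 0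
          · simp [hi]
          · exact mul_le_mul_of_nonneg_left (h i hi) (hw i)
      _ = m := by rw [← Finset.sum_mul, h1, one_mul]
  have h3 := det_le_pow_of_trace_le hpsd (by positivity) h2
  have hdet : G.det * (X * wgram C w * X.conjTranspose).det = (wgram C w).det := by
    have h4 : G.det * (X.conjTranspose * X).det = 1 := by
      rw [← hX, ← Matrix.det_mul, Matrix.mul_nonsing_inv _ hG.det_pos.ne'.isUnit, Matrix.det_one]
    rw [Matrix.det_mul] at h4
    rw [Matrix.det_mul, Matrix.det_mul]
    calc _ = (G.det * (X.conjTranspose.det * X.det)) * (wgram C w).det := by ring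
      _ = _ := by rw [h4, one_mul]
  rw [← hdet]
  exact mul_le_mul_of_nonneg_left h3 hG.det_pos.le

/-- The determinant after one step of the Frank-Wolfe iteration. -/
lemma det_smul_add_smul_vecMulVec {G : Matrix ι ι ℝ} (hG : IsUnit G.det) {v h : ι → ℝ}
    (hv : G *ᵥ h = v) {a b : ℝ} (ha : a ≠ 0) :
    (a • G + b • Matrix.vecMulVec v v).det =
      a ^ Fintype.card ι * (1 + b / a * (v ⬝ᵥ h)) * G.det := by
  have h1 : a • G + b • Matrix.vecMulVec v v =
      a • (G + Matrix.replicateCol Unit ((b / a) • v) * Matrix.replicateRow Unit v) := by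
    rw [← Matrix.vecMulVec_eq, Matrix.smul_vecMulVec, smul_add, smul_smul, mul_div_cancel₀ _ ha]
  have h2 : G⁻¹ *ᵥ v = h := by
    rw [← hv, Matrix.mulVec_mulVec, Matrix.nonsing_inv_mul _ hG, Matrix.one_mulVec]
  rw [h1, Matrix.det_smul, Matrix.det_add_replicateCol_mul_replicateRow hG]
  have h3 : (1 + Matrix.replicateRow Unit v * G⁻¹ *
      Matrix.replicateCol Unit ((b / a) • v)).det = 1 + b / a * (v ⬝ᵥ h) := by
    rw [Matrix.det_unique, Matrix.add_apply, Matrix.one_apply_eq, Matrix.mul_assoc,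
      ← Matrix.replicateCol_mulVec, Matrix.mulVec_smul, h2]
    congr 1
    rw [Matrix.mul_apply]
    simp [dotProduct, Finset.mul_sum, mul_left_comm]
  rw [h3]
  ring

end Determinant

section Rate

/-- The factor by which a step of the Frank-Wolfe iteration increases the determinant, if the
squared Mahalanobis norm is `m`, which is at least twice the dimension `r`. -/
lemma half_add_le_factor {r : ℕ} (hr : 1 ≤ r) {m : ℝ} (hm : 0 ≤ m) :
    1 / 2 + 3 / 10 * (m / r) ≤ (1 - 1 / (2 * r : ℝ)) ^ r * (1 + m / (2 * r - 1)) := by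
  have hr' : (1 : ℝ) ≤ r := by exact_mod_cast hr
  have hinv : 1 / (2 * r : ℝ) ≤ 1 / 2 := by
    rw [div_le_div_iff₀ (by positivity) (by norm_num)]; linarith
  have h0 : (0 : ℝ) < 1 - 1 / (2 * r : ℝ) := by linarith
  have h1 : (1 : ℝ) / 2 ≤ (1 - 1 / (2 * r : ℝ)) ^ r := by
    have := one_add_mul_le_pow (a := -(1 / (2 * r : ℝ))) (by linarith) r
    have h2 : (r : ℝ) * -(1 / (2 * r : ℝ)) = -(1 / 2) := by field_simp
    rw [h2] at this
    rw [sub_eq_add_neg]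
    linarith
  obtain ⟨k, rfl⟩ : ∃ k, r = k + 1 := ⟨r - 1, by omega⟩
  push_cast at *
  have h2 : (3 : ℝ) / 5 ≤ (1 - 1 / (2 * (k + 1) : ℝ)) ^ k := by
    have hk : (1 - 1 / (2 * (k + 1) : ℝ))⁻¹ ≤ Real.exp (1 / (2 * k + 1)) := by
      have := Real.add_one_le_exp (1 / (2 * k + 1) : ℝ)
      refine le_trans (le_of_eq ?_) this
      rw [inv_eq_iff_eq_inv]
      have : (2 * k + 1 : ℝ) ≠ 0 := by positivity
      field_simp
      ring
    have hk2 : ((1 - 1 / (2 * (k + 1) : ℝ))⁻¹) ^ k ≤ Real.exp (1 / 2) := by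
      refine (pow_le_pow_left₀ (by positivity) hk k).trans ?_
      rw [← Real.exp_nat_mul, Real.exp_le_exp, mul_one_div, div_le_div_iff₀ (by positivity)
        (by norm_num)]
      linarith
    have hk3 : Real.exp (1 / 2) ≤ 5 / 3 := by
      refine le_of_abs_le (abs_le_of_sq_le_sq ?_ (by norm_num))
      rw [← Real.exp_nat_mul]
      have := Real.exp_one_lt_d9
      norm_num
      linarith
    rw [inv_pow] at hk2
    have hk4 := hk2.trans hk3
    rw [inv_le_comm₀ (by positivity) (by norm_num)] at hk4
    linarith
  have h3 : (1 - 1 / (2 * (k + 1) : ℝ)) * (m / (2 * (k + 1) - 1)) = m / (2 * (k + 1)) := by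
    have : (2 * (k + 1) - 1 : ℝ) ≠ 0 := by
      have : (0 : ℝ) ≤ k := Nat.cast_nonneg k
      linarith
    field_simp
  calc 1 / 2 + 3 / 10 * (m / (k + 1)) = 1 / 2 + 3 / 5 * (m / (2 * (k + 1))) := by
        field_simp; ring
    _ ≤ (1 - 1 / (2 * (k + 1) : ℝ)) ^ (k + 1) +
          (1 - 1 / (2 * (k + 1) : ℝ)) ^ k * (m / (2 * (k + 1))) := by gcongr
    _ = _ := by rw [← h3, pow_succ]; ring

/-- The elementary inequality behind the rate of convergence: as `2 * e ≤ (11 / 10) ^ 20`, it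
follows from Bernoulli's inequality with the exponent `20`. -/
lemma exp_le_half_add {δ x : ℝ} (hx : 2 ≤ x) (hδ : Real.exp δ ≤ x) :
    Real.exp ((1 + δ) / 20) ≤ 1 / 2 + 3 / 10 * x := by
  have h1 : Real.exp ((1 + δ) / 20) ^ 20 ≤ (1 / 2 + 3 / 10 * x) ^ 20 := by
    have h2 : Real.exp ((1 + δ) / 20) ^ 20 = Real.exp 1 * Real.exp δ := by
      rw [← Real.exp_nat_mul, ← Real.exp_add]
      congr 1
      push_cast
      ring
    have h3 : x / 2 ≤ (1 + (x / 2 - 1) / 20) ^ 20 := by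
      have := one_add_mul_le_pow (a := (x / 2 - 1) / 20) (by linarith) 20
      push_cast at this
      linarith
    have h4 := Real.exp_one_lt_d9
    calc Real.exp ((1 + δ) / 20) ^ 20 = Real.exp 1 * Real.exp δ := h2
      _ ≤ 2.7182818286 * x := mul_le_mul h4.le hδ (Real.exp_pos _).le (by norm_num)
      _ = (2 * 2.7182818286) * (x / 2) := by ring
      _ ≤ (11 / 10) ^ 20 * (1 + (x / 2 - 1) / 20) ^ 20 := by
          refine mul_le_mul (by norm_num) h3 (by linarith) (by norm_num)
      _ = (11 / 10 * (1 + (x / 2 - 1) / 20)) ^ 20 := by rw [mul_pow]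
      _ ≤ _ := by
          refine pow_le_pow_left₀ (by linarith) ?_ 20
          linarith
  exact le_of_pow_le_pow_left₀ (by norm_num) (by linarith) h1

/-- The gap `δ` between the logarithms of two determinants, per dimension: a step of the
Frank-Wolfe iteration decreases `1 + δ` by the factor `1 - 1 / (20 r)`. -/
lemma one_add_gap_le {r : ℕ} (hr : 1 ≤ r) {m a N : ℝ} (ha : 0 < a) (hN : 0 < N)
    (hm : 2 * r ≤ m) (hNa : N ≤ a * (m / r) ^ r) :
    1 + (Real.log N - Real.log ((1 - 1 / (2 * r : ℝ)) ^ r * (1 + m / (2 * r - 1)) * a)) / r ≤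
      (1 + (Real.log N - Real.log a) / r) * (1 - 1 / (20 * r)) := by
  have hr' : (1 : ℝ) ≤ r := by exact_mod_cast hr
  have hm0 : 0 < m := by linarith
  have hx : 2 ≤ m / r := by rw [le_div_iff₀ (by linarith)]; exact hm
  have hF := half_add_le_factor hr hm0.le
  set F := (1 - 1 / (2 * r : ℝ)) ^ r * (1 + m / (2 * r - 1)) with hFdef
  have hF0 : 0 < F := by linarith
  set δ := (Real.log N - Real.log a) / r with hδ
  have hδx : Real.exp δ ≤ m / r := by
    rw [← Real.le_log_iff_exp_le (by linarith), hδ, div_le_iff₀ (by linarith)]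
    have := Real.log_le_log hN hNa
    rw [Real.log_mul ha.ne' (by positivity), Real.log_pow] at this
    linarith
  have hlog : (1 + δ) / 20 ≤ Real.log F :=
    (Real.le_log_iff_exp_le hF0).2 ((exp_le_half_add hx hδx).trans hF)
  rw [Real.log_mul hF0.ne' ha.ne']
  have h1 : 1 + (Real.log N - (Real.log F + Real.log a)) / r = 1 + δ - Real.log F / r := by
    rw [hδ]; ring
  have h2 : (1 + δ) * (1 - 1 / (20 * r)) = 1 + δ - (1 + δ) / 20 / r := by
    field_simp
  rw [h1, h2]
  gcongr

/-- The number of steps that the Frank-Wolfe iteration may take is sufficient. -/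
lemma one_add_log_mul_pow_lt_one {r D : ℕ} (hr : 1 ≤ r) (hrD : r ≤ D) :
    (1 + Real.log r) * (1 - 1 / (20 * r : ℝ)) ^ (15 * D * (1 + Nat.log 2 (Nat.log 2 D + 1))) <
      1 := by
  have hr' : (1 : ℝ) ≤ r := by exact_mod_cast hr
  set k := Nat.log 2 (Nat.log 2 D + 1) with hk
  have hlog2 := Real.log_two_lt_d9
  have hlog2' := Real.log_two_gt_d9
  have hlogr : 1 + Real.log r ≤ 2 ^ (k + 1) := by
    have h1 : D < 2 ^ (Nat.log 2 D + 1) := Nat.lt_pow_succ_log_self one_lt_two D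
    have h2 : Nat.log 2 D + 1 < 2 ^ (k + 1) := Nat.lt_pow_succ_log_self one_lt_two _
    have h3 : (r : ℝ) ≤ 2 ^ (Nat.log 2 D + 1) := by exact_mod_cast hrD.trans h1.le
    have h4 := Real.log_le_log (by linarith) h3
    rw [Real.log_pow] at h4
    have h5 : ((Nat.log 2 D + 1 : ℕ) : ℝ) + 1 ≤ 2 ^ (k + 1) := by exact_mod_cast h2
    have h6 : (1 : ℝ) ≤ 2 ^ (k + 1) := one_le_pow₀ one_le_two
    push_cast at h4 h5
    nlinarith
  have hpow : (1 - 1 / (20 * r : ℝ)) ^ (15 * D * (1 + k)) ≤ Real.exp (-(3 / 4 * (k + 1))) := by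
    have h1 : (1 - 1 / (20 * r : ℝ)) ≤ Real.exp (-(1 / (20 * r : ℝ))) := by
      have := Real.add_one_le_exp (-(1 / (20 * r : ℝ)))
      linarith
    have h0 : (0 : ℝ) ≤ 1 - 1 / (20 * r : ℝ) := by
      rw [sub_nonneg, div_le_one (by positivity)]
      linarith
    refine (pow_le_pow_left₀ h0 h1 _).trans ?_
    rw [← Real.exp_nat_mul, Real.exp_le_exp, mul_neg, neg_le_neg_iff, mul_one_div,
      le_div_iff₀ (by positivity)]
    push_cast
    have : (r : ℝ) ≤ D := by exact_mod_cast hrD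
    have hk0 : (0 : ℝ) ≤ k := Nat.cast_nonneg k
    nlinarith
  calc (1 + Real.log r) * (1 - 1 / (20 * r : ℝ)) ^ (15 * D * (1 + k))
      ≤ 2 ^ (k + 1) * Real.exp (-(3 / 4 * (k + 1))) := by
        refine mul_le_mul hlogr hpow ?_ (by positivity)
        refine pow_nonneg ?_ _
        rw [sub_nonneg, div_le_one (by positivity)]
        linarith
    _ = Real.exp ((k + 1) * (Real.log 2 - 3 / 4)) := by
        have : (2 : ℝ) ^ (k + 1) = Real.exp ((k + 1) * Real.log 2) := by
          rw [← Real.exp_log (x := (2 : ℝ) ^ (k + 1)) (by positivity), Real.log_pow]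
          push_cast
          rfl
        rw [this, ← Real.exp_add]
        ring_nf
    _ < 1 := by
        rw [Real.exp_lt_one_iff]
        have hk0 : (0 : ℝ) ≤ k := Nat.cast_nonneg k
        nlinarith

end Rate

/-! ### The elimination by columns -/

section Coordinates

variable {n D : ℕ} {K : Fin n → Fin n → ℝ}

/-- The invariant of the elimination by columns: `J` is the set of pivot columns among the columns
`cols` that have been processed, `pv j` is the pivot arm of column `j`. Residuals `L (φ i)`,
coordinates `A (φ i)` and multipliers `B (φ i)` are linear functions of the feature vectors. The
multipliers of the active arms are bounded by `1` (the pivot entries are maximal), and those of the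
pivots form a unitriangular matrix. -/
structure ElimInv (φ : Fin n → Fin D → ℝ) (S : List (Fin n)) (cols : List (Fin D))
    (st : ElimState ℝ n D) (J : Finset (Fin D)) (pv : Fin D → Fin n)
    (L A B : (Fin D → ℝ) →ₗ[ℝ] (Fin D → ℝ)) : Prop where
  res_eq : ∀ i, st.res i = L (φ i)
  coord_eq : ∀ i, st.coord i = A (φ i)
  rep : ∀ i, φ i = st.res i + ∑ j ∈ J, st.coord i j • φ (pv j)
  coord_zero : ∀ i, ∀ j ∉ J, st.coord i j = 0
  mem_cols : ∀ j ∈ J, j ∈ cols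
  length_pivots : st.pivots.length = J.card
  mem_pivots : ∀ p, p ∈ st.pivots ↔ ∃ j ∈ J, pv j = p
  pv_mem : ∀ j ∈ J, pv j ∈ S
  res_pv : ∀ j ∈ J, st.res (pv j) = 0
  coord_pv : ∀ j ∈ J, st.coord (pv j) = Pi.single j 1
  abs_le : ∀ i ∈ S, ∀ j ∈ J, |B (φ i) j| ≤ 1
  diag : ∀ j ∈ J, B (φ (pv j)) j = 1
  tri : ∀ j ∈ J, ∀ k ∈ J, j < k → B (φ (pv j)) k = 0
  res_zero : ∀ i ∈ S, ∀ j ∈ cols, st.res i j = 0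

/-- A column in which all active arms have residual `0` needs no pivot. -/
lemma ElimInv.skip {φ : Fin n → Fin D → ℝ} {S : List (Fin n)} {cols : List (Fin D)}
    {st : ElimState ℝ n D} {J : Finset (Fin D)} {pv : Fin D → Fin n}
    {L A B : (Fin D → ℝ) →ₗ[ℝ] (Fin D → ℝ)} (h : ElimInv φ S cols st J pv L A B) {k : Fin D}
    (hk : ∀ i ∈ S, st.res i k = 0) : ElimInv φ S (cols ++ [k]) st J pv L A B :=
  { h with
    mem_cols := fun j hj => List.mem_append_left _ (h.mem_cols j hj)
    res_zero := fun i hi j hj => by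
      rcases List.mem_append.1 hj with h' | h'
      · exact h.res_zero i hi j h'
      · rw [List.mem_singleton.1 h']; exact hk i hi }

/-- Elimination of column `k` with the pivot arm `p`. The multiplier of an arm in the new column is
its residual divided by the one of `p`, hence at most `1` for the active arms. -/
lemma ElimInv.pivot {φ : Fin n → Fin D → ℝ} {S : List (Fin n)} {cols : List (Fin D)}
    {st : ElimState ℝ n D} {J : Finset (Fin D)} {pv : Fin D → Fin n}
    {L A B : (Fin D → ℝ) →ₗ[ℝ] (Fin D → ℝ)} (h : ElimInv φ S cols st J pv L A B) {k : Fin D}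
    (hcols : ∀ j ∈ cols, j < k) {p : Fin n} (hp : p ∈ S) (hpk : st.res p k ≠ 0)
    (hmax : ∀ i ∈ S, |st.res i k| ≤ |st.res p k|) :
    ∃ L' A' B', ElimInv φ S (cols ++ [k])
      ⟨fun i j => st.res i j - st.res i k / st.res p k * st.res p j,
        fun i j => if j = k then st.res i k / st.res p k else
          st.coord i j - st.res i k / st.res p k * st.coord p j,
        st.pivots ++ [p]⟩ (insert k J) (Function.update pv k p) L' A' B' := by
  have hkJ : k ∉ J := fun hk => lt_irrefl k (hcols k (h.mem_cols k hk))
  have hne : ∀ j ∈ J, j ≠ k := fun j hj hjk => hkJ (hjk ▸ hj)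
  have hpv : ∀ j ∈ J, Function.update pv k p j = pv j := fun j hj =>
    Function.update_of_ne (hne j hj) _ _
  set τ : (Fin D → ℝ) →ₗ[ℝ] ℝ := (st.res p k)⁻¹ • (LinearMap.proj k ∘ₗ L) with hτ
  have hτφ : ∀ i, τ (φ i) = st.res i k / st.res p k := by
    intro i
    rw [hτ, h.res_eq i]
    simp [div_eq_inv_mul]
  have hτpv : ∀ j ∈ J, st.res (pv j) k = 0 := fun j hj => by rw [h.res_pv j hj]; rfl
  refine ⟨L - τ.smulRight (st.res p),
    LinearMap.pi fun j => if j = k then τ else LinearMap.proj j ∘ₗ A - st.coord p j • τ,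
    LinearMap.pi fun j => if j = k then τ else LinearMap.proj j ∘ₗ B, ?_⟩
  constructor
  · intro i
    funext j
    simp [hτφ, h.res_eq i]
  · intro i
    funext j
    by_cases hj : j = k
    · subst hj; simp [hτφ]
    · simp [hj, hτφ, h.coord_eq i, mul_comm]
  · intro i
    rw [Finset.sum_insert hkJ]
    simp only [if_true, Function.update_self]
    have h1 : ∑ j ∈ J, (if j = k then st.res i k / st.res p k else
          st.coord i j - st.res i k / st.res p k * st.coord p j) •
            φ (Function.update pv k p j) =
        ∑ j ∈ J, st.coord i j • φ (pv j) -
          (st.res i k / st.res p k) • ∑ j ∈ J, st.coord p j • φ (pv j) := by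
      rw [Finset.smul_sum, ← Finset.sum_sub_distrib]
      refine Finset.sum_congr rfl fun j hj => ?_
      rw [if_neg (hne j hj), hpv j hj, sub_smul, smul_smul]
    have h2 : (fun j => st.res i j - st.res i k / st.res p k * st.res p j) =
        st.res i - (st.res i k / st.res p k) • st.res p := rfl
    rw [h1, h2]
    nth_rewrite 1 [h.rep i]
    nth_rewrite 1 [h.rep p]
    rw [smul_add]
    abel
  · intro i j hj
    rw [Finset.mem_insert, not_or] at hj
    simp [hj.1, h.coord_zero _ j hj.2]
  · intro j hj
    rcases Finset.mem_insert.1 hj with rfl | hj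
    · simp
    · exact List.mem_append_left _ (h.mem_cols j hj)
  · simp [h.length_pivots, hkJ]
  · intro q
    simp only [List.mem_append, h.mem_pivots, List.mem_singleton, Finset.mem_insert]
    constructor
    · rintro (⟨j, hj, rfl⟩ | rfl)
      · exact ⟨j, Or.inr hj, hpv j hj⟩
      · exact ⟨k, Or.inl rfl, Function.update_self _ _ _⟩
    · rintro ⟨j, rfl | hj, rfl⟩
      · right; simp
      · left; exact ⟨j, hj, (hpv j hj).symm⟩
  · intro j hj
    rcases Finset.mem_insert.1 hj with rfl | hj
    · simpa using hp
    · rw [hpv j hj]; exact h.pv_mem j hj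
  · intro j hj
    rcases Finset.mem_insert.1 hj with rfl | hj
    · funext m
      simp [hpk]
    · funext m
      simp only [hpv j hj, hτpv j hj, zero_div, zero_mul, sub_zero]
      rw [h.res_pv j hj]
  · intro j hj
    rcases Finset.mem_insert.1 hj with rfl | hj
    · funext m
      simp only [Function.update_self, div_self hpk, one_mul, sub_self]
      by_cases hm : m = j
      · simp [hm]
      · simp [hm]
    · funext m
      simp only [hpv j hj, hτpv j hj, zero_div, zero_mul, sub_zero]
      by_cases hm : m = k
      · subst hm
        have hjm : m ≠ j := fun h => hkJ (h ▸ ‹j ∈ J›)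
        simp [hjm]
      · simp [hm, h.coord_pv j hj]
  · intro i hi j hj
    by_cases hjk : j = k
    · subst hjk
      simp only [LinearMap.pi_apply, if_true, hτφ, abs_div]
      exact div_le_one_of_le₀ (hmax i hi) (abs_nonneg _)
    · simp only [LinearMap.pi_apply, hjk, if_false]
      exact h.abs_le i hi j ((Finset.mem_insert.1 hj).resolve_left hjk)
  · intro j hj
    by_cases hjk : j = k
    · subst hjk
      simp [hτφ, hpk]
    · have hj' := (Finset.mem_insert.1 hj).resolve_left hjk
      simp only [LinearMap.pi_apply, hjk, if_false, hpv j hj']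
      exact h.diag j hj'
  · intro j hj m hm hjm
    by_cases hmk : m = k
    · subst hmk
      have hj' := (Finset.mem_insert.1 hj).resolve_left hjm.ne
      simp [hτφ, hpv j hj', hτpv j hj']
    · have hm' := (Finset.mem_insert.1 hm).resolve_left hmk
      have hjk : j ≠ k := fun hjk =>
        lt_asymm (hjk ▸ hjm) (hcols m (h.mem_cols m hm'))
      have hj' := (Finset.mem_insert.1 hj).resolve_left hjk
      simp only [LinearMap.pi_apply, hmk, if_false, hpv j hj']
      exact h.tri j hj' m hm' hjm
  · intro i hi j hj
    rcases List.mem_append.1 hj with hj | hj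
    · simp [h.res_zero i hi j hj, h.res_zero p hp j hj]
    · rw [List.mem_singleton.1 hj]
      simp [hpk]

lemma spec_elimColumn {φ : Fin n → Fin D → ℝ} {a : Fin n} {l : List (Fin n)}
    (hl : l.length ≤ n) {cols : List (Fin D)} {st : ElimState ℝ n D} {k : Fin D}
    (hcols : ∀ j ∈ cols, j < k)
    (h : ∃ J pv L A B, ElimInv φ (a :: l) cols st J pv L A B) :
    Spec K (elimColumn a l st k) (6 * (n * D) + 8 * n + 3)
      fun st' => ∃ J pv L A B, ElimInv φ (a :: l) (cols ++ [k]) st' J pv L A B := by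
  obtain ⟨J, pv, L, A, B, h⟩ := h
  refine (spec_tab_eq (s := 1) (v := fun i => st.res i k * st.res i k) (fun i => spec_mul _ _)
    le_rfl).bind_eq (s' := 6 * (n * D) + 6 * n + 3) ?_ (by omega)
  refine (spec_argmax _ a l).bind (s' := 6 * (n * D) + 4 * n + 3) (fun p hp => ?_) (by omega)
  obtain ⟨hp, hmax⟩ := hp
  refine (spec_nat 0).bind_eq (s' := 6 * (n * D) + 4 * n + 2) ?_ (by omega)
  refine Spec.ite_leq (s := 6 * (n * D) + 4 * n + 1) (fun hle => Spec.ret ?_) (fun hlt => ?_) le_rfl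
  · refine ⟨J, pv, L, A, B, h.skip fun i hi => ?_⟩
    have h1 := (hmax i hi).trans hle
    simp only [Nat.cast_zero] at h1
    exact mul_self_eq_zero.1 (le_antisymm h1 (mul_self_nonneg _))
  · simp only [Nat.cast_zero] at hlt
    have hpk : st.res p k ≠ 0 := fun h0 => by rw [h0] at hlt; simp at hlt
    refine (spec_tab_eq (s := 1) (v := fun i => st.res i k / st.res p k) (fun i => spec_div _ _)
      le_rfl).bind_eq (s' := 6 * (n * D) + 2 * n + 1) ?_ (by omega)
    refine (spec_tab₂_eq (s := 2)
      (v := fun i j => st.res i j - st.res i k / st.res p k * st.res p j)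
      (fun i j => (spec_mul _ _).bind_eq (spec_sub _ _) le_rfl) le_rfl).bind_eq
      (s' := 3 * (n * D) + n + 1) ?_ (by ring_nf; omega)
    refine (spec_tab₂_eq (s := 2)
      (v := fun i j => if j = k then st.res i k / st.res p k else
          st.coord i j - st.res i k / st.res p k * st.coord p j)
      (fun i j => ?_) le_rfl).bind_eq (s' := 1) ?_ (by ring_nf; omega)
    · by_cases hj : j = k
      · simp only [hj, if_true]
        exact Spec.ret rfl
      · simp only [hj, if_false]
        exact (spec_mul _ _).bind_eq (spec_sub _ _) le_rfl
    · refine Spec.tick (s := 0) ?_ le_rfl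
      refine Spec.ret ?_
      obtain ⟨L', A', B', h'⟩ := h.pivot hcols hp hpk fun i hi =>
        sq_le_sq.1 (by simpa [sq] using hmax i hi)
      exact ⟨_, _, L', A', B', h'⟩

lemma spec_coordinates (φ : Fin n → Fin D → ℝ) (a : Fin n) {l : List (Fin n)}
    (hl : l.length ≤ n) (hD : 1 ≤ D) (hn : 1 ≤ n) :
    Spec K (coordinates φ a l) (21 * (n * D ^ 2))
      fun st => ∃ J pv L A B, ElimInv φ (a :: l) (List.finRange D) st J pv L A B := by
  refine (spec_tab₂_eq (s := 1) (v := fun _ _ => ((0 : ℕ) : ℝ)) (fun _ _ => spec_nat 0)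
    le_rfl).bind_eq (s' := D * (6 * (n * D) + 8 * n + 4)) ?_ ?_
  · refine spec_loop (c := 6 * (n * D) + 8 * n + 3)
      (fun cols st => ∃ J pv L A B, ElimInv φ (a :: l) cols st J pv L A B) ?_ ?_ (by simp)
    · refine ⟨∅, fun _ => a, LinearMap.id, 0, 0, ?_⟩
      constructor <;> simp
      intro i
      rfl
    · intro pre k post hpre st hst
      refine spec_elimColumn hl (fun j hj => ?_) hst
      have hs : (List.finRange D).Pairwise (· < ·) := List.pairwise_lt_finRange D
      rw [hpre, List.pairwise_append] at hs
      exact hs.2.2 j hj k (by simp)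
  · have h1 : n * D ≤ n * D ^ 2 := Nat.mul_le_mul_left _ (by nlinarith)
    have h2 : n ≤ n * D := Nat.le_mul_of_pos_right _ hD
    have h3 : D ≤ n * D := Nat.le_mul_of_pos_left _ hn
    nlinarith

end Coordinates

/-! ### The Frank-Wolfe iteration -/

section Design

variable {n D : ℕ} {K : Fin n → Fin n → ℝ}

/-- `H` is symmetric and acts as the inverse of `gram c w` on the vectors `c i`, for `i` in `S`. -/
structure IsInv (c : Fin n → Fin D → ℝ) (S : List (Fin n)) (w : Fin n → ℝ)
    (H : Fin D → Fin D → ℝ) : Prop where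
  symm : ∀ i j, H i j = H j i
  inv : ∀ i ∈ S, gram c w *ᵥ (Matrix.of H *ᵥ c i) = c i

variable {c : Fin n → Fin D → ℝ} {S : List (Fin n)} {w : Fin n → ℝ} {H : Fin D → Fin D → ℝ}

lemma IsInv.dotProduct_comm (h : IsInv c S w H) (u v : Fin D → ℝ) :
    u ⬝ᵥ Matrix.of H *ᵥ v = v ⬝ᵥ Matrix.of H *ᵥ u := by
  have hT : (Matrix.of H).transpose = Matrix.of H := by
    ext i j
    exact h.symm j i
  rw [Matrix.dotProduct_mulVec, ← Matrix.mulVec_transpose, hT, _root_.dotProduct_comm]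

lemma IsInv.nonneg (h : IsInv c S w H) (hw : ∀ i, 0 ≤ w i) {p : Fin n} (hp : p ∈ S) :
    0 ≤ c p ⬝ᵥ Matrix.of H *ᵥ c p := by
  have h1 := dotProduct_gram_mulVec_self_nonneg c hw (Matrix.of H *ᵥ c p)
  rwa [h.inv p hp, _root_.dotProduct_comm] at h1

lemma of_mulVec_rankOne {H H' : Fin D → Fin D → ℝ} {g : Fin D → ℝ} {s q : ℝ}
    (hH' : ∀ i j, H' i j = s * (H i j - q * (g i * g j))) (v : Fin D → ℝ) :
    Matrix.of H' *ᵥ v = s • (Matrix.of H *ᵥ v - (q * (g ⬝ᵥ v)) • g) := by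
  funext i
  simp only [Matrix.mulVec, dotProduct, Matrix.of_apply, hH', Pi.smul_apply, Pi.sub_apply,
    smul_eq_mul, Finset.mul_sum, Finset.sum_mul, mul_sub, sub_mul, ← Finset.sum_sub_distrib]
  refine Finset.sum_congr rfl fun j _ => ?_
  ring

/-- The Sherman-Morrison formula. -/
lemma IsInv.update (h : IsInv c S w H) {p : Fin n} (hp : p ∈ S) {a b s q : ℝ} (has : a * s = 1)
    (hq : q * (a + b * (c p ⬝ᵥ Matrix.of H *ᵥ c p)) = b) {w' : Fin n → ℝ}
    (hw' : ∀ i, w' i = a * w i + if i = p then b else 0) {H' : Fin D → Fin D → ℝ}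
    (hH' : ∀ i j, H' i j =
      s * (H i j - q * ((Matrix.of H *ᵥ c p) i * (Matrix.of H *ᵥ c p) j))) :
    IsInv c S w' H' := by
  set g := Matrix.of H *ᵥ c p with hg
  have hgram : ∀ v, gram c w' *ᵥ v = a • (gram c w *ᵥ v) + (b * (c p ⬝ᵥ v)) • c p := by
    intro v
    rw [gram_mulVec, gram_mulVec, Finset.smul_sum]
    have : (b * (c p ⬝ᵥ v)) • c p =
        ∑ i, (if i = p then b else 0) • ((c i ⬝ᵥ v) • c i) := by
      rw [Finset.sum_eq_single p]
      · simp [smul_smul]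
      · intro i _ hi; simp [hi]
      · simp
    rw [this, ← Finset.sum_add_distrib]
    refine Finset.sum_congr rfl fun i _ => ?_
    rw [hw', smul_smul, smul_smul, ← add_smul]
    congr 1
    ring
  refine ⟨fun i j => ?_, fun i hi => ?_⟩
  · rw [hH', hH', h.symm i j, mul_comm (g i)]
  · have hgi : g ⬝ᵥ c i = c p ⬝ᵥ Matrix.of H *ᵥ c i := by
      rw [_root_.dotProduct_comm, hg, h.dotProduct_comm]
    rw [hgram, of_mulVec_rankOne hH', Matrix.mulVec_smul, Matrix.mulVec_sub, Matrix.mulVec_smul,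
      h.inv i hi, hg,
      h.inv p hp, ← hg, smul_smul, has, one_smul, dotProduct_smul, dotProduct_sub,
      dotProduct_smul, ← hgi, sub_add, ← sub_smul]
    have h0 : q * (g ⬝ᵥ c i) - b * s • (g ⬝ᵥ c i - (q * g ⬝ᵥ c i) • (c p ⬝ᵥ g)) = 0 := by
      simp only [smul_eq_mul]
      linear_combination (s * (g ⬝ᵥ c i)) * hq - (q * (g ⬝ᵥ c i)) * has
    rw [h0, zero_smul, sub_zero]

/-- The feature vectors in coordinates, restricted to the set `J` of pivot columns. -/
abbrev restr (c : Fin n → Fin D → ℝ) (J : Finset (Fin D)) (i : Fin n) (j : J) : ℝ := c i j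

lemma dotProduct_restr {J : Finset (Fin D)} (hc : ∀ i, ∀ j ∉ J, c i j = 0) (i : Fin n)
    (v : Fin D → ℝ) : (restr c J i ⬝ᵥ fun j : J => v j) = c i ⬝ᵥ v := by
  unfold dotProduct
  rw [Finset.sum_coe_sort J fun j => c i j * v j]
  refine Finset.sum_subset (Finset.subset_univ J) fun j _ hj => ?_
  rw [hc i j hj, zero_mul]

lemma wgram_restr_mulVec {J : Finset (Fin D)} (hc : ∀ i, ∀ j ∉ J, c i j = 0) (w : Fin n → ℝ)
    (v : Fin D → ℝ) :
    wgram (restr c J) w *ᵥ (fun j : J => v j) = fun j : J => (gram c w *ᵥ v) j := by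
  rw [gram_mulVec]
  unfold wgram
  rw [Matrix.sum_mulVec]
  funext j
  rw [Finset.sum_apply, Finset.sum_apply]
  refine Finset.sum_congr rfl fun i _ => ?_
  rw [Matrix.smul_mulVec, Matrix.vecMulVec_mulVec, op_smul_eq_smul, dotProduct_restr hc, smul_smul]
  rfl

/-- The invariant of the Frank-Wolfe iteration: `b` bounds the size of the support. -/
structure DesignInv (c : Fin n → Fin D → ℝ) (S : List (Fin n)) (J : Finset (Fin D)) (b : ℕ)
    (st : DesignState ℝ n D) : Prop where
  nonneg : ∀ i, 0 ≤ st.weight i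
  supp : ∀ i, i ∉ S → st.weight i = 0
  sum_eq : ∑ i, st.weight i = 1
  isInv : IsInv c S st.weight st.inv
  lev_eq : ∀ i, st.lev i = c i ⬝ᵥ Matrix.of st.inv *ᵥ c i
  card_le : (Finset.univ.filter fun i => st.weight i ≠ 0).card ≤ b
  det_pos : 0 < (wgram (restr c J) st.weight).det

variable {J : Finset (Fin D)}

/-- Compared with any other design of the iteration, a design with the maximal Mahalanobis norm
`lev p` has at least the determinant divided by `(lev p / r) ^ r`. -/
lemma DesignInv.det_le (hc : ∀ i, ∀ j ∉ J, c i j = 0) {b b' : ℕ} {st st' : DesignState ℝ n D}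
    (h : DesignInv c S J b st) (h' : DesignInv c S J b' st') (hJ : 0 < J.card) {m : ℝ}
    (hm : 0 < m) (hmax : ∀ i ∈ S, st.lev i ≤ m) :
    (wgram (restr c J) st'.weight).det ≤
      (wgram (restr c J) st.weight).det * (m / J.card) ^ J.card := by
  have hpd : (wgram (restr c J) st.weight).PosDef :=
    (posSemidef_wgram _ h.nonneg).posDef_iff_det_ne_zero.2 h.det_pos.ne'
  have key := det_wgram_le hpd (restr c J) h'.nonneg h'.sum_eq hm (by simpa using hJ)
    fun i hi => by
      have hiS : i ∈ S := by
        by_contra hn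
        exact hi (h'.supp i hn)
      have h1 : wgram (restr c J) st.weight *ᵥ
          (fun j : J => (Matrix.of st.inv *ᵥ c i) j) = restr c J i := by
        rw [wgram_restr_mulVec hc, h.isInv.inv i hiS]
      have h2 : (wgram (restr c J) st.weight)⁻¹ *ᵥ restr c J i =
          fun j : J => (Matrix.of st.inv *ᵥ c i) j := by
        rw [← h1, Matrix.mulVec_mulVec, Matrix.nonsing_inv_mul _ h.det_pos.ne'.isUnit,
          Matrix.one_mulVec]
      rw [h2, dotProduct_restr hc, ← h.lev_eq]
      exact hmax i hiS
  simpa using key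

/-- One step of the Frank-Wolfe iteration. -/
lemma DesignInv.step (hc : ∀ i, ∀ j ∉ J, c i j = 0) {b : ℕ} {st : DesignState ℝ n D}
    (h : DesignInv c S J b st) (hJ : 1 ≤ J.card) {p : Fin n} (hp : p ∈ S) {s den stp : ℝ}
    (hs : s = 2 * J.card / (2 * J.card - 1)) (hden : den = 2 * J.card - 1 + st.lev p)
    (hstp : stp = 1 / (2 * J.card)) {st' : DesignState ℝ n D}
    (hw : ∀ i, st'.weight i = if i = p then st.weight i / s + stp else st.weight i / s)
    (hH : ∀ i j, st'.inv i j = s * (st.inv i j -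
      (Matrix.of st.inv *ᵥ c p) i * (Matrix.of st.inv *ᵥ c p) j / den))
    (hlev : ∀ i, st'.lev i = s * (st.lev i -
      (c i ⬝ᵥ Matrix.of st.inv *ᵥ c p) * (c i ⬝ᵥ Matrix.of st.inv *ᵥ c p) / den)) :
    DesignInv c S J (b + 1) st' ∧
      (wgram (restr c J) st'.weight).det = (1 - 1 / (2 * J.card : ℝ)) ^ J.card *
        (1 + st.lev p / (2 * J.card - 1)) * (wgram (restr c J) st.weight).det := by
  have hr : (1 : ℝ) ≤ J.card := by exact_mod_cast hJ
  have hr2 : (0 : ℝ) < 2 * J.card - 1 := by linarith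
  have hs0 : 0 < s := by rw [hs]; positivity
  have hstp0 : 0 < stp := by rw [hstp]; positivity
  have has : s⁻¹ = 1 - stp := by
    rw [hs, hstp]
    field_simp
  have hlev0 : 0 ≤ st.lev p := by rw [h.lev_eq]; exact h.isInv.nonneg h.nonneg hp
  have hden0 : 0 < den := by rw [hden]; linarith
  have hw' : ∀ i, st'.weight i = s⁻¹ * st.weight i + if i = p then stp else 0 := by
    intro i
    rw [hw]
    split_ifs <;> rw [div_eq_inv_mul]
    simp
  have hq : den⁻¹ * (s⁻¹ + stp * st.lev p) = stp := by
    rw [inv_mul_eq_iff_eq_mul₀ hden0.ne', has, hden, hstp]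
    field_simp
  have hinv : IsInv c S st'.weight st'.inv := by
    refine h.isInv.update hp (s := s) (q := den⁻¹) (inv_mul_cancel₀ hs0.ne') ?_ hw' fun i j => ?_
    · rw [← h.lev_eq]; exact hq
    · rw [hH]; ring
  refine ⟨⟨fun i => ?_, fun i hi => ?_, ?_, hinv, fun i => ?_, ?_, ?_⟩, ?_⟩
  · rw [hw']
    have := h.nonneg i
    split_ifs <;> positivity
  · have hip : i ≠ p := fun hip => hi (hip ▸ hp)
    rw [hw', h.supp i hi, if_neg hip]
    simp
  · simp only [hw', Finset.sum_add_distrib, ← Finset.mul_sum, h.sum_eq, Finset.sum_ite_eq',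
      Finset.mem_univ, if_true, has]
    ring
  · have hmul := of_mulVec_rankOne (H := st.inv) (H' := st'.inv)
      (g := Matrix.of st.inv *ᵥ c p) (s := s) (q := den⁻¹)
      (fun i j => by rw [hH]; ring) (c i)
    rw [hmul, dotProduct_smul, dotProduct_sub, dotProduct_smul, hlev, h.lev_eq,
      dotProduct_comm (Matrix.of st.inv *ᵥ c p) (c i)]
    simp only [smul_eq_mul]
    ring
  · calc (Finset.univ.filter fun i => st'.weight i ≠ 0).card
        ≤ (insert p (Finset.univ.filter fun i => st.weight i ≠ 0)).card := by
          refine Finset.card_le_card fun i hi => ?_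
          rw [Finset.mem_filter, hw'] at hi
          rw [Finset.mem_insert, Finset.mem_filter]
          by_cases hip : i = p
          · exact Or.inl hip
          · right
            refine ⟨Finset.mem_univ i, fun h0 => hi.2 ?_⟩
            simp [h0, hip]
      _ ≤ _ := (Finset.card_insert_le _ _).trans (Nat.add_le_add_right h.card_le 1)
  all_goals
    have hG : wgram (restr c J) st'.weight = (1 - stp) • wgram (restr c J) st.weight +
        stp • Matrix.vecMulVec (restr c J p) (restr c J p) := by
      have : stp • Matrix.vecMulVec (restr c J p) (restr c J p) =
          ∑ i, (if i = p then stp else 0) •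
            Matrix.vecMulVec (restr c J i) (restr c J i) := by
        rw [Finset.sum_eq_single p]
        · simp
        · intro i _ hi; simp [hi]
        · simp
      unfold wgram
      rw [this, Finset.smul_sum, ← Finset.sum_add_distrib]
      refine Finset.sum_congr rfl fun i _ => ?_
      rw [hw', smul_smul, ← add_smul, has]
    have h1 : wgram (restr c J) st.weight *ᵥ
        (fun j : J => (Matrix.of st.inv *ᵥ c p) j) = restr c J p := by
      rw [wgram_restr_mulVec hc, h.isInv.inv p hp]
    have hne : 1 - stp ≠ 0 := by rw [← has]; positivity
    have hdet := det_smul_add_smul_vecMulVec (b := stp) h.det_pos.ne'.isUnit h1 hne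
    rw [← hG, dotProduct_restr hc, ← h.lev_eq, Fintype.card_coe] at hdet
    have hquot : stp / (1 - stp) = 1 / (2 * J.card - 1) := by
      rw [← has, hs, hstp]
      field_simp
    rw [hquot, hstp, one_div_mul_eq_div] at hdet
  · rw [hdet]
    have h2 : (0 : ℝ) < 1 - 1 / (2 * J.card) := by
      rw [sub_pos, div_lt_one (by positivity)]
      linarith
    have := h.det_pos
    positivity
  · exact hdet

/-- If the iteration uses up its `fuel`, then the gap between the determinants of the first and the
last design satisfies the inequality that `one_add_log_mul_pow_lt_one` excludes. -/
lemma spec_designLoop (hc : ∀ i, ∀ j ∉ J, c i j = 0) {a : Fin n} {l : List (Fin n)}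
    (hl : l.length ≤ n) (hDn : D ≤ n) (hD : 1 ≤ D) (fuel : ℕ) {b : ℕ} {st : DesignState ℝ n D}
    (h : DesignInv c (a :: l) J b st) :
    ∃ st', DesignInv c (a :: l) J (b + fuel) st' ∧
      Spec K (designLoop c J.card a l fuel st) (fuel * (35 * (n * D))) (· = st') ∧
      ((∀ i ∈ a :: l, st'.lev i ≤ 2 * D) ∨ 1 ≤ J.card ∧
        1 ≤ (1 + (Real.log (wgram (restr c J) st'.weight).det -
          Real.log (wgram (restr c J) st.weight).det) / J.card) *
            (1 - 1 / (20 * J.card : ℝ)) ^ fuel) := by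
  have hrD : J.card ≤ D := by simpa using Finset.card_le_univ J
  have hJ : ∀ {st : DesignState ℝ n D} {b : ℕ}, DesignInv c (a :: l) J b st → ∀ p,
      2 * D < st.lev p → 1 ≤ J.card := by
    intro st b h p hlt
    rw [Nat.one_le_iff_ne_zero]
    intro h0
    have hp0 : c p = 0 := by
      funext j
      exact hc p j (by rw [Finset.card_eq_zero.1 h0]; simp)
    rw [h.lev_eq, hp0, zero_dotProduct] at hlt
    have : (0 : ℝ) ≤ D := Nat.cast_nonneg D
    linarith
  induction fuel generalizing b st with
  | zero =>
    refine ⟨st, h, Spec.ret rfl, ?_⟩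
    by_cases hall : ∀ i ∈ a :: l, st.lev i ≤ 2 * D
    · exact Or.inl hall
    · push Not at hall
      obtain ⟨p, -, hlt⟩ := hall
      exact Or.inr ⟨hJ h p hlt, by simp⟩
  | succ fuel ih =>
    obtain ⟨p, hps, hp, hmax⟩ := (spec_argmax (K := K) st.lev a l).exists_eq
    have hcost : 2 * l.length + (D * (3 * D + 2) + (D * (D * 5 + 1)) + n * (3 * D + 6) + 3 * n +
        10) ≤ 35 * (n * D) := by
      have h1 : D * D ≤ n * D := Nat.mul_le_mul_right _ hDn
      have h2 : n ≤ n * D := Nat.le_mul_of_pos_right _ hD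
      have h3 : D ≤ n * D := hDn.trans h2
      have h4 : 1 ≤ n * D := hD.trans h3
      nlinarith
    by_cases hle : st.lev p ≤ 2 * D
    · refine ⟨st, { h with card_le := h.card_le.trans (by omega) }, ?_,
        Or.inl fun i hi => (hmax i hi).trans hle⟩
      refine hps.bind_eq (s' := 2) ?_ ?_
      · refine (spec_nat (2 * D)).bind_eq (s' := 1) ?_ le_rfl
        push_cast
        exact Spec.ite_leq (s := 0) (fun _ => Spec.ret rfl) (fun h => absurd hle (not_le.2 h))
          le_rfl
      · rw [Nat.succ_mul fuel]
        omega
    · have hlt := not_le.1 hle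
      have hr := hJ h p hlt
      have hr' : (1 : ℝ) ≤ J.card := by exact_mod_cast hr
      have hcast : ((2 * J.card - 1 : ℕ) : ℝ) = 2 * J.card - 1 := by
        rw [Nat.cast_sub (by omega)]
        push_cast
        rfl
      set s : ℝ := 2 * J.card / (2 * J.card - 1) with hs
      set den : ℝ := 2 * J.card - 1 + st.lev p with hden
      set stp : ℝ := 1 / (2 * J.card) with hstp
      set g := Matrix.of st.inv *ᵥ c p with hg
      set st₁ : DesignState ℝ n D := ⟨fun i => if i = p then st.weight i / s + stp else
        st.weight i / s, fun i j => s * (st.inv i j - g i * g j / den),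
        fun i => s * (st.lev i - (c i ⬝ᵥ g) * (c i ⬝ᵥ g) / den)⟩ with hst₁
      obtain ⟨hinv, hdet⟩ := h.step hc hr hp hs hden hstp (st' := st₁) (fun _ => rfl)
        (fun _ _ => rfl) (fun _ => rfl)
      obtain ⟨st', hinv', hspec, halt⟩ := ih hinv
      refine ⟨st', by rwa [Nat.add_assoc, Nat.add_comm 1] at hinv', ?_,
        halt.imp_right fun h1 => ⟨hr, ?_⟩⟩
      · refine hps.bind_eq (s' := D * (3 * D + 2) + (D * (D * 5 + 1)) + n * (3 * D + 6) + 3 * n +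
          10 + fuel * (35 * (n * D))) ?_ (by rw [Nat.succ_mul fuel]; omega)
        refine (spec_nat (2 * D)).bind_eq (s' := D * (3 * D + 2) + (D * (D * 5 + 1)) +
          n * (3 * D + 6) + 3 * n + 9 + fuel * (35 * (n * D))) ?_ (by omega)
        push_cast
        refine Spec.ite_leq (s := D * (3 * D + 2) + (D * (D * 5 + 1)) +
          n * (3 * D + 6) + 3 * n + 8 + fuel * (35 * (n * D))) (fun h => absurd h hle)
          (fun _ => ?_) (by omega)
        refine (spec_nat _).bind_eq (s' := D * (3 * D + 2) + (D * (D * 5 + 1)) +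
          n * (3 * D + 6) + 3 * n + 7 + fuel * (35 * (n * D))) ?_ (by omega)
        refine (spec_nat _).bind_eq (s' := D * (3 * D + 2) + (D * (D * 5 + 1)) +
          n * (3 * D + 6) + 3 * n + 6 + fuel * (35 * (n * D))) ?_ (by omega)
        rw [hcast, Nat.cast_mul, Nat.cast_ofNat]
        refine (spec_div _ _).bind_eq (s' := D * (3 * D + 2) + (D * (D * 5 + 1)) +
          n * (3 * D + 6) + 3 * n + 5 + fuel * (35 * (n * D))) ?_ (by omega)
        refine (spec_nat _).bind_eq (s' := D * (3 * D + 2) + (D * (D * 5 + 1)) +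
          n * (3 * D + 6) + 3 * n + 4 + fuel * (35 * (n * D))) ?_ (by omega)
        refine (spec_add _ _).bind_eq (s' := D * (3 * D + 2) + (D * (D * 5 + 1)) +
          n * (3 * D + 6) + 3 * n + 3 + fuel * (35 * (n * D))) ?_ (by omega)
        rw [hcast, ← hden, ← hs]
        refine (spec_mulVec _ _).bind_eq (s' := (D * (D * 5 + 1)) +
          n * (3 * D + 6) + 3 * n + 3 + fuel * (35 * (n * D))) ?_ (by omega)
        rw [← hg]
        refine (spec_tab₂_eq (s := 4) (v := st₁.inv) (fun i j => ?_) le_rfl :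
          Spec K _ (D * (D * 5 + 1)) _).bind_eq
          (s' := n * (3 * D + 6) + 3 * n + 3 + fuel * (35 * (n * D))) ?_ (by omega)
        · exact (spec_mul _ _).bind_eq ((spec_div _ _).bind_eq ((spec_sub _ _).bind_eq
            (spec_mul _ _) le_rfl) le_rfl) le_rfl
        refine (spec_tab_eq (s := 3 * D + 5) (v := st₁.lev) (fun i => ?_) le_rfl :
          Spec K _ (n * (3 * D + 6)) _).bind_eq
          (s' := 3 * n + 3 + fuel * (35 * (n * D))) ?_ (by omega)
        · exact (spec_dot _ _).bind_eq ((spec_mul _ _).bind_eq ((spec_div _ _).bind_eq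
            ((spec_sub _ _).bind_eq (spec_mul _ _) le_rfl) le_rfl) le_rfl) (by omega)
        refine (spec_nat 1).bind_eq (s' := 3 * n + 2 + fuel * (35 * (n * D))) ?_ (by omega)
        refine (spec_nat _).bind_eq (s' := 3 * n + 1 + fuel * (35 * (n * D))) ?_ (by omega)
        push_cast
        refine (spec_div _ _).bind_eq (s' := 3 * n + fuel * (35 * (n * D))) ?_ (by omega)
        rw [← hstp]
        refine (spec_tab_eq (s := 2) (v := st₁.weight) (fun i => ?_) le_rfl).bind_eq
          (s' := fuel * (35 * (n * D))) ?_ (by omega)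
        · refine (spec_div _ _).bind_eq (s' := 1) ?_ le_rfl
          by_cases hip : i = p
          · simp only [hip, if_true, hst₁]
            exact spec_add _ _
          · simp only [hip, if_false, hst₁]
            exact Spec.ret rfl
        exact hspec
      · refine h1.2.trans ?_
        have hmpos : 0 < st.lev p := by
          have : (0 : ℝ) ≤ D := Nat.cast_nonneg D
          linarith
        have hm : 2 * (J.card : ℝ) ≤ st.lev p := by
          have : (J.card : ℝ) ≤ D := by exact_mod_cast hrD
          linarith
        have hgap := one_add_gap_le hr h.det_pos hinv'.det_pos hm
          (h.det_le hc hinv' hr hmpos hmax)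
        rw [hdet, pow_succ', ← mul_assoc]
        refine mul_le_mul_of_nonneg_right hgap (pow_nonneg ?_ _)
        rw [sub_nonneg, div_le_one (by positivity)]
        linarith

end Design

/-! ### The designs of the program -/

section Design

variable {n D : ℕ} {K : Fin n → Fin n → ℝ}

lemma spec_designInit (st : ElimState ℝ n D) (a : Fin n) (hr : st.pivots.length ≤ D)
    (hD : 1 ≤ D) (hDn : D ≤ n) :
    Spec K (designInit st a) (16 * (n * D)) (· =
      ⟨fun i => if st.pivots = [] then if i = a then 1 else 0 else
          if i ∈ st.pivots then 1 / (st.pivots.length : ℝ) else 0,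
        fun i j => if i = j then (st.pivots.length : ℝ) else 0,
        fun i => st.pivots.length * (st.coord i ⬝ᵥ st.coord i)⟩) := by
  have hcost : 3 + D * (D * 1 + 1) + n * (3 * D + 3) + n + (n * (D + 1) + D + 1) ≤
      16 * (n * D) := by
    have h1 : D * D ≤ n * D := Nat.mul_le_mul_right _ hDn
    have h2 : n ≤ n * D := Nat.le_mul_of_pos_right _ hD
    have h3 : D ≤ n * D := hDn.trans h2
    have h4 : 1 ≤ n * D := hD.trans h3
    nlinarith
  refine (spec_nat 0).bind_eq (s' := 2 + D * (D * 1 + 1) + n * (3 * D + 3) + n +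
    (n * (D + 1) + D + 1)) ?_ (by omega)
  refine (spec_nat 1).bind_eq (s' := 1 + D * (D * 1 + 1) + n * (3 * D + 3) + n +
    (n * (D + 1) + D + 1)) ?_ (by omega)
  refine (spec_nat _).bind_eq (s' := D * (D * 1 + 1) + n * (3 * D + 3) + n +
    (n * (D + 1) + D + 1)) ?_ (by omega)
  push_cast
  refine (spec_tab₂_eq (s := 0) (v := fun i j => if i = j then (st.pivots.length : ℝ) else 0)
    (fun i j => ?_) le_rfl).bind_eq (s' := n * (3 * D + 3) + n + (n * (D + 1) + D + 1)) ?_ (by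
      show D * (D * 1 + 1) + _ ≤ _
      omega)
  · exact Spec.ret rfl
  refine (spec_tab_eq (s := 3 * D + 2) (v := fun i => st.pivots.length *
    (st.coord i ⬝ᵥ st.coord i)) (fun i => (spec_dot _ _).bind_eq (spec_mul _ _) le_rfl)
    le_rfl).bind_eq (s' := n + (n * (D + 1) + D + 1)) ?_ (by
      show n * (3 * D + 3) + _ ≤ _
      omega)
  refine (spec_tab_eq (s := 0) (v := fun _ => (0 : ℝ)) (fun i => Spec.ret rfl) le_rfl).bind_eq
    (s' := n * (D + 1) + D + 1) ?_ (by omega)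
  obtain ⟨res, coord, pivots⟩ := st
  match pivots with
  | [] =>
    refine (spec_tab_eq (s := 0) (v := fun i => if i = a then (1 : ℝ) else 0)
      (fun i => Spec.ret rfl) le_rfl).bind_eq (s' := 0) (Spec.ret ?_) (by ring_nf; omega)
    simp
  | q :: ps =>
    simp only [List.length_cons] at hr
    refine (spec_div _ _).bind_eq (s' := n * (D + 1) + D) ?_ (by omega)
    have hmul : (q :: ps).length * (n * 1 + 1) ≤ n * (D + 1) + D := by
      have := Nat.mul_le_mul_right (n * 1 + 1) hr
      rw [List.length_cons]
      nlinarith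
    refine (spec_loop (c := n * 1) (fun pre w => w = fun i => if i ∈ pre then
      1 / ((q :: ps).length : ℝ) else 0) (by simp) (fun pre p post _ w hw => ?_) hmul).bind_eq
      (s' := 0) (Spec.ret ?_) (by omega)
    · refine spec_tab_eq (fun i => Spec.ret ?_) le_rfl
      rw [hw]
      by_cases hip : i = p <;> simp [hip]
    · simp

variable {φ : Fin n → Fin D → ℝ} {S : List (Fin n)} {st : ElimState ℝ n D} {J : Finset (Fin D)}
  {pv : Fin D → Fin n} {L A B : (Fin D → ℝ) →ₗ[ℝ] (Fin D → ℝ)}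

lemma ElimInv.eq_sum (h : ElimInv φ S (List.finRange D) st J pv L A B) {i : Fin n}
    (hi : i ∈ S) : φ i = ∑ j ∈ J, st.coord i j • φ (pv j) := by
  have h0 : st.res i = 0 := by
    funext j
    exact h.res_zero i hi j (List.mem_finRange j)
  have := h.rep i
  rwa [h0, zero_add] at this

/-- Solutions of the normal equations in coordinates correspond to solutions of the normal
equations for the feature vectors. -/
lemma ElimInv.exists_gram_mulVec_eq (h : ElimInv φ S (List.finRange D) st J pv L A B)
    {u : Fin n → ℝ} (hu : ∀ i, i ∉ S → u i = 0) {i : Fin n} (hi : i ∈ S) {v : Fin D → ℝ}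
    (hv : gram st.coord u *ᵥ v = st.coord i) :
    ∃ w, gram φ u *ᵥ w = φ i ∧ ∀ j, φ j ⬝ᵥ w = st.coord j ⬝ᵥ v := by
  have hdot : ∀ x : Fin D → ℝ, x ⬝ᵥ ((LinearMap.toMatrix' A).transpose *ᵥ v) = A x ⬝ᵥ v := by
    intro x
    rw [Matrix.mulVec_transpose, _root_.dotProduct_comm, ← Matrix.dotProduct_mulVec,
      _root_.dotProduct_comm, LinearMap.toMatrix'_mulVec]
  refine ⟨(LinearMap.toMatrix' A).transpose *ᵥ v, ?_, fun j => ?_⟩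
  · rw [gram_mulVec, h.eq_sum hi, ← hv, gram_mulVec]
    have h1 : ∀ j, (u j * (φ j ⬝ᵥ ((LinearMap.toMatrix' A).transpose *ᵥ v))) • φ j =
        ∑ k ∈ J, (u j * (st.coord j ⬝ᵥ v) * st.coord j k) • φ (pv k) := by
      intro j
      rw [hdot, ← h.coord_eq]
      by_cases hj : j ∈ S
      · nth_rewrite 1 [h.eq_sum hj]
        rw [Finset.smul_sum]
        simp only [smul_smul]
      · simp [hu j hj]
    rw [Finset.sum_congr rfl fun j _ => h1 j, Finset.sum_comm]
    refine Finset.sum_congr rfl fun k _ => ?_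
    rw [← Finset.sum_smul, Finset.sum_apply]
    rfl
  · rw [hdot, h.coord_eq]

/-- In the coordinates with respect to the pivots, no design has a determinant greater than `1`:
the multipliers of the elimination bound the active arms, and the change from coordinates to
multipliers is unitriangular. -/
lemma ElimInv.det_le_one (h : ElimInv φ S (List.finRange D) st J pv L A B) {w : Fin n → ℝ}
    (hw : ∀ i, 0 ≤ w i) (hS : ∀ i, i ∉ S → w i = 0) (h1 : ∑ i, w i = 1) (hJ : 1 ≤ J.card) :
    (wgram (restr st.coord J) w).det ≤ 1 := by
  set U : Matrix J J ℝ := Matrix.of fun k j => B (φ (pv j)) k with hU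
  have hdet : U.det = 1 := by
    rw [Matrix.det_of_isUpperTriangular]
    · exact Finset.prod_eq_one fun j _ => h.diag j j.2
    · intro k j hjk
      exact h.tri j j.2 k k.2 hjk
  have hUc : ∀ i ∈ S, U *ᵥ restr st.coord J i = fun k : J => B (φ i) k := by
    intro i hi
    funext k
    rw [h.eq_sum hi, map_sum, Finset.sum_apply]
    simp only [Matrix.mulVec, dotProduct, hU, Matrix.of_apply, map_smul, Pi.smul_apply,
      smul_eq_mul, restr]
    rw [Finset.sum_coe_sort J fun j => B (φ (pv j)) k * st.coord i j]
    exact Finset.sum_congr rfl fun j _ => mul_comm _ _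
  have hdet2 : (U.conjTranspose * U).det = 1 := by
    rw [Matrix.det_mul, Matrix.det_conjTranspose, hdet]
    simp
  have hpd : (U.conjTranspose * U).PosDef :=
    (Matrix.posSemidef_conjTranspose_mul_self U).posDef_iff_det_ne_zero.2 (by rw [hdet2]; simp)
  have hJ' : (0 : ℝ) < J.card := by exact_mod_cast hJ
  have key := det_wgram_le hpd.inv (restr st.coord J) hw h1 hJ' (by simpa using hJ) fun i hi => by
    have hiS : i ∈ S := by
      by_contra hn
      exact hi (hS i hn)
    rw [Matrix.nonsing_inv_nonsing_inv _ (by rw [hdet2]; exact isUnit_one),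
      ← Matrix.mulVec_mulVec, Matrix.conjTranspose_eq_transpose_of_trivial,
      Matrix.dotProduct_mulVec, ← Matrix.mulVec_transpose, Matrix.transpose_transpose, hUc i hiS]
    calc ∑ k : J, B (φ i) k * B (φ i) k ≤ ∑ _k : J, (1 : ℝ) := by
          refine Finset.sum_le_sum fun k _ => ?_
          rw [← sq]
          exact (sq_le_one_iff_abs_le_one _).2 (h.abs_le i hiS k k.2)
      _ = J.card := by simp
  rw [Matrix.det_nonsing_inv, hdet2] at key
  simpa [hJ'.ne'] using key

/-- The iteration starts from the uniform distribution on the pivots. -/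
lemma ElimInv.designInv (h : ElimInv φ S (List.finRange D) st J pv L A B) {a : Fin n}
    (ha : a ∈ S) (hD : 1 ≤ D) {d : DesignState ℝ n D}
    (hw : ∀ i, d.weight i = if st.pivots = [] then if i = a then 1 else 0 else
          if i ∈ st.pivots then 1 / (st.pivots.length : ℝ) else 0)
    (hH : ∀ i j, d.inv i j = if i = j then (st.pivots.length : ℝ) else 0)
    (hlev : ∀ i, d.lev i = st.pivots.length * (st.coord i ⬝ᵥ st.coord i)) :
    DesignInv st.coord S J D d ∧
      (1 ≤ J.card → (wgram (restr st.coord J) d.weight).det = (1 / (J.card : ℝ)) ^ J.card) := by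
  have hrD : J.card ≤ D := by simpa using Finset.card_le_univ J
  have hHv : ∀ v, Matrix.of d.inv *ᵥ v = (J.card : ℝ) • v := by
    intro v
    funext i
    simp [Matrix.mulVec, dotProduct, hH, h.length_pivots]
  have hlev' : ∀ i, d.lev i = st.coord i ⬝ᵥ Matrix.of d.inv *ᵥ st.coord i := by
    intro i
    rw [hHv, dotProduct_smul, hlev, h.length_pivots, smul_eq_mul]
  have hsymm : ∀ i j, d.inv i j = d.inv j i := by
    intro i j
    simp only [hH, eq_comm (a := i)]
  by_cases hJ : J = ∅
  · have hnil : st.pivots = [] := by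
      rw [← List.length_eq_zero_iff, h.length_pivots, hJ, Finset.card_empty]
    have hw' : ∀ i, d.weight i = if i = a then 1 else 0 := by
      intro i
      rw [hw, if_pos hnil]
    have hc : ∀ i, st.coord i = 0 := by
      intro i
      funext j
      exact h.coord_zero i j (by simp [hJ])
    refine ⟨⟨fun i => ?_, fun i hi => ?_, ?_, ⟨hsymm, fun i _ => ?_⟩, hlev', ?_, ?_⟩, ?_⟩
    · rw [hw']
      split_ifs <;> simp
    · rw [hw', if_neg]
      rintro rfl
      exact hi ha
    · simp [hw']
    · rw [hc]
      simp
    · refine le_trans (Finset.card_le_card (t := {a}) fun i hi => ?_) (by simpa using hD)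
      rw [Finset.mem_filter, hw'] at hi
      by_contra hia
      exact hi.2 (if_neg (by simpa using hia))
    · subst hJ
      rw [Matrix.det_isEmpty]
      exact one_pos
    · intro hcard
      simp [hJ] at hcard
  · have hJ1 : 1 ≤ J.card := Finset.card_pos.2 (Finset.nonempty_iff_ne_empty.2 hJ)
    have hJ0 : (0 : ℝ) < J.card := by exact_mod_cast hJ1
    have hnil : st.pivots ≠ [] := by
      rw [← List.length_pos_iff, h.length_pivots]
      exact hJ1
    set q : ℝ := 1 / (J.card : ℝ) with hq
    have hq0 : 0 < q := by rw [hq]; positivity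
    have hinj : Set.InjOn pv J := by
      intro j hj k hk hjk
      have := h.coord_pv j hj
      rw [hjk, h.coord_pv k hk] at this
      by_contra hne
      have h1 := congrFun this k
      rw [Pi.single_eq_same, Pi.single_eq_of_ne (Ne.symm hne)] at h1
      exact one_ne_zero h1
    have hw' : ∀ i, d.weight i = if i ∈ J.image pv then q else 0 := by
      intro i
      have : i ∈ st.pivots ↔ i ∈ J.image pv := by rw [h.mem_pivots, Finset.mem_image]
      rw [hw, if_neg hnil, h.length_pivots]
      simp only [this, hq]
    have hsum : ∀ {M : Type} [AddCommGroup M] [Module ℝ M] (F : Fin n → M),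
        ∑ i, d.weight i • F i = ∑ j ∈ J, q • F (pv j) := by
      intro M _ _ F
      simp only [hw', ite_smul, zero_smul]
      rw [← Finset.sum_filter, Finset.filter_mem_eq_inter, Finset.univ_inter,
        Finset.sum_image hinj]
    have hgram : ∀ v : Fin D → ℝ, (∀ j ∉ J, v j = 0) → gram st.coord d.weight *ᵥ v = q • v := by
      intro v hv
      rw [gram_mulVec]
      simp only [mul_smul]
      rw [hsum fun i => (st.coord i ⬝ᵥ v) • st.coord i]
      funext k
      rw [Finset.sum_apply]
      have : ∀ j ∈ J, (q • (st.coord (pv j) ⬝ᵥ v) • st.coord (pv j)) k =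
          if k = j then q * v j else 0 := by
        intro j hj
        rw [h.coord_pv j hj, single_dotProduct]
        simp [Pi.single_apply]
      rw [Finset.sum_congr rfl this, Finset.sum_ite_eq]
      split_ifs with hk
      · rfl
      · simp [hv k hk]
    have hwg : wgram (restr st.coord J) d.weight = q • (1 : Matrix J J ℝ) := by
      unfold wgram
      rw [hsum fun i => Matrix.vecMulVec (restr st.coord J i) (restr st.coord J i)]
      ext k m
      rw [Matrix.sum_apply]
      have : ∀ j ∈ J, (q • Matrix.vecMulVec (restr st.coord J (pv j))
          (restr st.coord J (pv j))) k m =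
            if (k : Fin D) = j then (if k = m then q else 0) else 0 := by
        intro j hj
        simp only [Matrix.smul_apply, Matrix.vecMulVec_apply, restr, h.coord_pv j hj,
          Pi.single_apply, smul_eq_mul]
        by_cases hkj : (k : Fin D) = j
        · subst hkj
          by_cases hkm : k = m
          · simp [hkm]
          · have : (m : Fin D) ≠ k := fun h => hkm (Subtype.ext h.symm)
            simp [hkm, this]
        · simp [hkj]
      rw [Finset.sum_congr rfl this, Finset.sum_ite_eq, if_pos k.2]
      simp [Matrix.one_apply]
    have hdet : (wgram (restr st.coord J) d.weight).det = q ^ J.card := by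
      rw [hwg, Matrix.det_smul, Matrix.det_one, mul_one, Fintype.card_coe]
    refine ⟨⟨fun i => ?_, fun i hi => ?_, ?_, ⟨hsymm, fun i _ => ?_⟩, hlev', ?_, ?_⟩, fun _ => hdet⟩
    · rw [hw']
      split_ifs
      · exact hq0.le
      · exact le_rfl
    · rw [hw', if_neg]
      rw [Finset.mem_image]
      rintro ⟨j, hj, rfl⟩
      exact hi (h.pv_mem j hj)
    · have := hsum fun _ => (1 : ℝ)
      simp only [smul_eq_mul, mul_one, Finset.sum_const, nsmul_eq_mul] at this
      rw [this, hq, mul_one_div_cancel hJ0.ne']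
    · rw [hHv, Matrix.mulVec_smul, hgram _ (h.coord_zero i), smul_smul, hq,
        mul_one_div_cancel hJ0.ne', one_smul]
    · refine le_trans (Finset.card_le_card (t := J.image pv) fun i hi => ?_)
        (Finset.card_image_le.trans hrD)
      rw [Finset.mem_filter, hw'] at hi
      by_contra hia
      exact hi.2 (if_neg hia)
    · rw [hdet]
      exact pow_pos hq0 _

/-- The program finds a near-optimal design, together with coordinates in which the matrix of the
normal equations has an inverse. -/
lemma exists_design (φ : Fin n → Fin D → ℝ) (hD : 1 ≤ D) (hDn : D ≤ n) (a : Fin n)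
    {l : List (Fin n)} (hl : l.length ≤ n) :
    ∃ el d₀ d, Spec K (coordinates φ a l) (21 * (n * D ^ 2)) (· = el) ∧
      Spec K (designInit el a) (16 * (n * D)) (· = d₀) ∧
      Spec K (designLoop el.coord el.pivots.length a l
        (15 * D * (1 + Nat.log 2 (Nat.log 2 D + 1))) d₀)
        (15 * D * (1 + Nat.log 2 (Nat.log 2 D + 1)) * (35 * (n * D))) (· = d) ∧
      IsDesign φ (a :: l).toFinset d.weight ∧
      IsInv el.coord (a :: l) d.weight d.inv ∧
      ∀ u : Fin n → ℝ, (∀ i, i ∉ a :: l → u i = 0) → ∀ i ∈ a :: l, ∀ v,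
        gram el.coord u *ᵥ v = el.coord i →
          ∃ w, gram φ u *ᵥ w = φ i ∧ ∀ j, φ j ⬝ᵥ w = el.coord j ⬝ᵥ v := by
  obtain ⟨el, hel, J, pv, L, A, B, h⟩ :=
    (spec_coordinates (K := K) φ a hl hD (hD.trans hDn)).exists_eq
  have hrD : J.card ≤ D := by simpa using Finset.card_le_univ J
  obtain ⟨hinv, hdet⟩ := h.designInv (a := a) (by simp) hD (d := ⟨_, _, _⟩) (fun _ => rfl)
    (fun _ _ => rfl) (fun _ => rfl)
  obtain ⟨d, hd, hspec, hlev⟩ := spec_designLoop (K := K) h.coord_zero hl hDn hD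
    (15 * D * (1 + Nat.log 2 (Nat.log 2 D + 1))) hinv
  rw [← h.length_pivots] at hspec
  refine ⟨el, _, d, hel, spec_designInit el a (h.length_pivots.trans_le hrD) hD hDn, hspec, ?_,
    hd.isInv, fun u hu i hi v hv => h.exists_gram_mulVec_eq hu hi hv⟩
  -- the iteration has not used up its steps
  have hlev' : ∀ i ∈ a :: l, d.lev i ≤ 2 * D := by
    refine hlev.resolve_right ?_
    rintro ⟨hJ, h1⟩
    rw [hdet hJ] at h1
    have hJ0 : (1 : ℝ) ≤ J.card := by exact_mod_cast hJ
    have h2 := Real.log_nonpos hd.det_pos.le (h.det_le_one hd.nonneg hd.supp hd.sum_eq hJ)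
    have h3 := one_add_log_mul_pow_lt_one hJ hrD
    refine absurd (h1.trans ?_) (not_le.2 h3)
    refine mul_le_mul_of_nonneg_right ?_ (pow_nonneg ?_ _)
    · rw [Real.log_pow, one_div, Real.log_inv, add_le_add_iff_left, div_le_iff₀ (by linarith)]
      linarith
    · rw [sub_nonneg, div_le_one (by positivity)]
      linarith
  refine ⟨hd.nonneg, fun i hi => hd.supp i (by simpa using hi), hd.sum_eq, ?_, fun i hi => ?_⟩
  · refine hd.card_le.trans ?_
    unfold firstPhase
    generalize Nat.log 2 (Nat.log 2 D + 1) = k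
    nlinarith [Nat.zero_le (D * k)]
  · rw [List.mem_toFinset] at hi
    obtain ⟨w, hw, hdot⟩ := h.exists_gram_mulVec_eq hd.supp hi (hd.isInv.inv i hi)
    refine ⟨w, hw, ?_⟩
    rw [hdot, ← hd.lev_eq]
    exact hlev' i hi

end Design

/-! ### The phases of the program -/

section Runs

variable {n : ℕ} {α β σ : Type} {K : Fin n → Fin n → ℝ} {y : ℕ → Fin n → ℝ}

/-- Executed from round `t` on, the program `p` takes at most `s` steps, returns `v` and pulls the
arms `l`. -/
def Runs (K : Fin n → Fin n → ℝ) (y : ℕ → Fin n → ℝ) (p : Prog ℝ n α) (t s : ℕ) (v : α)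
    (l : List (Fin n)) : Prop :=
  ∃ k ≤ s, p.exec K y t = ⟨v, k, l⟩

lemma Runs.ret {t s : ℕ} {v : α} : Runs K y (pure v) t s v [] :=
  ⟨0, Nat.zero_le _, rfl⟩

lemma Runs.bind {p : Prog ℝ n α} {f : α → Prog ℝ n β} {t s s' b : ℕ} {v : α} {w : β}
    {l l' : List (Fin n)} (h : Runs K y p t s v l) (h' : Runs K y (f v) (t + l.length) s' w l')
    (hb : s + s' ≤ b) : Runs K y (p >>= f) t b w (l ++ l') := by
  obtain ⟨k, hk, he⟩ := h
  obtain ⟨k', hk', he'⟩ := h'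
  refine ⟨k + k', (Nat.add_le_add hk hk').trans hb, ?_⟩
  rw [exec_bind, he]
  simp [he']

lemma Runs.tick {p : Prog ℝ n α} {t s b : ℕ} {v : α} {l : List (Fin n)} (h : Runs K y p t s v l)
    (hb : s + 1 ≤ b) : Runs K y (.tick p) t b v l := by
  obtain ⟨k, hk, he⟩ := h
  exact ⟨k + 1, by omega, by simp [Prog.exec, he, Outcome.charge]⟩

lemma runs_pullArm (i : Fin n) (t : ℕ) : Runs K y (pullArm i) t 1 (y t i) [i] :=
  ⟨1, le_rfl, rfl⟩

lemma Spec.runs {p : Prog ℝ n α} {s : ℕ} {v : α} (h : Spec K p s (· = v)) (t : ℕ) :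
    Runs K y p t s v [] := by
  obtain ⟨w, hw, rfl⟩ := h
  exact hw y t

lemma Spec.runs_bind {p : Prog ℝ n α} {f : α → Prog ℝ n β} {t s s' b : ℕ} {v : α} {w : β}
    {l : List (Fin n)} (h : Spec K p s (· = v)) (h' : Runs K y (f v) t s' w l)
    (hb : s + s' ≤ b) : Runs K y (p >>= f) t b w l :=
  (h.runs t).bind (l := []) h' hb

end Runs

section Phase

variable {n D : ℕ} {K : Fin n → Fin n → ℝ}

/-- The pulls of a phase, and the right-hand side of the normal equations. -/
lemma runs_pulls (y : ℕ → Fin n → ℝ) (c : Fin n → Fin D → ℝ) (new : List (Fin n))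
    (b : Fin D → ℝ) (t : ℕ) :
    Runs K y (loop new b fun b i => do
      let y ← pullArm i
      tab D fun j => do add (b j) (← mul y (c i j))) t (new.length * (3 * D + 2))
      (b + ∑ s : Fin new.length, y (t + s) (new.get s) • c (new.get s)) new := by
  induction new generalizing b t with
  | nil =>
    simp only [List.length_nil, Finset.univ_eq_empty, Finset.sum_empty, add_zero]
    exact Runs.ret
  | cons i new ih =>
    have h1 : Runs K y (do
        let y ← pullArm i
        tab D fun j => do add (b j) (← mul y (c i j))) t (3 * D + 1) (b + y t i • c i) [i] :=
      (runs_pullArm i t).bind (l' := []) (s' := 3 * D) (Spec.runs (spec_tab_eq (s := 2)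
        (fun j => (spec_mul _ _).bind_eq (spec_add _ _) le_rfl) (by omega)) _) (by omega)
    have h2 := (ih (b + y t i • c i) (t + 1)).tick (b := new.length * (3 * D + 2) + 1) le_rfl
    have hval : b + ∑ s : Fin (i :: new).length, y (t + s) ((i :: new).get s) •
        c ((i :: new).get s) = b + y t i • c i +
          ∑ s : Fin new.length, y (t + 1 + s) (new.get s) • c (new.get s) := by
      simp only [List.length_cons, Fin.sum_univ_succ, Fin.val_zero, add_zero, List.get_eq_getElem,
        Fin.val_succ, List.getElem_cons_zero, List.getElem_cons_succ, add_assoc]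
      simp only [add_comm]
    rw [hval]
    refine h1.bind (l' := new) (s' := new.length * (3 * D + 2) + 1) h2 ?_
    rw [List.length_cons, Nat.succ_mul new.length]
    omega

lemma spec_rankOne (H : Fin D → Fin D → ℝ) (w : ℝ) (v : Fin D → ℝ) (hD : 1 ≤ D) :
    Spec K (rankOne H w v) (18 * D ^ 2) (· = fun i j =>
      H i j - w / (1 + w * (v ⬝ᵥ Matrix.of H *ᵥ v)) *
        ((Matrix.of H *ᵥ v) i * (Matrix.of H *ᵥ v) j)) := by
  refine (spec_mulVec _ _).bind_eq (s' := 3 * D + 5 + D * (D * 4 + 1)) ?_ (by nlinarith)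
  refine (spec_nat 1).bind_eq (s' := 3 * D + 4 + D * (D * 4 + 1)) ?_ (by omega)
  refine (spec_dot _ _).bind_eq (s' := 3 + D * (D * 4 + 1)) ?_ (by omega)
  refine (spec_mul _ _).bind_eq (s' := 2 + D * (D * 4 + 1)) ?_ (by omega)
  refine (spec_add _ _).bind_eq (s' := 1 + D * (D * 4 + 1)) ?_ (by omega)
  refine (spec_div _ _).bind_eq (s' := D * (D * 4 + 1)) ?_ (by omega)
  rw [Nat.cast_one]
  exact spec_tab₂_eq (s := 3) (fun i j => (spec_mul _ _).bind_eq ((spec_mul _ _).bind_eq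
    (spec_sub _ _) le_rfl) le_rfl) le_rfl

variable {c : Fin n → Fin D → ℝ} {S : List (Fin n)} {w : Fin n → ℝ} {H : Fin D → Fin D → ℝ}

lemma IsInv.div (h : IsInv c S w H) {m : ℝ} (hm : m ≠ 0) :
    IsInv c S (fun i => m * w i) fun i j => H i j / m := by
  refine ⟨fun i j => by rw [h.symm], fun i hi => ?_⟩
  have h1 : (Matrix.of fun i j => H i j / m) *ᵥ c i = m⁻¹ • (Matrix.of H *ᵥ c i) := by
    funext k
    simp only [Matrix.mulVec, dotProduct, Matrix.of_apply, Pi.smul_apply, smul_eq_mul,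
      Finset.mul_sum]
    refine Finset.sum_congr rfl fun j _ => ?_
    ring
  have h2 : gram c (fun i => m * w i) = m • gram c w := by
    unfold gram
    rw [Finset.smul_sum]
    simp only [mul_smul]
  rw [h1, h2, Matrix.mulVec_smul, Matrix.smul_mulVec, h.inv i hi, smul_smul,
    inv_mul_cancel₀ hm, one_smul]

/-- Rank-one updates turn the inverse for the weights `w` into the one for the pull counts `u`. -/
lemma spec_updates (h : IsInv c S w H) (hS : S.Nodup) (hw : ∀ i, 0 ≤ w i) {u : Fin n → ℕ}
    (hu : ∀ i, w i ≤ u i) (hu0 : ∀ i, i ∉ S → w i = u i) (hD : 1 ≤ D) :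
    ∃ H', Spec K (loop S H fun H i => do rankOne H (← sub (← nat (u i)) (w i)) (c i))
      (n * (18 * D ^ 2 + 3)) (· = H') ∧ IsInv c S (fun i => (u i : ℝ)) H' := by
  have hlen : S.length ≤ n := by simpa using hS.length_le_card
  refine Spec.exists_eq ((spec_loop (c := 18 * D ^ 2 + 2)
    (fun pre H => IsInv c S (fun i => if i ∈ pre then (u i : ℝ) else w i) H) (by simpa using h)
    (fun pre p post hpre H hH => ?_) (Nat.mul_le_mul_right _ hlen)).mono le_rfl fun H' hH' => ?_)
  · have hpS : p ∈ S := by simp [hpre]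
    have hppre : p ∉ pre := by
      rw [hpre, List.nodup_append] at hS
      intro hp
      exact hS.2.2 p hp p (by simp) rfl
    refine (spec_nat _).bind_eq (s' := 18 * D ^ 2 + 1) ?_ (by omega)
    refine (spec_sub _ _).bind_eq (s' := 18 * D ^ 2) ?_ (by omega)
    refine (spec_rankOne _ _ _ hD).mono le_rfl ?_
    rintro _ rfl
    have hb : 0 ≤ (u p : ℝ) - w p := sub_nonneg.2 (hu p)
    have hlev := hH.nonneg (fun i => by
      split_ifs
      · exact Nat.cast_nonneg _
      · exact hw i) hpS
    have hden : 1 + ((u p : ℝ) - w p) * (c p ⬝ᵥ Matrix.of H *ᵥ c p) ≠ 0 := by positivity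
    refine hH.update hpS (a := 1) (b := u p - w p) (s := 1) (one_mul 1)
      (div_mul_cancel₀ _ hden) (fun i => ?_) fun i j => ?_
    · by_cases hip : i = p
      · subst hip
        simp [hppre]
      · simp [hip]
    · rw [one_mul]
  · convert hH' using 2 with i
    split_ifs with hi
    · rfl
    · exact (hu0 i hi).symm

end Phase

section Phase

variable {n D : ℕ} {K : Fin n → Fin n → ℝ}

/-- What the program computes at the beginning of a phase with active arms `a :: l`, when it uses
the design `r`. -/
def HasDesign (K : Fin n → Fin n → ℝ) (φ : Fin n → Fin D → ℝ) (a : Fin n) (l : List (Fin n))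
    (r : Fin n → ℝ) : Prop :=
  ∃ el d₀ d, Spec K (coordinates φ a l) (21 * (n * D ^ 2)) (· = el) ∧
      Spec K (designInit el a) (16 * (n * D)) (· = d₀) ∧
      Spec K (designLoop el.coord el.pivots.length a l
        (15 * D * (1 + Nat.log 2 (Nat.log 2 D + 1))) d₀)
        (15 * D * (1 + Nat.log 2 (Nat.log 2 D + 1)) * (35 * (n * D))) (· = d) ∧
      d.weight = r ∧
      IsInv el.coord (a :: l) d.weight d.inv ∧
      ∀ u : Fin n → ℝ, (∀ i, i ∉ a :: l → u i = 0) → ∀ i ∈ a :: l, ∀ v,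
        gram el.coord u *ᵥ v = el.coord i →
          ∃ w, gram φ u *ᵥ w = φ i ∧ ∀ j, φ j ⬝ᵥ w = el.coord j ⬝ᵥ v

/-- The design rule of the program. -/
lemma exists_designRule (K : Fin n → Fin n → ℝ) (φ : Fin n → Fin D → ℝ) (hD : 1 ≤ D)
    (hDn : D ≤ n) :
    ∃ ρ, IsDesignRule φ ρ ∧ ∀ (S : Finset (Fin n)) (a : Fin n) (l : List (Fin n)),
      (List.finRange n).filter (· ∈ S) = a :: l → HasDesign K φ a l (ρ S) := by
  have h : ∀ S : Finset (Fin n), ∃ r, (S.Nonempty → IsDesign φ S r) ∧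
      ∀ (a : Fin n) (l : List (Fin n)), (List.finRange n).filter (· ∈ S) = a :: l →
        HasDesign K φ a l r := by
    intro S
    have hS : ((List.finRange n).filter (· ∈ S)).toFinset = S := by
      ext i
      simp
    rcases hfil : (List.finRange n).filter (· ∈ S) with _ | ⟨a, l⟩
    · rw [hfil, List.toFinset_nil] at hS
      exact ⟨0, fun hne => absurd hS.symm hne.ne_empty, by simp⟩
    · have hlen : l.length ≤ n := by
        have h1 := List.length_filter_le (· ∈ S) (List.finRange n)
        rw [hfil, List.length_finRange, List.length_cons] at h1
        omega
      obtain ⟨el, d₀, d, h1, h2, h3, h4, h5, h6⟩ := exists_design (K := K) φ hD hDn a hlen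
      rw [hfil] at hS
      rw [hS] at h4
      refine ⟨d.weight, fun _ => h4, fun a' l' heq => ?_⟩
      obtain ⟨rfl, rfl⟩ := List.cons.inj heq
      exact ⟨el, d₀, d, h1, h2, h3, rfl, h5, h6⟩
  choose ρ h1 h2 using h
  exact ⟨ρ, h1, h2⟩

/-- The bound on the number of steps in one phase. -/
def phaseCost (n D T : ℕ) : ℕ :=
  700 * (1 + Nat.log 2 (Nat.log 2 D + 1)) * (n * D ^ 2) + 13 * (T * D)

lemma le_phaseCost {n D T m : ℕ} (hD : 1 ≤ D) (hDn : D ≤ n) (hm : m ≤ 2 * T) :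
    21 * (n * D ^ 2) + 16 * (n * D) +
        15 * D * (1 + Nat.log 2 (Nat.log 2 D + 1)) * (35 * (n * D)) + 1 + n * 2 +
        (4 * m + 3 * n) + D * (D * 2 + 1) + n * (18 * D ^ 2 + 3) + D * 2 + T * (3 * D + 2) +
        D * (3 * D + 2) + n * (3 * D + 2) + 2 * n + 7 + n * 3 ≤ phaseCost n D T := by
  have a1 : n * D ≤ n * D ^ 2 := Nat.mul_le_mul_left _ (by nlinarith)
  have a2 : n ≤ n * D := Nat.le_mul_of_pos_right _ hD
  have a3 : D * D ≤ n * D := Nat.mul_le_mul_right _ hDn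
  have a4 : T ≤ T * D := Nat.le_mul_of_pos_right _ hD
  unfold phaseCost
  generalize Nat.log 2 (Nat.log 2 D + 1) = k
  have b1 : 15 * D * (1 + k) * (35 * (n * D)) = 525 * (n * D ^ 2) + 525 * (n * D ^ 2 * k) := by
    ring
  have b2 : 700 * (1 + k) * (n * D ^ 2) = 700 * (n * D ^ 2) + 700 * (n * D ^ 2 * k) := by ring
  have b3 : D * (D * 2 + 1) = 2 * (D * D) + D := by ring
  have b4 : n * (18 * D ^ 2 + 3) = 18 * (n * D ^ 2) + 3 * n := by ring
  have b5 : T * (3 * D + 2) = 3 * (T * D) + 2 * T := by ring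
  have b6 : D * (3 * D + 2) = 3 * (D * D) + 2 * D := by ring
  have b7 : n * (3 * D + 2) = 3 * (n * D) + 2 * n := by ring
  rw [b1, b2, b3, b4, b5, b6, b7]
  omega

lemma phases_prefix (φ : Fin n → Fin D → ℝ) (ρ : Finset (Fin n) → Fin n → ℝ) (T : ℕ) (R δ : ℝ)
    (y : ℕ → Fin n → ℝ) {l m : ℕ} (hlm : l ≤ m) :
    (phases φ ρ T R δ y l).2 <+: (phases φ ρ T R δ y m).2 := by
  induction m, hlm using Nat.le_induction with
  | base => exact List.prefix_rfl
  | succ m _ ih =>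
    rw [phases_succ]
    exact ih.trans (List.prefix_append _ _)

lemma le_length_phases [NeZero n] {φ : Fin n → Fin D → ℝ} {ρ : Finset (Fin n) → Fin n → ℝ}
    (hρ : IsDesignRule φ ρ) (hD : 1 ≤ D) (T : ℕ) {R : ℝ} (hR : 0 ≤ R) (δ : ℝ)
    (y : ℕ → Fin n → ℝ) (l : ℕ) : l ≤ (phases φ ρ T R δ y l).2.length := by
  induction l with
  | zero => exact Nat.zero_le _
  | succ l ih =>
    rw [phases_succ, List.length_append]
    have h1 := phaseLength_le_length (D := D) l (hρ _ (phases_nonempty φ ρ δ hR (T := T) y l)).2.2.1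
    have h2 := phaseLength_pos hD l
    omega

/-- The score that the program computes for an active arm is the prediction of the least-squares
estimate. -/
lemma dotProduct_mulVec_eq_leastSquares {φ c : Fin n → Fin D → ℝ} {S : List (Fin n)}
    {u : Fin n → ℕ} {H : Fin D → Fin D → ℝ} (h : IsInv c S (fun i => (u i : ℝ)) H)
    (hpull : ∀ i ∈ S, ∀ v, gram c (fun i => (u i : ℝ)) *ᵥ v = c i →
      ∃ w, gram φ (fun i => (u i : ℝ)) *ᵥ w = φ i ∧ ∀ j, φ j ⬝ᵥ w = c j ⬝ᵥ v)
    {i : Fin n} (hi : i ∈ S) (r : Fin (pullList u).length → ℝ) :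
    c i ⬝ᵥ Matrix.of H *ᵥ (∑ s, r s • c ((pullList u).get s)) =
      leastSquares φ (pullList u) r ⬝ᵥ φ i := by
  obtain ⟨w, hw, hdot⟩ := hpull i hi _ (h.inv i hi)
  rw [leastSquares_dotProduct φ u r hw, h.dotProduct_comm, sum_dotProduct]
  refine Finset.sum_congr rfl fun s _ => ?_
  rw [smul_dotProduct, smul_eq_mul, hdot]

open Classical in
lemma spec_eliminate (score : Fin n → ℝ) (thr : ℝ) (best : Fin n) (S : List (Fin n)) :
    Spec K (loop S [] fun S' i => do
      if ← leq (← sub (score best) (score i)) thr then pure (S' ++ [i]) else pure S')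
      (S.length * 3) (· = S.filter fun i => score best - score i ≤ thr) := by
  refine spec_loop (c := 2) (fun pre S' => S' = pre.filter fun i => score best - score i ≤ thr)
    (by simp) (fun pre i post _ S' hS' => ?_) le_rfl
  refine (spec_sub _ _).bind_eq (s' := 1) ?_ le_rfl
  refine Spec.ite_leq (s := 0) (fun h => Spec.ret ?_) (fun h => Spec.ret ?_) le_rfl
  · rw [hS', List.filter_append, List.filter_cons_of_pos (by simpa using h), List.filter_nil]
  · rw [hS', List.filter_append, List.filter_cons_of_neg
      (by rw [decide_eq_true_eq]; exact not_le.2 h), List.filter_nil, List.append_nil]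

lemma spec_pullCounts {φ : Fin n → Fin D → ℝ} {S : Finset (Fin n)} {r : Fin n → ℝ}
    (h : IsDesign φ S r) (ph : ℕ) :
    Spec K (tab n fun i => ceil ((phaseLength D ph : ℝ) * r i) (phaseLength D ph) 0)
      (4 * phaseLength D ph + 3 * n) (· = pullCount D ph r) := by
  have hsum := length_le_two_mul_phaseLength ph h
  rw [length_pullList] at hsum
  refine (spec_tab_sum (s := fun i => 2 * (pullCount D ph r i - 0 + 1))
    (Q := fun i k => k = pullCount D ph r i) fun i => spec_ceil _ _ (Nat.zero_le _) ?_).mono ?_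
    fun _ hv => funext hv
  · rw [Nat.zero_add, Nat.ceil_le]
    refine mul_le_of_le_one_right (Nat.cast_nonneg _) ?_
    rw [← h.2.2.1]
    exact Finset.single_le_sum (fun j _ => h.1 j) (Finset.mem_univ i)
  · simp only [Nat.sub_zero, Finset.sum_add_distrib, ← Finset.mul_sum]
    simp
    omega

variable [NeZero n] {φ : Fin n → Fin D → ℝ} {ρ : Finset (Fin n) → Fin n → ℝ}

/-- The program carries out phased elimination from phase `ph` on. -/
lemma runs_phaseLoop (hD : 1 ≤ D) (hDn : D ≤ n) (hρ : IsDesignRule φ ρ)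
    (hdes : ∀ (S : Finset (Fin n)) (a : Fin n) (l : List (Fin n)),
      (List.finRange n).filter (· ∈ S) = a :: l → HasDesign K φ a l (ρ S))
    {T : ℕ} (hT : firstPhase D ≤ T) {R : ℝ} (hR : 0 ≤ R) (δ : ℝ) (y : ℕ → Fin n → ℝ)
    (fuel ph N : ℕ) (hfuel : fuel + ph = T) (hN : 0 < N)
    (hNT : (phases φ ρ T R δ y ph).2.length + N = T)
    (hph : ph = 0 ∨ phaseLength D (ph - 1) ≤ T) :
    Runs K y (phaseLoop φ R (confidence n T δ) fuel ph
      ((List.finRange n).filter (· ∈ (phases φ ρ T R δ y ph).1)) N)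
      (phases φ ρ T R δ y ph).2.length (phaseCost n D T * (Nat.log 2 T + 2 - ph)) ()
      (((phases φ ρ T R δ y T).2.drop (phases φ ρ T R δ y ph).2.length).take N) := by
  induction fuel generalizing ph N with
  | zero =>
    have := le_length_phases hρ hD T hR δ y ph
    omega
  | succ fuel ih =>
    have hne := phases_nonempty φ ρ δ hR (T := T) y ph
    set S := (phases φ ρ T R δ y ph).1 with hSdef
    set past := (phases φ ρ T R δ y ph).2 with hpast
    rcases hfil : (List.finRange n).filter (· ∈ S) with _ | ⟨a, l⟩
    · obtain ⟨i, hi⟩ := hne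
      have : i ∈ (List.finRange n).filter (· ∈ S) := by simp [hi]
      rw [hfil] at this
      simp at this
    obtain ⟨el, d₀, d, h1, h2, h3, h4, h5, h6⟩ := hdes S a l hfil
    have hdesign := hρ S hne
    have hmem : ∀ i, i ∈ a :: l ↔ i ∈ S := by
      intro i
      rw [← hfil]
      simp
    have hnodup : (a :: l).Nodup := by
      rw [← hfil]
      exact (List.nodup_finRange n).filter _
    have hlen : (a :: l).length ≤ n := by simpa using hnodup.length_le_card
    have hlen' : l.length ≤ n := (Nat.le_succ _).trans hlen
    set m := phaseLength D ph with hm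
    have hm0 : (0 : ℝ) < m := by exact_mod_cast phaseLength_pos hD ph
    have hmT : m ≤ 2 * T := by
      rcases Nat.eq_zero_or_pos ph with h0 | h0
      · rw [hm, h0]
        unfold phaseLength
        omega
      · have := hph.resolve_left h0.ne'
        obtain ⟨k, rfl⟩ : ∃ k, ph = k + 1 := ⟨ph - 1, by omega⟩
        rw [hm, phaseLength_succ]
        rw [Nat.add_sub_cancel] at this
        omega
    have hphT : ph ≤ Nat.log 2 T + 1 := by
      rcases hph with h0 | h0
      · omega
      · have := le_log_of_phaseLength_le hD h0
        omega
    set u := pullCount D ph (ρ S) with hu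
    obtain ⟨H, hH, hHinv⟩ := spec_updates (K := K) (h5.div hm0.ne') hnodup
      (fun i => mul_nonneg hm0.le (by rw [h4]; exact hdesign.1 i)) (u := u)
      (fun i => by rw [h4]; exact Nat.le_ceil _)
      (fun i hi => by
        have h0 := hdesign.2.1 i fun hS => hi ((hmem i).2 hS)
        rw [h4, hu]
        simp [pullCount, h0]) hD
    have hu0 : ∀ i, i ∉ a :: l → (u i : ℝ) = 0 := by
      intro i hi
      have h0 := hdesign.2.1 i fun hS => hi ((hmem i).2 hS)
      rw [hu]
      simp [pullCount, h0]
    set new := pullList u with hnew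
    have hnew1 : m ≤ new.length := phaseLength_le_length ph hdesign.2.2.1
    have hnewle : (new.take N).length ≤ T := (List.length_take_le _ _).trans (by omega)
    have hsucc : (phases φ ρ T R δ y (ph + 1)).2 = past ++ new := rfl
    obtain ⟨rest, hrest⟩ := phases_prefix φ ρ T R δ y (show ph + 1 ≤ T by omega)
    rw [hsucc] at hrest
    have hdrop : (phases φ ρ T R δ y T).2.drop past.length = new ++ rest := by
      rw [← hrest, List.append_assoc, List.drop_left]
    rw [hdrop]
    set q := phaseCost n D T with hq
    have hsteps : q * (Nat.log 2 T + 2 - ph) =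
        q + q * (Nat.log 2 T + 2 - (ph + 1)) := by
      obtain ⟨k, hk⟩ : ∃ k, Nat.log 2 T + 2 - ph = k + 1 :=
        ⟨Nat.log 2 T + 2 - ph - 1, by omega⟩
      rw [show Nat.log 2 T + 2 - (ph + 1) = k by omega, hk]
      ring
    set q' := q * (Nat.log 2 T + 2 - (ph + 1)) with hq'
    -- the costs of the parts of a phase, in the order of the program
    set e1 := 21 * (n * D ^ 2) with he1
    set e2 := 16 * (n * D) with he2
    set e3 := 15 * D * (1 + Nat.log 2 (Nat.log 2 D + 1)) * (35 * (n * D)) with he3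
    set e4 := n * 2 with he4
    set e5 := 4 * m + 3 * n with he5
    set e6 := D * (D * 2 + 1) with he6
    set e7 := n * (18 * D ^ 2 + 3) with he7
    set e8 := D * 2 with he8
    set e9 := T * (3 * D + 2) with he9
    set e10 := D * (3 * D + 2) with he10
    set e11 := n * (3 * D + 2) with he11
    have hcost : e1 + e2 + e3 + 1 + e4 + e5 + e6 + e7 + e8 + e9 + e10 + e11 + 2 * n + 7 + n * 3
        ≤ q := le_phaseCost hD hDn hmT
    rw [hsteps]
    refine h1.runs_bind (s' := q - e1 + q') ?_ (by omega)
    refine h2.runs_bind (s' := q - e1 - e2 + q') ?_ (by omega)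
    refine h3.runs_bind (s' := q - e1 - e2 - e3 + q') ?_ (by omega)
    refine (spec_nat _).runs_bind (s' := q - e1 - e2 - e3 - 1 + q') ?_ (by omega)
    refine (spec_tab_eq (s := 1) (v := fun i => (m : ℝ) * d.weight i) (fun i => spec_mul _ _)
      le_rfl : Spec K _ e4 _).runs_bind (s' := q - e1 - e2 - e3 - 1 - e4 + q') ?_ (by omega)
    refine (show Spec K (tab n fun i => ceil ((m : ℝ) * d.weight i) m 0) e5 (· = u) by
      rw [h4]; exact spec_pullCounts hdesign ph).runs_bind
      (s' := q - e1 - e2 - e3 - 1 - e4 - e5 + q') ?_ (by omega)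
    refine (spec_tab₂_eq (s := 1) (v := fun i j => d.inv i j / (m : ℝ))
      (fun i j => spec_div _ _) le_rfl : Spec K _ e6 _).runs_bind
      (s' := q - e1 - e2 - e3 - 1 - e4 - e5 - e6 + q') ?_ (by omega)
    refine hH.runs_bind (s' := q - e1 - e2 - e3 - 1 - e4 - e5 - e6 - e7 + q') ?_ (by omega)
    refine (spec_tab_eq (s := 1) (v := fun _ => ((0 : ℕ) : ℝ)) (fun _ => spec_nat 0) le_rfl :
      Spec K _ e8 _).runs_bind (s' := q - e1 - e2 - e3 - 1 - e4 - e5 - e6 - e7 - e8 + q') ?_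
      (by omega)
    have htake : (new ++ rest).take N = new.take N ++ rest.take (N - new.length) :=
      List.take_append
    rw [htake]
    have hpulls := runs_pulls (K := K) y el.coord (new.take N) (fun _ => ((0 : ℕ) : ℝ)) past.length
    refine Runs.bind (s := e9)
      (s' := q - e1 - e2 - e3 - 1 - e4 - e5 - e6 - e7 - e8 - e9 + q') (?_ : Runs K y _ _ e9
        ((fun _ => ((0 : ℕ) : ℝ)) + ∑ s : Fin (new.take N).length,
          y (past.length + s) ((new.take N).get s) • el.coord ((new.take N).get s))
        (new.take N)) ?_ (by omega)
    · obtain ⟨k, hk, he⟩ := hpulls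
      exact ⟨k, hk.trans (Nat.mul_le_mul_right _ hnewle), he⟩
    clear hpulls
    by_cases hlast : N ≤ (new.take N).length
    · have hN' : N ≤ new.length := hlast.trans (List.length_take_le' _ _)
      rw [if_pos hlast, Nat.sub_eq_zero_of_le hN', List.take_zero]
      exact Runs.ret
    · have hN' : new.length < N := by
        rw [List.length_take] at hlast
        omega
      rw [if_neg hlast]
      have hall : new.take N = new := List.take_of_length_le hN'.le
      rw [hall]
      set b : Fin D → ℝ := (fun _ => ((0 : ℕ) : ℝ)) + ∑ s : Fin new.length,
        y (past.length + s) (new.get s) • el.coord (new.get s) with hb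
      have hb' : b = ∑ s : Fin new.length,
          y (past.length + s) (new.get s) • el.coord (new.get s) := by
        rw [hb]
        have : (fun _ => ((0 : ℕ) : ℝ)) = (0 : Fin D → ℝ) := by
          funext j
          exact Nat.cast_zero
        rw [this, zero_add]
      set θ := leastSquares φ new fun s => y (past.length + s) (new.get s) with hθ
      set score : Fin n → ℝ := fun i => el.coord i ⬝ᵥ Matrix.of H *ᵥ b with hscore
      have hscore' : ∀ i ∈ S, score i = θ ⬝ᵥ φ i := by
        intro i hi
        rw [hscore]
        simp only
        rw [hb']
        exact dotProduct_mulVec_eq_leastSquares hHinv (h6 _ hu0) ((hmem i).2 hi) _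
      refine (spec_mulVec _ _).runs_bind (s' := q - e1 - e2 - e3 - 1 - e4 - e5 - e6 - e7 - e8 -
        e9 - e10 + q') ?_ (by omega)
      refine (spec_tab_eq (s := 3 * D + 1) (v := score) (fun i => spec_dot _ _) le_rfl :
        Spec K _ e11 _).runs_bind (s' := q - e1 - e2 - e3 - 1 - e4 - e5 - e6 - e7 - e8 - e9 -
        e10 - e11 + q') ?_ (by omega)
      obtain ⟨best, hbest, hbestS, hmax⟩ := (spec_argmax (K := K) score a l).exists_eq
      refine hbest.runs_bind (s' := q' + n * 3 + 7) ?_ (by omega)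
      refine (spec_nat _).runs_bind (s' := q' + n * 3 + 6) ?_ (by omega)
      refine (spec_mul _ _).runs_bind (s' := q' + n * 3 + 5) ?_ (by omega)
      refine (spec_nat _).runs_bind (s' := q' + n * 3 + 4) ?_ (by omega)
      refine (spec_div _ _).runs_bind (s' := q' + n * 3 + 3) ?_ (by omega)
      refine (spec_mul _ _).runs_bind (s' := q' + n * 3 + 2) ?_ (by omega)
      refine (spec_sqrt _).runs_bind (s' := q' + n * 3 + 1) ?_ (by omega)
      refine (spec_mul _ _).runs_bind (s' := q' + n * 3) ?_ (by omega)
      have hthr : ((4 : ℕ) : ℝ) * R * Real.sqrt ((D : ℝ) / (m : ℝ) * confidence n T δ) =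
          threshold n D T R δ ph := by
        rw [Nat.cast_ofNat]
        rfl
      rw [hthr]
      refine (spec_eliminate _ _ _ _).runs_bind (s' := q') ?_ (by omega)
      have hS' : (a :: l).filter (fun i => score best - score i ≤ threshold n D T R δ ph) =
          (List.finRange n).filter (· ∈ (phases φ ρ T R δ y (ph + 1)).1) := by
        rw [← hfil, List.filter_filter]
        refine List.filter_congr fun i _ => ?_
        rw [phases_succ, ← Bool.decide_and, decide_eq_decide, Finset.mem_filter]
        rw [and_comm]
        refine and_congr_right fun hi => ?_
        rw [hscore' best ((hmem _).1 hbestS), hscore' i hi]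
        constructor
        · intro h j hj
          refine le_trans (sub_le_sub_right ?_ _) h
          have := hmax j ((hmem j).2 hj)
          rwa [hscore' j hj, hscore' best ((hmem _).1 hbestS)] at this
        · intro h
          exact h best ((hmem _).1 hbestS)
      have hnext := ih (ph + 1) (N - new.length) (by omega) (by omega)
        (by rw [hsucc, List.length_append]; omega) (Or.inr (by
          rw [Nat.add_sub_cancel]
          omega))
      rw [hsucc, ← hrest, List.drop_left, List.length_append] at hnext
      rw [hS']
      exact hnext

end Phase

/-! ### The number of steps of the program -/

section Program

variable {n : ℕ} {K : Fin n → Fin n → ℝ}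

lemma runs_pullLoop (y : ℕ → Fin n → ℝ) (ξ : ℕ → Fin n) (l : List ℕ) (t : ℕ) :
    Runs K y (loop l () fun _ t => do
      let _ ← pullArm (V := ℝ) (ξ t)
      pure ()) t (2 * l.length) () (l.map ξ) := by
  induction l generalizing t with
  | nil => exact Runs.ret
  | cons i l ih =>
    exact ((runs_pullArm (ξ i) t).bind (l := [ξ i]) (l' := []) (s' := 0) (b := 1) Runs.ret
      le_rfl).bind (l' := l.map ξ) ((ih (t + 1)).tick (b := 2 * l.length + 1) le_rfl)
      (by rw [List.length_cons]; omega)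

lemma phaseCost_mul_le {n D T : ℕ} (hD : 1 ≤ D) (hn : 1 ≤ n) (hDT : D ≤ T) :
    ((6 + 40 * (n * D ^ 2) + phaseCost n D T * (Nat.log 2 T + 2) : ℕ) : ℝ) ≤
      3000 * (1 + Real.log T) ^ 2 * ((n + T) * D ^ 2) := by
  have hT : 1 ≤ T := hD.trans hDT
  have hlog := natLog_le hT
  have hlogT : 0 ≤ Real.log T := Real.log_nonneg (by exact_mod_cast hT)
  have hk : Nat.log 2 (Nat.log 2 D + 1) ≤ Nat.log 2 T := by
    refine Nat.log_mono_right (le_trans ?_ hDT)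
    exact Nat.log_lt_self 2 (by omega)
  set Λ := 1 + Real.log T with hΛ
  have hk' : (1 : ℝ) + (Nat.log 2 (Nat.log 2 D + 1) : ℕ) ≤ 2 * Λ := by
    have : ((Nat.log 2 (Nat.log 2 D + 1) : ℕ) : ℝ) ≤ Nat.log 2 T := by exact_mod_cast hk
    linarith
  have hΛ1 : 1 ≤ Λ := by linarith
  have hD' : (1 : ℝ) ≤ D := by exact_mod_cast hD
  have hn' : (1 : ℝ) ≤ n := by exact_mod_cast hn
  set Z : ℝ := (n + T) * D ^ 2 with hZ
  have hT0 : (0 : ℝ) ≤ T := Nat.cast_nonneg T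
  have hZ1 : (n : ℝ) * D ^ 2 ≤ Z := by
    rw [hZ]
    gcongr
    linarith
  have hTD : (T : ℝ) * D ≤ Z - n * D ^ 2 := by
    rw [hZ]
    nlinarith [mul_nonneg hT0 (sub_nonneg.2 hD')]
  have hone : 1 ≤ (n : ℝ) * D ^ 2 := one_le_mul_of_one_le_of_one_le hn' (one_le_pow₀ hD')
  have hcost : (phaseCost n D T : ℝ) ≤ 1400 * Λ * Z := by
    unfold phaseCost
    push_cast
    calc 700 * (1 + (Nat.log 2 (Nat.log 2 D + 1) : ℕ) : ℝ) * (n * D ^ 2) + 13 * (T * D)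
        ≤ 700 * (2 * Λ) * (n * D ^ 2) + 1400 * Λ * (T * D) := by
          gcongr
          linarith
      _ ≤ 700 * (2 * Λ) * (n * D ^ 2) + 1400 * Λ * (Z - n * D ^ 2) := by gcongr
      _ = _ := by ring
  have hΛ2 : 1 ≤ Λ ^ 2 := one_le_pow₀ hΛ1
  push_cast
  calc 6 + 40 * ((n : ℝ) * D ^ 2) + phaseCost n D T * ((Nat.log 2 T : ℕ) + 2)
      ≤ 6 * Z + 40 * Z + 1400 * Λ * Z * (2 * Λ) := by
        gcongr
        linarith
    _ = 46 * 1 * Z + 2800 * Λ ^ 2 * Z := by ring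
    _ ≤ 46 * Λ ^ 2 * Z + 2800 * Λ ^ 2 * Z := by gcongr
    _ ≤ 3000 * Λ ^ 2 * Z := by nlinarith [mul_nonneg (sq_nonneg Λ) (by linarith : 0 ≤ Z)]

/-- The program carries out APG-PE, for some way to break ties and some choice of designs, within
the claimed number of steps. -/
lemma exists_apgPE_steps_le [NeZero n] (hK : (Matrix.of K).PosSemidef) {T : ℕ} (hT : 1 ≤ T)
    {R α : ℝ} (δ : ℝ) (hR : 0 ≤ R) (hα : 0 < α) :
    ∃ (ξ : ℕ → Fin n) (D : ℕ) (ρ : Finset (Fin n) → Fin n → ℝ),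
      IsPGreedy K (α / (T : ℝ) ^ (1 / 2 : ℝ)) ξ D ∧ IsDesignRule (feature K ξ D) ρ ∧
      ∀ y : ℕ → Fin n → ℝ,
        ((apgPE T R α δ).exec K y 0).pulled = arms K ξ D ρ T R δ y ∧
        (((apgPE T R α δ).exec K y 0).steps : ℝ) ≤
          3000 * (1 + Real.log T) ^ 2 * ((n + T) * D ^ 2) := by
  have hn : 1 ≤ n := Nat.one_le_iff_ne_zero.2 (NeZero.ne n)
  have hT' : (1 : ℝ) ≤ T := by exact_mod_cast hT
  obtain ⟨κ, hκ⟩ := exists_inner_eq_of_posSemidef hK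
  have he : 0 < α / (T : ℝ) ^ (1 / 2 : ℝ) := by positivity
  have he2 : α * α / T = (α / (T : ℝ) ^ (1 / 2 : ℝ)) ^ 2 := by
    rw [← Real.sqrt_eq_rpow, div_pow, Real.sq_sqrt (by linarith), sq]
  obtain ⟨st, hgreedy, hDn, hfeature, hspec⟩ := spec_greedy hκ he
  rw [← he2] at hspec
  set D := st.basis.length with hDdef
  have hD : 1 ≤ D := hgreedy.1
  obtain ⟨ρ, hρ, hdes⟩ := exists_designRule K
    (feature K (fun m => st.points.getD m 0) D) hD hDn
  refine ⟨fun m => st.points.getD m 0, D, ρ, hgreedy, hρ, fun y => ?_⟩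
  -- the statement about the execution, for a suitable number of steps
  suffices h : ∃ s : ℕ, (s : ℝ) ≤ 3000 * (1 + Real.log T) ^ 2 * ((n + T) * D ^ 2) ∧
      Runs K y (apgPE T R α δ) 0 s ()
        (arms K (fun m => st.points.getD m 0) D ρ T R δ y) by
    obtain ⟨s, hs, k, hk, hexec⟩ := h
    rw [hexec]
    refine ⟨rfl, le_trans ?_ hs⟩
    exact_mod_cast hk
  by_cases hphase : T ≤ firstPhase D
  · refine ⟨3 + 40 * (n * D ^ 2) + 2 * T, ?_, ?_⟩
    · have hΛ : 1 ≤ (1 + Real.log T) ^ 2 := one_le_pow₀ (by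
        linarith [Real.log_nonneg hT'])
      have hD2 : (1 : ℝ) ≤ (D : ℝ) ^ 2 := one_le_pow₀ (by exact_mod_cast hD)
      have hn' : (1 : ℝ) ≤ n := by exact_mod_cast hn
      push_cast
      have h1 : (1 : ℝ) ≤ n * D ^ 2 := one_le_mul_of_one_le_of_one_le hn' hD2
      have h2 : (T : ℝ) ≤ T * D ^ 2 := le_mul_of_one_le_right (by linarith) hD2
      calc 3 + 40 * ((n : ℝ) * D ^ 2) + 2 * T ≤ 3000 * 1 * ((n + T) * D ^ 2) := by nlinarith
        _ ≤ _ := by gcongr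
    · refine (spec_mul _ _).runs_bind (s' := 2 + 40 * (n * D ^ 2) + 2 * T) ?_ (by omega)
      refine (spec_nat _).runs_bind (s' := 1 + 40 * (n * D ^ 2) + 2 * T) ?_ (by omega)
      refine (spec_div _ _).runs_bind (s' := 40 * (n * D ^ 2) + 2 * T) ?_ (by omega)
      refine hspec.runs_bind (s' := 2 * T) ?_ le_rfl
      unfold arms
      rw [if_pos hphase]
      simp only [← hDdef, if_pos hphase]
      have := runs_pullLoop (K := K) y (fun t => st.points.getD (t % D) 0) (List.range T) 0
      rwa [List.length_range] at this
  · have hlt := not_le.1 hphase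
    have hDT : D ≤ T := by
      refine le_trans ?_ hlt.le
      unfold firstPhase
      nlinarith
    refine ⟨_, phaseCost_mul_le hD hn hDT, ?_⟩
    set q := phaseCost n D T * (Nat.log 2 T + 2) with hq
    refine (spec_mul _ _).runs_bind (s' := 5 + 40 * (n * D ^ 2) + q) ?_ (by omega)
    refine (spec_nat _).runs_bind (s' := 4 + 40 * (n * D ^ 2) + q) ?_ (by omega)
    refine (spec_div _ _).runs_bind (s' := 3 + 40 * (n * D ^ 2) + q) ?_ (by omega)
    refine hspec.runs_bind (s' := 3 + q) ?_ (by omega)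
    unfold arms
    rw [if_neg hphase]
    simp only [if_neg hphase]
    refine (spec_nat _).runs_bind (s' := 2 + q) ?_ (by omega)
    refine (spec_div _ _).runs_bind (s' := 1 + q) ?_ (by omega)
    refine (spec_log _).runs_bind (s' := q) ?_ (by omega)
    have hconf : Real.log (((2 * n * (Nat.log 2 T + 1) : ℕ) : ℝ) / δ) = confidence n T δ := by
      unfold confidence
      push_cast
      rfl
    rw [hconf]
    have h := runs_phaseLoop hD hDn hρ hdes hlt.le hR δ y T 0 T (by omega) hT
      (by simp [phases]) (Or.inl rfl)
    rw [← hfeature] at h ⊢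
    simp only [phases, List.length_nil, List.drop_zero, Nat.sub_zero] at h
    convert h using 2
    simp

end Program

end APG

theorem mainTheorem2 :
    ∃ (C : ℝ) (c : ℕ),
      ∀ (d : ℕ) (Ω : Set (EuclideanSpace ℝ (Fin d))) (K : Ω → Ω → ℝ),
        APG.IsPosDefKernel K → (∀ x, K x x ≤ 1) →
      ∀ (n : ℕ) [NeZero n] (x : Fin n → Ω), Function.Injective x →
      ∀ (T : ℕ) (R : ℝ≥0) (α δ : ℝ), 1 ≤ T → 0 < α → 0 < δ → δ < 1 →
        -- the regret of APG-PE, for each way to break ties and each choice of the designs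
        (∀ (ξ : ℕ → Fin n) (D : ℕ) (ρ : Finset (Fin n) → Fin n → ℝ),
          APG.IsPGreedy (fun i j => K (x i) (x j)) (α / (T : ℝ) ^ (1 / 2 : ℝ)) ξ D →
          APG.IsDesignRule (APG.feature (fun i j => K (x i) (x j)) ξ D) ρ →
          ∀ (H : Type*) [NormedAddCommGroup H] [InnerProductSpace ℝ H] [CompleteSpace H]
            [RKHS ℝ H Ω ℝ], (∀ p q, RKHS.kernel H p q 1 = K p q) →
          ∀ (f : H) (B : ℝ), ‖f‖ ≤ B →
          ∀ (Ψ : Type*) [MeasurableSpace Ψ] (μ : MeasureTheory.Measure Ψ)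
            [MeasureTheory.IsProbabilityMeasure μ] (ε : ℕ → Ψ → ℝ),
            (∀ t, Measurable (ε t)) → ProbabilityTheory.iIndepFun ε μ →
            (∀ t, ProbabilityTheory.HasSubgaussianMGF (ε t) (R ^ 2) μ) →
            ENNReal.ofReal (1 - δ) ≤ μ {ψ |
              APG.regret (fun i => f (x i))
                (APG.arms (fun i j => K (x i) (x j)) ξ D ρ T R δ
                  fun t i => f (x i) + ε t ψ) ≤
              C * (R + (1 + α) * B) * (1 + Real.log T) ^ c *
                Real.sqrt (T * D * Real.log (n / δ))}) ∧
        -- the total computational complexity of APG-PE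
        (∃ (ξ : ℕ → Fin n) (D : ℕ) (ρ : Finset (Fin n) → Fin n → ℝ),
          APG.IsPGreedy (fun i j => K (x i) (x j)) (α / (T : ℝ) ^ (1 / 2 : ℝ)) ξ D ∧
          APG.IsDesignRule (APG.feature (fun i j => K (x i) (x j)) ξ D) ρ ∧
          ∀ y : ℕ → Fin n → ℝ,
            ((APG.apgPE T (R : ℝ) α δ).exec (fun i j => K (x i) (x j)) y 0).pulled =
              APG.arms (fun i j => K (x i) (x j)) ξ D ρ T R δ y ∧
            (((APG.apgPE T (R : ℝ) α δ).exec (fun i j => K (x i) (x j)) y 0).steps : ℝ) ≤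
              C * (1 + Real.log T) ^ c * ((n + T) * D ^ 2)) := by
  refine ⟨3000, 2, ?_⟩
  intro d Ω K hK hK1 n _ x hx T R α δ hT hα h0 h1
  have hlogT : 0 ≤ Real.log T := Real.log_nonneg (by exact_mod_cast hT)
  refine ⟨?_, ?_⟩
  · intro ξ D ρ hξ hρ H _ _ _ _ hker f B hf Ψ _ μ _ ε hmeas hind hsub
    refine (APG.measure_regret_le_of_rkhs hK1 x hT hα h0 h1 hξ hρ hker hf hmeas hind
      hsub).trans (MeasureTheory.measure_mono fun ψ hψ => ?_)
    rw [Set.mem_ofPred_eq] at hψ ⊢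
    refine hψ.trans ?_
    have hB0 : 0 ≤ B := (norm_nonneg f).trans hf
    have hR : (0 : ℝ) ≤ R := R.2
    gcongr
    norm_num
  · exact APG.exists_apgPE_steps_le (hK.2 n x hx).posSemidef hT δ R.2 hα
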